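/- **Notation.** For positive integers $n,h$ with $h\mid\gcd(n,24)$ and for $e$ exactly dividing $n/h$ (that is, $e\mid n/h$ and $\gcd(e,\tfrac{n}{he})=1$), let $w_e$ be the set of matrices $\begin{pmatrix} ae & b/h\\ cn & de\end{pmatrix}$ with $a,b,c,d\in\mathbb Z$ and determinant $e$, regarded (after division by $\sqrt e$) as elements of $\mathrm{SL}_2(\mathbb R)$. Put $\Gamma_0(n|h)=w_1$, and let $n|h{+}e_1,e_2,\dots$ denote the group generated by $w_1,w_{e_1},w_{e_2},\dots$; the part "$|h$" is omitted when $h=1$. For such a group $\Gamma$ put $N=nh$, and for $e$ exactly dividing $N$ let $W_e$ be any matrix $\begin{pmatrix} ae & b\\ cN& de\end{pmatrix}$ with $a,b,c,d\in\mathbb Z$ and determinant $e$. Let $\lambda$ be the homomorphism from $\Gamma$ to the $h$-th roots of unity given by Conway and Norton's rule: $\lambda=1$ on $\Gamma_0(N)$; $\lambda(W_e)=1$ whenever $e$ exactly divides $N$, $W_e\in\Gamma$ and every prime dividing $e$ divides $n/h$; $\lambda\begin{pmatrix}1&1/h\\0&1\end{pmatrix}=e^{-2\pi i/h}$; and $\lambda\begin{pmatrix}1&0\\n&1\end{pmatrix}=e^{\pm2\pi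 i/h}$, with sign $+$ if and only if $\tau\mapsto-1/(N\tau)$ lies in $\Gamma$. Let $\Gamma_\lambda=\ker\lambda$. The *normalized Hauptmodul* $\mathcal T$ on $\Gamma_\lambda$ is the generator of the function field of the genus zero curve $\Gamma_\lambda\backslash\mathbb H^*$ that is bounded away from the cusp $\infty$ and has $q$-expansion $q^{-1}+O(q)$ at $\infty$, where $q=e^{2\pi i\tau}$. For a prime $p$ let $\big(\sum a(m)q^m\big)|U_p=\sum a(pm)q^m$, and for a series $f=\sum a(m)q^m$ with rational coefficients let $v_p(f)=\inf_m v_p(a(m))$. **Proposition 4.6.** Let $(\Gamma,p,\alpha)$ be one of $$(6{+}2,\,3,\,\tfrac32),\quad (6{+}3,\,2,\,1),\quad (10{+}5,\,2,\,\tfrac32),\quad (22{+}11,\,2,\,\tfrac12),\quad (6|3,\,2,\,\tfrac32),\quad (24|4{+}2,\,3,\,\tfrac12),$$ and let $\mathcal T$ be the normalized Hauptmodul on $\Gamma_\lambda$. Then $\mathcal T$ has rational $q$-coefficients, and for every integer $n\ge 0$ $$v_p\big(\mathcal T|U_p^n\big)\ \ge\ \lfloor n\alpha\rfloor .$$ 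-/

import Mathlib

noncomputable section

namespace Moonshine

open UpperHalfPlane
open scoped MatrixGroups

/-- `d` exactly divides `m`: `d ∣ m` and `gcd(d, m / d) = 1`. -/
def ExactDvd (d m : ℕ) : Prop := d ∣ m ∧ Nat.Coprime d (m / d)

/-- The set `w_e` attached to `n | h`: the matrices `(a e, b / h; c n, d e)` with integers
`a, b, c, d` and determinant `e`, scaled by `1 / √e` so as to lie in `SL(2, ℝ)`.
For `h = 1` these are the Atkin-Lehner involutions `W_e` of level `n`; in particular
`wSet N 1 1` is `Γ₀(N)`, and `wSet n h 1` is `Γ₀(n | h)`. -/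
def wSet (n h e : ℕ) : Set SL(2, ℝ) :=
  {g | ∃ a b c d : ℤ, Real.sqrt e • (g : Matrix (Fin 2) (Fin 2) ℝ) =
    !![(a : ℝ) * e, (b : ℝ) / h; (c : ℝ) * n, (d : ℝ) * e]}

/-- The group `Γ₀(n | h) + e₁, e₂, …` with `S = {e₁, e₂, …}`, generated by `w_1 = Γ₀(n | h)` and
the `w_e` with `e ∈ S`. -/
def nhGroup (n h : ℕ) (S : Finset ℕ) : Subgroup SL(2, ℝ) :=
  Subgroup.closure (wSet n h 1 ∪ ⋃ e ∈ S, wSet n h e)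

/-- `e ∈ AL(Γ)` for a group `Γ` of type `n | h`: `e` exactly divides `n h`, the Atkin-Lehner
involutions `W_e` of level `n h` lie in `Γ`, and every prime dividing `e` divides `n / h`. -/
def IsAL (n h : ℕ) (Γ : Subgroup SL(2, ℝ)) (e : ℕ) : Prop :=
  ExactDvd e (n * h) ∧ wSet (n * h) 1 e ⊆ Γ ∧ ∀ q : ℕ, q.Prime → q ∣ e → q ∣ n / h

/-- The Fricke involution `τ ↦ -1 / (N τ)` belongs to `Γ`. -/
def HasFricke (N : ℕ) (Γ : Subgroup SL(2, ℝ)) : Prop :=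
  ∃ g ∈ Γ, Real.sqrt N • (g : Matrix (Fin 2) (Fin 2) ℝ) = !![0, -1; (N : ℝ), 0]

/-- Conway and Norton's rule for the homomorphism `lam` from a group `Γ` of type `n | h` to the
`h`-th roots of unity. -/
structure IsConwayNorton (n h : ℕ) (Γ : Subgroup SL(2, ℝ)) (lam : Γ →* rootsOfUnity h ℂ) :
    Prop where
  /-- `lam = 1` on `Γ₀(n h)`. -/
  level : ∀ g : Γ, (g : SL(2, ℝ)) ∈ wSet (n * h) 1 1 → lam g = 1
  /-- `lam = 1` on the `W_e` with `e ∈ AL(Γ)`. -/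
  atkinLehner : ∀ e : ℕ, IsAL n h Γ e →
    ∀ g : Γ, (g : SL(2, ℝ)) ∈ wSet (n * h) 1 e → lam g = 1
  /-- `lam = exp(-2πi/h)` at `x = (1, 1/h; 0, 1)`. -/
  x_eq : ∀ g : Γ, ((g : SL(2, ℝ)) : Matrix (Fin 2) (Fin 2) ℝ) = !![1, 1 / (h : ℝ); 0, 1] →
    ((lam g : ℂˣ) : ℂ) = Complex.exp (-(2 * Real.pi * Complex.I / h))
  /-- `lam = exp(2πi/h)` at `y = (1, 0; n, 1)` if `Γ` contains the Fricke involution. -/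
  y_eq_of_fricke : HasFricke (n * h) Γ →
    ∀ g : Γ, ((g : SL(2, ℝ)) : Matrix (Fin 2) (Fin 2) ℝ) = !![1, 0; (n : ℝ), 1] →
      ((lam g : ℂˣ) : ℂ) = Complex.exp (2 * Real.pi * Complex.I / h)
  /-- `lam = exp(-2πi/h)` at `y = (1, 0; n, 1)` if `Γ` does not contain the Fricke involution. -/
  y_eq_of_not_fricke : ¬ HasFricke (n * h) Γ →
    ∀ g : Γ, ((g : SL(2, ℝ)) : Matrix (Fin 2) (Fin 2) ℝ) = !![1, 0; (n : ℝ), 1] →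
      ((lam g : ℂˣ) : ℂ) = Complex.exp (-(2 * Real.pi * Complex.I / h))

/-- The fixing group `Γ_λ` of `Γ = Γ₀(n | h) + S`, as a subgroup of `GL(2, ℝ)`: the kernel of the
map `λ` given by Conway and Norton's rule. (The rule prescribes `λ` on generators of `Γ`, so at
most one `λ` obeys it, and the infimum is over a single map whenever the rule is consistent.) -/
def fixingGroup (n h : ℕ) (S : Finset ℕ) : Subgroup (GL (Fin 2) ℝ) :=
  ((⨅ lam : {lam : nhGroup n h S →* rootsOfUnity h ℂ // IsConwayNorton n h (nhGroup n h S) lam},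
    lam.1.ker).map (nhGroup n h S).subtype).map Matrix.SpecialLinearGroup.toGL

/-- `f` has the (everywhere convergent) `q`-expansion `f(τ) = ∑ a(m) q^m` over `m ∈ ℤ`, where
`q = exp(2πiτ)`. The family `a` is determined by `f`. -/
def HasQExpansion (f : ℍ → ℂ) (a : ℤ → ℂ) : Prop :=
  ∀ τ : ℍ, HasSum (fun m : ℤ => a m * Complex.exp (2 * Real.pi * Complex.I * m * τ)) (f τ)

/-- `f` is a modular function for `Γ`, that is, an element of the function field of `Γ \ ℍ*`:
meromorphic on `ℍ`, invariant under `Γ`, and meromorphic at each cusp of `Γ`. -/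
structure IsModularFunction (Γ : Subgroup (GL (Fin 2) ℝ)) (f : ℍ → ℂ) : Prop where
  meromorphic : MeromorphicOn (fun z : ℂ => f (ofComplex z)) {z : ℂ | 0 < z.im}
  invariant : ∀ g ∈ Γ, ∀ τ : ℍ, f (g • τ) = f τ
  cusps : ∀ c : OnePoint ℝ, IsCusp c Γ → ∀ g : GL (Fin 2) ℝ, g • OnePoint.infty = c →
    ∃ N : ℕ, (fun τ : ℍ => f (g • τ)) =O[atImInfty] (fun τ : ℍ => Real.exp (N * τ.im))

/-- `T` is the normalized Hauptmodul of the genus zero group `Γ`: a generator of the function field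
of `Γ \ ℍ*` that is bounded away from the cusp `∞` (so holomorphic on `ℍ`, and bounded at every
cusp not equivalent to `∞`), with `q`-expansion `q⁻¹ + O(q)` at `∞`. -/
structure IsNormalizedHauptmodul (Γ : Subgroup (GL (Fin 2) ℝ)) (T : ℍ → ℂ) : Prop where
  modular : IsModularFunction Γ T
  /-- Every modular function for `Γ` is a rational function `P(T) / Q(T)`, as an identity of
  meromorphic functions, that is, off a discrete closed subset of `ℍ`. -/
  generator : ∀ f : ℍ → ℂ, IsModularFunction Γ f → ∃ P Q : Polynomial ℂ, Q ≠ 0 ∧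
    ∀ᶠ z in Filter.codiscreteWithin {z : ℂ | 0 < z.im},
      f (ofComplex z) * Q.eval (T (ofComplex z)) = P.eval (T (ofComplex z))
  holomorphic : DifferentiableOn ℂ (fun z : ℂ => T (ofComplex z)) {z : ℂ | 0 < z.im}
  bounded : ∀ c : OnePoint ℝ, IsCusp c Γ → (¬ ∃ g ∈ Γ, g • OnePoint.infty = c) →
    c.IsBoundedAt T 0
  expansion : ∃ a : ℤ → ℂ, HasQExpansion T a ∧ a (-1) = 1 ∧ a 0 = 0 ∧ ∀ m : ℤ, m < -1 → a m = 0

/-- The operator `U_p` on `q`-expansions: `(∑ a(m) q^m) | U_p = ∑ a(p m) q^m`. -/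
def opU (p : ℕ) (a : ℤ → ℚ) : ℤ → ℚ := fun m => a (p * m)

/-- The `p`-adic valuation `v_p(f) = inf_m v_p(a(m))` of a series `f = ∑ a(m) q^m` with rational
coefficients, where `v_p(0) = ∞`. -/
def vSeries (p : ℕ) (a : ℤ → ℚ) : EReal :=
  ⨅ m : ℤ, if a m = 0 then ⊤ else (((padicValRat p (a m) : ℤ) : ℝ) : EReal)

end Moonshine

end

noncomputable section

namespace Moonshine

open UpperHalfPlane Filter Asymptotics ModularForm CongruenceSubgroup
open scoped MatrixGroups Topology Manifold PowerSeries Real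

/-! Every group in the table has the form Γ₀(pMh|h)+M, where M is 1 or a prime different from p, and
comes with an exponent r satisfying h·r·(p-1)·(M+1) = 24. The candidate for the Hauptmodul is the
eta quotient f = (η(hτ)η(hMτ) / (η(phτ)η(phMτ)))^r = q⁻¹ + ..., which has integral coefficients
(`fFun`).

Identification of T. The 24th power of f is a quotient of discriminants evaluated at hτ, hence
invariant under the whole group; f has a simple pole at ∞ and a simple zero at 0. Any λ obeying
Conway and Norton's rule is determined on Atkin-Lehner matrices by its values at x and y, and these
two values are equal or inverse to each other. So each such matrix can be moved into Γ_λ by a power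
of x, or by a power of y; this shows that ∞ and 0 represent all cusps up to translations. If c is
the value of T at 0, then ((T - c)/f)^24 is invariant under Γ_λ and bounded at all cusps, hence
constant, and (T - c)/f = 1 (`eq_fFun_add_const`, `hauptmodul_eq`). In particular f itself is
invariant under Γ_λ, and t(τ) = f(τ/h)^h is invariant under Γ₀(pM)+M (`alInvariant_of_hauptmodul`).
Neither existence nor uniqueness of λ enters.

Modular equation. Put s = 1/t. The symmetric functions of the s((τ+k)/p) are modular for Γ₀(pM)+M
and have poles at most at 0, so they are polynomials in s whose degree is bounded by the pole order.
Their coefficients are read off from ten coefficients of t and s. This gives a monic equation of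
degree p for s over ℤ[s(pτ)] (`modular_equation_two`, `modular_equation_three`). For h > 1 the
series σ = 1/f satisfies σ^h = s(q^h), and the equation for s factors; a nonvanishing cofactor is
cancelled to leave an equation for σ (`modular_equation_cube_root`, `modular_equation_fourth_root`).

Divisibility. The conjugates of σ over series in q^p are the σ(ζq), so p·U_p is the trace. The
equation thus yields a linear recurrence for U_p(σ^i), and shows that U_p(f) = c₀ + c·σ for integers
c₀ and c (`tailSeries_two`, `tailSeries_three`). The normalization of T removes constant terms, so
only the iterates of U_p on c·σ matter. They are controlled by the lattices spanned by p^e σ^j with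
A·j + w ≤ D·e: U_p raises w by a fixed δ, so each application gains δ/D = α in p-adic valuation
(`dvd_coeff_iterate_two`, `dvd_coeff_iterate_three`, `dvd_coeff_iterate_three_of_fourth_root`). -/

/-! ### Möbius transformations of the upper half plane. -/

/-- The real Möbius transformation with matrix `(a, b; c, d)` of positive determinant. -/
def glMat (a b c d : ℝ) (h : 0 < a * d - b * c) : GL (Fin 2) ℝ :=
  Matrix.GeneralLinearGroup.mkOfDetNeZero !![a, b; c, d] (by
    rw [Matrix.det_fin_two_of]; exact h.ne')

lemma coe_glMat (a b c d : ℝ) (h : 0 < a * d - b * c) :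
    ((glMat a b c d h : GL (Fin 2) ℝ) : Matrix (Fin 2) (Fin 2) ℝ) = !![a, b; c, d] := rfl

lemma coe_glMat_smul (a b c d : ℝ) (h : 0 < a * d - b * c) (τ : ℍ) :
    ((glMat a b c d h • τ : ℍ) : ℂ) = (a * τ + b) / (c * τ + d) := by
  rw [coe_smul_of_det_pos]
  · simp [num, denom, coe_glMat]
  · rw [Matrix.GeneralLinearGroup.val_det_apply, coe_glMat, Matrix.det_fin_two_of]; exact h

lemma denom_glMat_ne_zero {a b c d : ℝ} (h : 0 < a * d - b * c) (τ : ℍ) :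
    (c : ℂ) * τ + d ≠ 0 := by
  simpa [denom, coe_glMat] using denom_ne_zero (glMat a b c d h) τ

lemma glMat_smul_glMat_smul {a b c d a' b' c' d' : ℝ} (h : 0 < a * d - b * c)
    (h' : 0 < a' * d' - b' * c') (τ : ℍ) :
    glMat a b c d h • glMat a' b' c' d' h' • τ =
      glMat (a * a' + b * c') (a * b' + b * d') (c * a' + d * c') (c * b' + d * d')
        (by nlinarith [mul_pos h h']) • τ := by
  rw [smul_smul]
  congr 1
  apply Units.ext
  rw [Units.val_mul, coe_glMat, coe_glMat, coe_glMat, Matrix.mul_fin_two]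

lemma glMat_smul_eq {a b c d a' b' c' d' : ℝ} (h : 0 < a * d - b * c)
    (h' : 0 < a' * d' - b' * c') (k : ℝ) (hk : k ≠ 0) (ha : a = k * a') (hb : b = k * b')
    (hc : c = k * c') (hd : d = k * d') (τ : ℍ) :
    glMat a b c d h • τ = glMat a' b' c' d' h' • τ := by
  have := denom_glMat_ne_zero h' τ
  have hk' : (k : ℂ) ≠ 0 := by exact_mod_cast hk
  ext
  rw [coe_glMat_smul, coe_glMat_smul, ha, hb, hc, hd]
  push_cast
  rw [show (k : ℂ) * a' * τ + k * b' = k * (a' * τ + b') by ring,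
    show (k : ℂ) * c' * τ + k * d' = k * (c' * τ + d') by ring, mul_div_mul_left _ _ hk']

/-- `τ ↦ (τ + v) / w`. -/
def affine (v w : ℝ) (hw : 0 < w) (τ : ℍ) : ℍ := glMat 1 v 0 w (by linarith) • τ

lemma coe_affine (v w : ℝ) (hw : 0 < w) (τ : ℍ) : (affine v w hw τ : ℂ) = (τ + v) / w := by
  simp [affine, coe_glMat_smul]

lemma im_affine (v w : ℝ) (hw : 0 < w) (τ : ℍ) : (affine v w hw τ).im = τ.im / w := by
  rw [← coe_im, coe_affine, Complex.div_ofReal_im]; simp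

/-- `τ ↦ m τ`. -/
def scale (m : ℝ) (hm : 0 < m) (τ : ℍ) : ℍ := glMat m 0 0 1 (by linarith) • τ

lemma coe_scale (m : ℝ) (hm : 0 < m) (τ : ℍ) : (scale m hm τ : ℂ) = m * τ := by
  simp [scale, coe_glMat_smul]

lemma im_scale (m : ℝ) (hm : 0 < m) (τ : ℍ) : (scale m hm τ).im = m * τ.im := by
  rw [← coe_im, coe_scale]; simp

lemma sl_smul_eq_glMat (γ : SL(2, ℤ)) (τ : ℍ) :
    γ • τ = glMat (γ 0 0 : ℤ) (γ 0 1 : ℤ) (γ 1 0 : ℤ) (γ 1 1 : ℤ) (by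
      have := γ.det_coe
      rw [Matrix.det_fin_two] at this
      have h : ((γ 0 0 : ℤ) * (γ 1 1 : ℤ) - (γ 0 1 : ℤ) * (γ 1 0 : ℤ) : ℝ) = 1 := by
        exact_mod_cast this
      rw [h]; exact one_pos) • τ := by
  ext
  rw [coe_glMat_smul, coe_specialLinearGroup_apply]
  simp

lemma tendsto_im_atImInfty_iff {α : Type*} {l : Filter α} {f : α → ℍ} :
    Tendsto f l atImInfty ↔ Tendsto (fun x => (f x).im) l atTop := by
  rw [atImInfty, tendsto_comap_iff]; rfl

lemma tendsto_affine (v w : ℝ) (hw : 0 < w) : Tendsto (affine v w hw) atImInfty atImInfty := by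
  rw [tendsto_im_atImInfty_iff]
  simp only [im_affine]
  exact (tendsto_im_atImInfty_iff.1 tendsto_id).atTop_div_const hw

lemma tendsto_scale (m : ℝ) (hm : 0 < m) : Tendsto (scale m hm) atImInfty atImInfty := by
  rw [tendsto_im_atImInfty_iff]
  simp only [im_scale]
  exact (tendsto_im_atImInfty_iff.1 tendsto_id).const_mul_atTop hm

/-! ### Holomorphic functions and boundedness at cusps. -/

/-- A holomorphic function on `ℍ`. -/
def Holo (f : ℍ → ℂ) : Prop := DifferentiableOn ℂ (fun z : ℂ => f (ofComplex z)) {z : ℂ | 0 < z.im}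

lemma Holo.mdiff {f : ℍ → ℂ} (hf : Holo f) : MDiff f := mdifferentiable_iff.2 hf

lemma Holo.comp_smul {f : ℍ → ℂ} (hf : Holo f) {a b c d : ℝ} (h : 0 < a * d - b * c) :
    Holo (fun τ => f (glMat a b c d h • τ)) := by
  have h1 : DifferentiableOn ℂ (fun z : ℂ => ((a : ℂ) * z + b) / (c * z + d))
      {z : ℂ | 0 < z.im} := by
    apply DifferentiableOn.div (by fun_prop) (by fun_prop)
    intro z hz
    exact denom_glMat_ne_zero h ⟨z, hz⟩
  have h2 : ∀ z : ℂ, ∀ hz : 0 < z.im, ((a : ℂ) * z + b) / (c * z + d) =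
      (glMat a b c d h • (⟨z, hz⟩ : ℍ) : ℍ) := fun z hz => by rw [coe_glMat_smul]
  refine (hf.comp h1 ?_).congr ?_
  · intro z hz
    change 0 < (((a : ℂ) * z + b) / (c * z + d)).im
    rw [h2 z hz]
    exact (glMat a b c d h • (⟨z, hz⟩ : ℍ) : ℍ).im_pos
  · intro z hz
    simp only [Function.comp]
    rw [h2 z hz, ofComplex_apply, ofComplex_apply_of_im_pos hz]

/-- A holomorphic function on `ℍ` invariant under `Γ₀(N)` and bounded at all cusps is constant. -/
lemma const_of_bounded {N : ℕ} [NeZero N] {f : ℍ → ℂ} (hol : Holo f)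
    (inv : ∀ γ ∈ Gamma0 N, ∀ τ : ℍ, f (γ • τ) = f τ)
    (bdd : ∀ γ : SL(2, ℤ), IsBoundedAtImInfty (fun τ => f (γ • τ))) :
    ∃ c : ℂ, ∀ τ, f τ = c := by
  let F : ModularForm ((Gamma0 N).map (Matrix.SpecialLinearGroup.mapGL ℝ)) 0 :=
    { toFun := f
      slash_action_eq' := by
        rintro _ ⟨γ, hγ, rfl⟩
        ext τ
        have := SL_slash_apply (k := 0) f γ τ
        simp only [neg_zero, zpow_zero, mul_one] at this
        rw [inv γ hγ] at this
        exact this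
      holo' := hol.mdiff
      bdd_at_cusps' := by
        intro c hc
        rw [Subgroup.IsArithmetic.isCusp_iff_isCusp_SL2Z] at hc
        rw [OnePoint.isBoundedAt_iff_forall_SL2Z hc]
        intro γ _
        have h : (f ∣[(0 : ℤ)] γ) = fun τ => f (γ • τ) := by
          ext τ
          simpa using SL_slash_apply (k := 0) f γ τ
        rw [h]
        exact bdd γ }
  obtain ⟨c, hc⟩ := ModularForm.eq_const_of_weight_zero F
  exact ⟨c, fun τ => congrFun hc τ⟩

/-- If `g` and `γ` send `∞` to the same cusp and `f ∘ g` is bounded at `i∞`, so is `f ∘ γ`. -/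
lemma bounded_transport {f : ℍ → ℂ} {g : GL (Fin 2) ℝ} {γ : SL(2, ℤ)}
    (h : g 0 0 * (γ 1 0 : ℤ) = g 1 0 * (γ 0 0 : ℤ))
    (hb : IsBoundedAtImInfty (fun τ => f (g • τ))) :
    IsBoundedAtImInfty (fun τ => f (γ • τ)) := by
  set γ' : GL (Fin 2) ℝ := Matrix.SpecialLinearGroup.mapGL ℝ γ with hγ'
  have e0 : γ' 0 0 = ((γ 0 0 : ℤ) : ℝ) := by simp [hγ']
  have e1 : γ' 1 0 = ((γ 1 0 : ℤ) : ℝ) := by simp [hγ']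
  -- The matrix u = g⁻¹γ fixes ∞, so it is upper triangular and acts near i∞ by an affine map.
  obtain ⟨u, hgu⟩ : ∃ u, g * u = γ' := ⟨g⁻¹ * γ', mul_inv_cancel_left _ _⟩
  have hu10 : u 1 0 = 0 := by
    have h0 : g 0 0 * u 0 0 + g 0 1 * u 1 0 = γ' 0 0 := by
      rw [← hgu, Units.val_mul, Matrix.mul_apply, Fin.sum_univ_two]
    have h1 : g 1 0 * u 0 0 + g 1 1 * u 1 0 = γ' 1 0 := by
      rw [← hgu, Units.val_mul, Matrix.mul_apply, Fin.sum_univ_two]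
    have hd : g 0 0 * g 1 1 - g 0 1 * g 1 0 ≠ 0 := by
      have := g.det_ne_zero
      rwa [Matrix.det_fin_two] at this
    have : (g 0 0 * g 1 1 - g 0 1 * g 1 0) * u 1 0 = 0 := by
      rw [e0] at h0; rw [e1] at h1
      linear_combination g 0 0 * h1 - g 1 0 * h0 + h
    exact (mul_eq_zero.1 this).resolve_left hd
  have hfun : (fun τ => f (γ • τ)) = (fun τ => f (g • τ)) ∘ (fun τ => u • τ) := by
    ext τ
    simp only [Function.comp]
    rw [← mul_smul, hgu]
    rfl
  rw [hfun]
  exact hb.comp_tendsto (tendsto_smul_atImInfty hu10)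

/-! ### The group Γ₀(pM)+M and its two cusps. -/

/-- `(x, y; z, w)` is an integer matrix representing an element of `Γ₀(p M) + M`, of determinant
`e ∈ {1, M}`. -/
structure AtkinLehner (p M e : ℕ) (x y z w : ℤ) : Prop where
  e_eq : e = 1 ∨ e = M
  det : x * w - y * z = e
  dvd_x : (e : ℤ) ∣ x
  dvd_w : (e : ℤ) ∣ w
  dvd_z : (p * M : ℤ) ∣ z

lemma AtkinLehner.det_pos {p M e : ℕ} {x y z w : ℤ} (H : AtkinLehner p M e x y z w)
    (hM : 0 < M) : 0 < (x : ℝ) * w - y * z := by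
  have h : ((x * w - y * z : ℤ) : ℝ) = ((e : ℤ) : ℝ) := by rw [H.det]
  push_cast at h
  rw [h]
  rcases H.e_eq with h | h <;> simp [h, hM]

/-- Admissible pairs: `p` prime, and `M` either `1` or a prime different from `p`. -/
structure Admissible (p M : ℕ) : Prop where
  hp : p.Prime
  hM : M = 1 ∨ (M.Prime ∧ M ≠ p)

namespace Admissible

variable {p M : ℕ} (A : Admissible p M)
include A

lemma M_pos : 0 < M := by
  rcases A.hM with h | h
  · simp [h]
  · exact h.1.pos

lemma coprime : Nat.Coprime p M := by
  rcases A.hM with h | h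
  · simp [h]
  · exact (Nat.coprime_primes A.hp h.1).2 h.2.symm

lemma isCoprime : IsCoprime (p : ℤ) (M : ℤ) := A.coprime.isCoprime

lemma coprime_of_not_dvd {c : ℤ} (h : ¬ (M : ℤ) ∣ c) : IsCoprime (M : ℤ) c := by
  rcases A.hM with h1 | h1
  · simp [h1] at h
  · exact (Prime.coprime_iff_not_dvd (Nat.prime_iff_prime_int.1 h1.1)).2 h

lemma p_coprime_of_not_dvd {c : ℤ} (h : ¬ (p : ℤ) ∣ c) : IsCoprime (p : ℤ) c :=
  (Prime.coprime_iff_not_dvd (Nat.prime_iff_prime_int.1 A.hp)).2 h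

/-- The cusps a/c with p ∣ c form the orbit of ∞: when M ∣ c a matrix of Γ₀(pM) is completed from a
Bézout relation, and otherwise an Atkin-Lehner matrix W_M is. -/
lemma exists_smul_infty {a c : ℤ} (hac : IsCoprime a c) (hc : (p : ℤ) ∣ c) :
    ∃ (e : ℕ) (x y z w : ℤ), AtkinLehner p M e x y z w ∧ x * c = z * a := by
  by_cases hMc : (M : ℤ) ∣ c
  · obtain ⟨u, v, huv⟩ := hac
    exact ⟨1, a, -v, c, u, ⟨Or.inl rfl, by push_cast; linear_combination huv, by simp, by simp,
      A.isCoprime.mul_dvd hc hMc⟩, by ring⟩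
  · obtain ⟨u, v, huv⟩ : IsCoprime (M * a) c := (A.coprime_of_not_dvd hMc).mul_left hac
    exact ⟨M, M * a, -v, M * c, M * u, ⟨Or.inr rfl, by linear_combination M * huv, by simp, by simp,
      by rw [mul_comm]; exact mul_dvd_mul_left _ hc⟩, by ring⟩

/-- The complementary orbit, that of 0. Here the roles are exchanged: W_M is used when M ∣ c. -/
lemma exists_smul_zero {a c : ℤ} (hac : IsCoprime a c) (hc : ¬ (p : ℤ) ∣ c) :
    ∃ (e : ℕ) (x y z w : ℤ), AtkinLehner p M e x y z w ∧ y * c = w * a := by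
  have hpc := A.p_coprime_of_not_dvd hc
  by_cases hMc : (M : ℤ) ∣ c
  · obtain ⟨u, v, huv⟩ : IsCoprime c (a * p) := hac.symm.mul_right hpc.symm
    exact ⟨M, M * u, a, -(p * M * v), c, ⟨Or.inr rfl, by linear_combination M * huv, by simp, hMc,
      by rw [dvd_neg]; exact dvd_mul_right _ _⟩, by ring⟩
  · obtain ⟨u, v, huv⟩ : IsCoprime c (a * (p * M)) :=
      hac.symm.mul_right (hpc.symm.mul_right (A.coprime_of_not_dvd hMc).symm)
    exact ⟨1, u, a, -(p * M * v), c, ⟨Or.inl rfl, by push_cast; linear_combination huv, by simp,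
      by simp, by rw [dvd_neg]; exact dvd_mul_right _ _⟩, by ring⟩

end Admissible

/-- Invariance of `f` under `Γ₀(p M) + M`. -/
def ALInvariant (p M : ℕ) (f : ℍ → ℂ) : Prop :=
  ∀ (e : ℕ) (x y z w : ℤ), AtkinLehner p M e x y z w → ∀ (h : 0 < (x : ℝ) * w - y * z) (τ : ℍ),
    f (glMat x y z w h • τ) = f τ

/-- `τ ↦ -1 / τ`. -/
def invol (τ : ℍ) : ℍ := glMat 0 (-1) 1 0 (by norm_num) • τ

lemma coe_invol (τ : ℍ) : (invol τ : ℂ) = -1 / τ := by simp [invol, coe_glMat_smul]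

lemma col_eq (γ : SL(2, ℤ)) : IsCoprime (γ 0 0 : ℤ) (γ 1 0 : ℤ) := by
  have := γ.det_coe
  rw [Matrix.det_fin_two] at this
  exact ⟨γ 1 1, -γ 0 1, by linear_combination this⟩

/-- A holomorphic function on `ℍ` invariant under `Γ₀(p M) + M` and bounded at the cusps
`∞` and `0` is constant. -/
lemma const_of_ALInvariant {p M : ℕ} (A : Admissible p M) {f : ℍ → ℂ} (hol : Holo f)
    (inv : ALInvariant p M f) (hinf : IsBoundedAtImInfty f)
    (hzero : IsBoundedAtImInfty (fun τ => f (invol τ))) : ∃ c : ℂ, ∀ τ, f τ = c := by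
  have : NeZero (p * M) := ⟨(Nat.mul_pos A.hp.pos A.M_pos).ne'⟩
  refine const_of_bounded (N := p * M) hol ?_ ?_
  · intro γ hγ τ
    rw [sl_smul_eq_glMat]
    refine inv 1 _ _ _ _ ⟨Or.inl rfl, ?_, by simp, by simp, ?_⟩ _ _
    · have := γ.det_coe
      rw [Matrix.det_fin_two] at this
      exact_mod_cast this
    · rw [Gamma0_mem, ZMod.intCast_zmod_eq_zero_iff_dvd] at hγ
      exact_mod_cast hγ
  · intro γ
    by_cases hc : (p : ℤ) ∣ γ 1 0
    · obtain ⟨e, x, y, z, w, H, hx⟩ := A.exists_smul_infty (col_eq γ) hc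
      have hd := H.det_pos A.M_pos
      apply bounded_transport (g := glMat x y z w hd)
      · change (x : ℝ) * _ = z * _
        exact_mod_cast hx
      · simpa only [inv e x y z w H hd] using hinf
    · obtain ⟨e, x, y, z, w, H, hx⟩ := A.exists_smul_zero (col_eq γ) hc
      have hd := H.det_pos A.M_pos
      have hS : (0 : ℝ) < 0 * 0 - (-1) * 1 := by norm_num
      apply bounded_transport (g := glMat x y z w hd * glMat 0 (-1) 1 0 hS)
      · rw [Units.val_mul, coe_glMat, coe_glMat, Matrix.mul_fin_two]
        simp only [Matrix.of_apply, Matrix.cons_val', Matrix.cons_val_zero, Matrix.cons_val_one]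
        have : (y : ℝ) * (γ 1 0 : ℤ) = w * (γ 0 0 : ℤ) := by exact_mod_cast hx
        simpa using this
      · simp only [mul_smul, inv e x y z w H hd]
        exact hzero

/-! ### Power series converging on the unit disc. -/

/-- The function `f` on the open unit disc is the sum of the power series `F`. -/
def HasVal (F : ℂ⟦X⟧) (f : ℂ → ℂ) : Prop :=
  ∀ q : ℂ, ‖q‖ < 1 → HasSum (fun n => PowerSeries.coeff n F * q ^ n) (f q)

namespace HasVal

variable {F G : ℂ⟦X⟧} {f g : ℂ → ℂ}

lemma congr (hF : HasVal F f) (h : ∀ q : ℂ, ‖q‖ < 1 → g q = f q) : HasVal F g :=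
  fun q hq => by rw [h q hq]; exact hF q hq

lemma add (hF : HasVal F f) (hG : HasVal G g) : HasVal (F + G) (fun q => f q + g q) :=
  fun q hq => by simpa [add_mul] using (hF q hq).add (hG q hq)

lemma sub (hF : HasVal F f) (hG : HasVal G g) : HasVal (F - G) (fun q => f q - g q) :=
  fun q hq => by simpa [sub_mul] using (hF q hq).sub (hG q hq)

lemma summable_norm (hF : HasVal F f) {q : ℂ} (hq : ‖q‖ < 1) :
    Summable fun n => ‖PowerSeries.coeff n F * q ^ n‖ := (hF q hq).summable.norm

lemma mul (hF : HasVal F f) (hG : HasVal G g) : HasVal (F * G) (fun q => f q * g q) := by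
  intro q hq
  have h1 := hF.summable_norm hq
  have h2 := hG.summable_norm hq
  have h3 := tsum_mul_tsum_eq_tsum_sum_antidiagonal_of_summable_norm h1 h2
  have h4 := (summable_norm_sum_mul_antidiagonal_of_summable_norm h1 h2).of_norm
  have h5 := h4.hasSum
  rw [← h3, (hF q hq).tsum_eq, (hG q hq).tsum_eq] at h5
  refine h5.congr_fun fun n => ?_
  rw [PowerSeries.coeff_mul, Finset.sum_mul]
  refine Finset.sum_congr rfl fun x hx => ?_
  have hx' : x.1 + x.2 = n := by simpa using hx
  rw [← hx', pow_add]
  ring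

lemma const (c : ℂ) : HasVal (PowerSeries.C c) (fun _ => c) := by
  intro q _
  have := hasSum_ite_eq (0 : ℕ) c
  refine this.congr_fun fun n => ?_
  rw [PowerSeries.coeff_C]
  split_ifs with h <;> simp [h]

lemma one : HasVal 1 (fun _ => 1) := by simpa using const 1

lemma X : HasVal PowerSeries.X (fun q => q) := by
  intro q _
  have := hasSum_ite_eq (1 : ℕ) q
  refine this.congr_fun fun n => ?_
  rw [PowerSeries.coeff_X]
  split_ifs with h <;> simp [h]

lemma pow (hF : HasVal F f) (n : ℕ) : HasVal (F ^ n) (fun q => f q ^ n) := by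
  induction n with
  | zero => simpa using one
  | succ n ih => simpa [pow_succ] using ih.mul hF

lemma expand (hF : HasVal F f) {d : ℕ} (hd : d ≠ 0) :
    HasVal (PowerSeries.expand d hd F) (fun q => f (q ^ d)) := by
  intro q hq
  have h1 : ‖q ^ d‖ < 1 := by
    rw [norm_pow]; exact pow_lt_one₀ (norm_nonneg _) hq hd
  have h2 := hF (q ^ d) h1
  have hinj : Function.Injective (fun n : ℕ => d * n) :=
    fun a b h => Nat.eq_of_mul_eq_mul_left (Nat.pos_of_ne_zero hd) h
  rw [← hinj.hasSum_iff]
  · refine h2.congr_fun fun n => ?_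
    simp [pow_mul]
  · intro n hn
    rw [PowerSeries.coeff_expand_of_not_dvd, zero_mul]
    rintro ⟨k, rfl⟩
    exact hn ⟨k, rfl⟩

lemma hasFPowerSeriesOnBall (hF : HasVal F f) :
    HasFPowerSeriesOnBall f (.ofScalars ℂ fun n => PowerSeries.coeff n F) 0 1 := by
  constructor
  · refine le_of_forall_lt_imp_le_of_dense fun r hr ↦ ?_
    lift r to NNReal using hr.ne_top
    apply FormalMultilinearSeries.le_radius_of_summable
    have := hF.summable_norm (q := (r : ℂ)) (by simpa using hr)
    simpa using this
  · simp
  · intro y hy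
    rw [← ENNReal.coe_one, Metric.eball_coe, NNReal.coe_one, mem_ball_zero_iff] at hy
    simpa [mul_comm] using hF y hy

lemma unique (hF : HasVal F f) (hG : HasVal G f) : F = G := by
  have h := hF.hasFPowerSeriesOnBall.hasFPowerSeriesAt.eq_formalMultilinearSeries
    hG.hasFPowerSeriesOnBall.hasFPowerSeriesAt
  ext n
  have := congrArg (fun p => FormalMultilinearSeries.coeff p n) h
  simpa using this

lemma differentiableOn (hF : HasVal F f) : DifferentiableOn ℂ f (Metric.ball 0 1) := by
  have := hF.hasFPowerSeriesOnBall.differentiableOn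
  rwa [← ENNReal.coe_one, Metric.eball_coe, NNReal.coe_one] at this

lemma tendsto (hF : HasVal F f) : Tendsto f (𝓝 0) (𝓝 (PowerSeries.constantCoeff F)) := by
  have h := hF.hasFPowerSeriesOnBall.hasFPowerSeriesAt.continuousAt.tendsto
  have h0 : f 0 = PowerSeries.constantCoeff F := by
    have h1 := hF 0 (by simp)
    refine h1.unique ?_
    refine (hasSum_ite_eq (0 : ℕ) (PowerSeries.constantCoeff F)).congr_fun fun n => ?_
    rcases n with _ | n <;> simp
  rwa [h0] at h

lemma exists_of_differentiableOn (hf : DifferentiableOn ℂ f (Metric.ball 0 1)) :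
    ∃ F, HasVal F f := by
  refine ⟨PowerSeries.mk fun n => (n.factorial : ℂ)⁻¹ * iteratedDeriv n f 0, fun q hq => ?_⟩
  have := Complex.hasSum_taylorSeries_on_ball (r := 1) (c := 0) hf (z := q) (by simpa using hq)
  refine this.congr_fun fun n => ?_
  simp [mul_comm, mul_left_comm]

/-- No estimate on the coefficients of the formal inverse is needed: 1/f is holomorphic on the disc,
so its Taylor series converges there, and it is the formal inverse by uniqueness. -/
lemma inv (hF : HasVal F f) (hne : ∀ q : ℂ, ‖q‖ < 1 → f q ≠ 0) (hG : F * G = 1) :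
    HasVal G (fun q => (f q)⁻¹) := by
  obtain ⟨G', hG'⟩ := exists_of_differentiableOn (f := fun q => (f q)⁻¹)
    (hF.differentiableOn.inv fun q hq => hne q (by simpa using hq))
  have h1 : F * G' = 1 := by
    refine ((hF.mul hG').congr (g := fun _ => 1) ?_).unique one
    intro q hq
    simp [mul_inv_cancel₀ (hne q hq)]
  have : G = G' := by
    calc G = G * (F * G') := by rw [h1, mul_one]
      _ = (F * G) * G' := by ring
      _ = G' := by rw [hG, one_mul]
  rw [this]; exact hG'

end HasVal

/-! ### Euler's product and the pentagonal number theorem. -/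

/-- Euler's product `∏ (1 - q^n)`. -/
def eulerProd (q : ℂ) : ℂ := ∏' n : ℕ, (1 - q ^ (n + 1))

lemma eulerProd_ne_zero {q : ℂ} (hq : ‖q‖ < 1) : eulerProd q ≠ 0 := by
  have : eulerProd q = ∏' n : ℕ, (1 + -q ^ (n + 1)) := by simp [eulerProd, sub_eq_add_neg]
  rw [this]
  apply tprod_one_add_ne_zero_of_summable
  · intro n h
    have h1 : q ^ (n + 1) = 1 := by linear_combination -h
    have h2 : ‖q‖ ^ (n + 1) < 1 := pow_lt_one₀ (norm_nonneg _) hq (by simp)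
    rw [← norm_pow, h1] at h2
    simp at h2
  · simpa using (summable_nat_add_iff 1).2 (summable_geometric_of_lt_one (norm_nonneg q) hq)

/-- The bound is uniform in k and n: apply 1 + x ≤ exp x to each factor and sum the geometric
series. -/
lemma norm_prod_one_sub_le {q : ℂ} (hq : ‖q‖ < 1) (k n : ℕ) :
    ‖∏ i ∈ Finset.range n, (1 - q ^ (k + i + 1))‖ ≤ Real.exp (1 - ‖q‖)⁻¹ := by
  have h1 : ∀ i ∈ Finset.range n, ‖1 - q ^ (k + i + 1)‖ ≤ Real.exp (‖q‖ ^ i) := by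
    intro i _
    calc ‖1 - q ^ (k + i + 1)‖ ≤ 1 + ‖q‖ ^ (k + i + 1) := by
          simpa using norm_sub_le (1 : ℂ) (q ^ (k + i + 1))
      _ ≤ 1 + ‖q‖ ^ i := by
          gcongr 1 + ?_
          exact pow_le_pow_of_le_one (norm_nonneg _) hq.le (by omega)
      _ ≤ _ := by rw [add_comm]; exact Real.add_one_le_exp _
  rw [norm_prod]
  refine (Finset.prod_le_prod (fun _ _ => norm_nonneg _) h1).trans ?_
  rw [← Real.exp_sum, Real.exp_le_exp, ← tsum_geometric_of_lt_one (norm_nonneg _) hq]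
  exact (summable_geometric_of_lt_one (norm_nonneg _) hq).sum_le_tsum _
    (fun _ _ => by positivity)

/-- The pentagonal number theorem as an identity of functions on the disc. It supplies eta products
with explicit integral power series; the work consists in the convergence hypotheses of the
identity. -/
lemma hasVal_pentagonal : HasVal (PowerSeries.pentagonalSeries ℂ) eulerProd := by
  intro q hq
  have hgeo := summable_geometric_of_lt_one (norm_nonneg _) hq
  have hsum : Summable fun n => PowerSeries.coeff n (PowerSeries.pentagonalSeries ℂ) * q ^ n := by
    apply Summable.of_norm_bounded hgeo
    intro n
    rw [norm_mul, norm_pow]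
    refine mul_le_of_le_one_left (by positivity) ?_
    by_cases h : n ∈ Set.range pentagonal
    · obtain ⟨k, rfl⟩ := h
      rw [PowerSeries.coeff_pentagonalSeries_pentagonal]
      rcases Int.even_or_odd k with hk | hk
      · simp [Int.negOnePow_even k hk]
      · simp [Int.negOnePow_odd k hk]
    · simp [PowerSeries.coeff_pentagonalSeries_eq_zero ℂ h]
  have hS := hsum.hasSum
  set V := ∑' n, PowerSeries.coeff n (PowerSeries.pentagonalSeries ℂ) * q ^ n
  have h1 : HasSum (fun k : ℤ => ((Int.negOnePow k : ℤ) : ℂ) * q ^ pentagonal k) V := by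
    have := (pentagonal_injective.hasSum_iff (f := fun n =>
      PowerSeries.coeff n (PowerSeries.pentagonalSeries ℂ) * q ^ n) (a := V) (fun n hn => by
        simp [PowerSeries.coeff_pentagonalSeries_eq_zero ℂ hn])).2 hS
    refine this.congr_fun fun k => ?_
    simp
  -- The sum over ℤ is folded by pairing the index -k with k + 1, which have opposite signs.
  have h2 : HasSum (fun k : ℕ => (-1) ^ k * (q ^ pentagonal (-k) - q ^ pentagonal (k + 1))) V := by
    rw [← neg_injective.hasSum_iff (fun x hx ↦ by absurd hx; use -x; simp)] at h1
    refine h1.nat_add_neg_add_one.congr_fun fun k => ?_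
    simp_rw [Function.comp_apply, neg_neg, Int.negOnePow_add]
    simp
    ring
  have key := Pentagonal.tprod_one_sub_pow (x := q) ?_ ?_ ?_ h2.summable ?_
  · rw [eulerProd, key, h2.tsum_eq]; exact hS
  · exact tendsto_pow_atTop_nhds_zero_of_norm_lt_one hq
  · intro k
    apply Summable.of_norm_bounded (hgeo.mul_right (Real.exp (1 - ‖q‖)⁻¹))
    intro n
    rw [norm_mul, norm_pow]
    exact mul_le_mul (pow_le_pow_of_le_one (norm_nonneg _) hq.le (by nlinarith))
      (norm_prod_one_sub_le hq k (n + 1)) (norm_nonneg _) (by positivity)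
  · intro k
    simp_rw [sub_eq_add_neg]
    apply multipliable_one_add_of_summable
    simpa [add_assoc] using (summable_nat_add_iff (k + 1)).2 hgeo
  · set B := Real.exp (1 - ‖q‖)⁻¹ * (1 - ‖q‖)⁻¹
    have hB : ∀ k : ℕ, ‖∑' n : ℕ, q ^ ((k + 1) * n) *
        ∏ i ∈ Finset.range (n + 1), (1 - q ^ (k + i + 1))‖ ≤ B := by
      intro k
      have h3 : HasSum (fun n => Real.exp (1 - ‖q‖)⁻¹ * ‖q‖ ^ n) B :=
        (hasSum_geometric_of_lt_one (norm_nonneg _) hq).mul_left _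
      refine tsum_of_norm_bounded h3 fun n => ?_
      rw [norm_mul, norm_pow, mul_comm]
      exact mul_le_mul (norm_prod_one_sub_le hq k (n + 1))
        (pow_le_pow_of_le_one (norm_nonneg _) hq.le (by nlinarith)) (by positivity) (by positivity)
    apply squeeze_zero_norm (a := fun k : ℕ => ‖q‖ ^ k * B)
    · intro k
      rw [norm_mul]
      refine mul_le_mul ?_ (hB k) (norm_nonneg _) (by positivity)
      rw [norm_mul, norm_pow, norm_neg, norm_one, one_pow, one_mul, norm_pow]
      refine pow_le_pow_of_le_one (norm_nonneg _) hq.le ?_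
      rw [Nat.le_div_iff_mul_le two_pos]
      nlinarith
    · simpa using (tendsto_pow_atTop_nhds_zero_of_lt_one (norm_nonneg _) hq).mul_const B

/-! ### The variable q and the eta quotients. -/

/-- `q = exp(2πiτ)`. -/
def qq (τ : ℍ) : ℂ := Complex.exp (2 * π * Complex.I * τ)

lemma qq_ne_zero (τ : ℍ) : qq τ ≠ 0 := Complex.exp_ne_zero _

lemma norm_qq (τ : ℍ) : ‖qq τ‖ = Real.exp (-(2 * π * τ.im)) := by
  rw [qq, Complex.norm_exp]
  congr 1
  simp

lemma norm_qq_lt_one (τ : ℍ) : ‖qq τ‖ < 1 := by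
  rw [norm_qq, Real.exp_lt_one_iff]
  have := τ.im_pos
  have := Real.pi_pos
  nlinarith [mul_pos Real.pi_pos τ.im_pos]

lemma norm_qq_pow_lt_one (τ : ℍ) {n : ℕ} (hn : n ≠ 0) : ‖qq τ ^ n‖ < 1 := by
  rw [norm_pow]; exact pow_lt_one₀ (norm_nonneg _) (norm_qq_lt_one τ) hn

lemma qq_scale (m : ℕ) (hm : (0 : ℝ) < m) (τ : ℍ) : qq (scale m hm τ) = qq τ ^ m := by
  rw [qq, qq, coe_scale, ← Complex.exp_nat_mul]
  congr 1
  push_cast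
  ring

lemma tendsto_qq : Tendsto qq atImInfty (𝓝 0) := by
  rw [tendsto_zero_iff_norm_tendsto_zero]
  simp only [norm_qq]
  have := tendsto_im_atImInfty_iff.1 (tendsto_id (α := ℍ) (x := atImInfty))
  exact Real.tendsto_exp_neg_atTop_nhds_zero.comp
    (this.const_mul_atTop (by positivity : (0 : ℝ) < 2 * π))

/-- `∏ (1 - q^n) (1 - q^(M n))`. -/
def etaNum (M : ℕ) (q : ℂ) : ℂ := eulerProd q * eulerProd (q ^ M)

lemma etaNum_ne_zero {M : ℕ} (hM : M ≠ 0) {q : ℂ} (hq : ‖q‖ < 1) : etaNum M q ≠ 0 := by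
  refine mul_ne_zero (eulerProd_ne_zero hq) (eulerProd_ne_zero ?_)
  rw [norm_pow]; exact pow_lt_one₀ (norm_nonneg _) hq hM

/-- The eta quotient `(η(hτ) η(hMτ) / (η(phτ) η(phMτ)))^r`, provided its leading exponent
`h r (1 - p) (M + 1) / 24` is `-1`. -/
def fFun (p M h r : ℕ) (τ : ℍ) : ℂ :=
  (qq τ)⁻¹ * (etaNum M (qq τ ^ h) / etaNum M ((qq τ ^ h) ^ p)) ^ r

/-- The power series of `etaNum M`. -/
def etaNumSeries (M : ℕ) (hM : M ≠ 0) : ℤ⟦X⟧ :=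
  PowerSeries.pentagonalSeries ℤ * PowerSeries.expand M hM (PowerSeries.pentagonalSeries ℤ)

/-- Extension of coefficients from `ℤ` to `ℂ`. -/
abbrev toC : ℤ⟦X⟧ →+* ℂ⟦X⟧ := PowerSeries.map (Int.castRingHom ℂ)

lemma toC_injective : Function.Injective toC :=
  PowerSeries.map_injective _ Int.cast_injective

lemma toC_pentagonal : toC (PowerSeries.pentagonalSeries ℤ) = PowerSeries.pentagonalSeries ℂ := by
  ext n
  rw [PowerSeries.coeff_map]
  by_cases h : n ∈ Set.range pentagonal
  · obtain ⟨k, rfl⟩ := h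
    simp
  · rw [PowerSeries.coeff_pentagonalSeries_eq_zero _ h,
      PowerSeries.coeff_pentagonalSeries_eq_zero _ h, map_zero]

lemma hasVal_etaNumSeries (M : ℕ) (hM : M ≠ 0) : HasVal (toC (etaNumSeries M hM)) (etaNum M) := by
  rw [etaNumSeries, map_mul, PowerSeries.map_expand, toC_pentagonal]
  exact hasVal_pentagonal.mul (hasVal_pentagonal.expand hM)

lemma constantCoeff_pentagonal :
    PowerSeries.constantCoeff (PowerSeries.pentagonalSeries ℤ) = 1 := by
  have := PowerSeries.coeff_pentagonalSeries_pentagonal ℤ 0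
  simpa [pentagonal_def] using this

lemma constantCoeff_etaNumSeries (M : ℕ) (hM : M ≠ 0) :
    PowerSeries.constantCoeff (etaNumSeries M hM) = 1 := by
  rw [etaNumSeries, map_mul, PowerSeries.constantCoeff_expand, constantCoeff_pentagonal, one_mul]

/-- The inverse of a power series with constant coefficient `1`. -/
def invSeries (F : ℤ⟦X⟧) : ℤ⟦X⟧ := PowerSeries.invOfUnit F 1

lemma mul_invSeries {F : ℤ⟦X⟧} (hF : PowerSeries.constantCoeff F = 1) : F * invSeries F = 1 :=
  PowerSeries.mul_invOfUnit F 1 (by simpa using hF)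

lemma constantCoeff_invSeries (F : ℤ⟦X⟧) : PowerSeries.constantCoeff (invSeries F) = 1 := by
  simp [invSeries]

lemma hasVal_invSeries {F : ℤ⟦X⟧} (hF : PowerSeries.constantCoeff F = 1) {f : ℂ → ℂ}
    (h : HasVal (toC F) f) (hne : ∀ q : ℂ, ‖q‖ < 1 → f q ≠ 0) :
    HasVal (toC (invSeries F)) (fun q => (f q)⁻¹) :=
  h.inv hne (by rw [← map_mul, mul_invSeries hF, map_one])

/-- The power series of `q ↦ etaNum M q / etaNum M (q ^ p)`. -/
def etaQuotSeries (p M : ℕ) (hp : p ≠ 0) (hM : M ≠ 0) : ℤ⟦X⟧ :=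
  etaNumSeries M hM * invSeries (PowerSeries.expand p hp (etaNumSeries M hM))

lemma constantCoeff_expand_etaNumSeries (p M : ℕ) (hp : p ≠ 0) (hM : M ≠ 0) :
    PowerSeries.constantCoeff (PowerSeries.expand p hp (etaNumSeries M hM)) = 1 := by
  rw [PowerSeries.constantCoeff_expand, constantCoeff_etaNumSeries]

lemma constantCoeff_etaQuotSeries (p M : ℕ) (hp : p ≠ 0) (hM : M ≠ 0) :
    PowerSeries.constantCoeff (etaQuotSeries p M hp hM) = 1 := by
  rw [etaQuotSeries, map_mul, constantCoeff_invSeries, constantCoeff_etaNumSeries, one_mul]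

lemma norm_pow_lt_one_of {q : ℂ} (hq : ‖q‖ < 1) {n : ℕ} (hn : n ≠ 0) : ‖q ^ n‖ < 1 := by
  rw [norm_pow]; exact pow_lt_one₀ (norm_nonneg _) hq hn

lemma hasVal_etaQuotSeries (p M : ℕ) (hp : p ≠ 0) (hM : M ≠ 0) :
    HasVal (toC (etaQuotSeries p M hp hM)) (fun q => etaNum M q / etaNum M (q ^ p)) := by
  rw [etaQuotSeries, map_mul]
  have h1 : HasVal (toC (PowerSeries.expand p hp (etaNumSeries M hM)))
      (fun q => etaNum M (q ^ p)) := by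
    rw [PowerSeries.map_expand]; exact (hasVal_etaNumSeries M hM).expand hp
  refine ((hasVal_etaNumSeries M hM).mul (hasVal_invSeries
    (constantCoeff_expand_etaNumSeries p M hp hM) h1 fun q hq => ?_)).congr ?_
  · exact etaNum_ne_zero hM (norm_pow_lt_one_of hq hp)
  · intro q _
    rw [div_eq_mul_inv]

/-- The power series of `q * fFun`. -/
def fSeries (p M h r : ℕ) (hp : p ≠ 0) (hM : M ≠ 0) (hh : h ≠ 0) : ℤ⟦X⟧ :=
  PowerSeries.expand h hh (etaQuotSeries p M hp hM ^ r)

lemma constantCoeff_fSeries (p M h r : ℕ) (hp : p ≠ 0) (hM : M ≠ 0) (hh : h ≠ 0) :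
    PowerSeries.constantCoeff (fSeries p M h r hp hM hh) = 1 := by
  rw [fSeries, PowerSeries.constantCoeff_expand, map_pow, constantCoeff_etaQuotSeries, one_pow]

lemma hasVal_fSeries (p M h r : ℕ) (hp : p ≠ 0) (hM : M ≠ 0) (hh : h ≠ 0) :
    HasVal (toC (fSeries p M h r hp hM hh))
      (fun q => (etaNum M (q ^ h) / etaNum M ((q ^ h) ^ p)) ^ r) := by
  rw [fSeries, PowerSeries.map_expand, map_pow]
  exact ((hasVal_etaQuotSeries p M hp hM).pow r).expand hh

lemma etaQuot_ne_zero {p M h : ℕ} (hp : p ≠ 0) (hM : M ≠ 0) (hh : h ≠ 0) {q : ℂ} (hq : ‖q‖ < 1) :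
    etaNum M (q ^ h) / etaNum M ((q ^ h) ^ p) ≠ 0 :=
  div_ne_zero (etaNum_ne_zero hM (norm_pow_lt_one_of hq hh))
    (etaNum_ne_zero hM (norm_pow_lt_one_of (norm_pow_lt_one_of hq hh) hp))

lemma fFun_ne_zero {p M h : ℕ} (r : ℕ) (hp : p ≠ 0) (hM : M ≠ 0) (hh : h ≠ 0) (τ : ℍ) :
    fFun p M h r τ ≠ 0 :=
  mul_ne_zero (inv_ne_zero (qq_ne_zero τ))
    (pow_ne_zero _ (etaQuot_ne_zero hp hM hh (norm_qq_lt_one τ)))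

lemma HasVal.holo {F : ℂ⟦X⟧} {f : ℂ → ℂ} (hF : HasVal F f) : Holo (fun τ => f (qq τ)) := by
  have h1 : DifferentiableOn ℂ (fun z : ℂ => Complex.exp (2 * π * Complex.I * z))
      {z : ℂ | 0 < z.im} := by fun_prop
  refine (hF.differentiableOn.comp h1 ?_).congr ?_
  · intro z hz
    rw [mem_ball_zero_iff]
    exact norm_qq_lt_one ⟨z, hz⟩
  · intro z hz
    simp [Function.comp, qq, ofComplex_apply_of_im_pos hz]

lemma holo_qq : Holo qq := HasVal.X.holo

lemma Holo.mul {f g : ℍ → ℂ} (hf : Holo f) (hg : Holo g) : Holo (fun τ => f τ * g τ) :=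
  DifferentiableOn.mul hf hg

lemma Holo.sub {f g : ℍ → ℂ} (hf : Holo f) (hg : Holo g) : Holo (fun τ => f τ - g τ) :=
  DifferentiableOn.sub hf hg

lemma Holo.const (c : ℂ) : Holo (fun _ => c) := differentiableOn_const c

lemma Holo.pow {f : ℍ → ℂ} (hf : Holo f) (n : ℕ) : Holo (fun τ => f τ ^ n) :=
  DifferentiableOn.pow hf n

lemma Holo.inv {f : ℍ → ℂ} (hf : Holo f) (h : ∀ τ, f τ ≠ 0) : Holo (fun τ => (f τ)⁻¹) :=
  DifferentiableOn.inv hf fun _ _ => h _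

lemma Holo.prod {ι : Type*} {s : Finset ι} {f : ι → ℍ → ℂ} (hf : ∀ i ∈ s, Holo (f i)) :
    Holo (fun τ => ∏ i ∈ s, f i τ) := by
  classical
  induction s using Finset.induction_on with
  | empty => simpa using Holo.const 1
  | insert a s ha ih =>
    simp only [Finset.prod_insert ha]
    exact (hf a (Finset.mem_insert_self a s)).mul
      (ih fun i hi => hf i (Finset.mem_insert_of_mem hi))

lemma holo_fFun {p M h : ℕ} (r : ℕ) (hp : p ≠ 0) (hM : M ≠ 0) (hh : h ≠ 0) :
    Holo (fFun p M h r) :=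
  (holo_qq.inv qq_ne_zero).mul (hasVal_fSeries p M h r hp hM hh).holo

lemma tendsto_fFun_mul_qq {p M h : ℕ} (r : ℕ) (hp : p ≠ 0) (hM : M ≠ 0) (hh : h ≠ 0) :
    Tendsto (fun τ => fFun p M h r τ * qq τ) atImInfty (𝓝 1) := by
  have h1 := (hasVal_fSeries p M h r hp hM hh).tendsto
  have h2 : PowerSeries.constantCoeff (toC (fSeries p M h r hp hM hh)) = 1 := by
    rw [← PowerSeries.coeff_zero_eq_constantCoeff_apply, PowerSeries.coeff_map,
      PowerSeries.coeff_zero_eq_constantCoeff_apply, constantCoeff_fSeries, map_one]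
  rw [h2] at h1
  refine (h1.comp tendsto_qq).congr fun τ => ?_
  simp only [Function.comp, fFun]
  field_simp [qq_ne_zero τ]

lemma isTheta_qq : qq =Θ[atImInfty] fun τ => Real.exp (-(2 * π * τ.im)) := by
  refine IsTheta.of_norm_left ?_
  simp only [norm_qq]
  exact isTheta_rfl

lemma isTheta_fFun {p M h : ℕ} (r : ℕ) (hp : p ≠ 0) (hM : M ≠ 0) (hh : h ≠ 0) :
    fFun p M h r =Θ[atImInfty] fun τ => Real.exp (2 * π * τ.im) := by
  have h1 : (fun τ => fFun p M h r τ * qq τ) =Θ[atImInfty] fun _ => (1 : ℝ) :=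
    ((isEquivalent_const_iff_tendsto one_ne_zero).2 (tendsto_fFun_mul_qq r hp hM hh)).isTheta.trans
      (isTheta_const_const one_ne_zero one_ne_zero)
  have h2 := h1.div isTheta_qq
  refine (IsTheta.trans ?_ h2).trans ?_
  · refine EventuallyEq.isTheta (Eventually.of_forall fun τ => ?_)
    exact (mul_div_cancel_right₀ _ (qq_ne_zero τ)).symm
  · refine EventuallyEq.isTheta (Eventually.of_forall fun τ => ?_)
    change 1 / Real.exp (-(2 * π * τ.im)) = _
    rw [Real.exp_neg, one_div, inv_inv]

lemma fFun_pow {p M h : ℕ} (r : ℕ) (hh : (0 : ℝ) < h) (τ : ℍ) :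
    fFun p M h r τ ^ h = fFun p M 1 (h * r) (scale h hh τ) := by
  rw [fFun, fFun, qq_scale, mul_pow, ← pow_mul, mul_comm r h, inv_pow, pow_one]

/-! ### The discriminant -/

lemma discriminant_eq (τ : ℍ) : discriminant τ = qq τ * eulerProd (qq τ) ^ 24 := by
  rw [discriminant_eq_q_prod]
  have h1 : Function.Periodic.qParam 1 (τ : ℂ) = qq τ := by simp [Function.Periodic.qParam, qq]
  rw [h1]
  congr 1
  rw [eulerProd, ← (multipliable_one_sub_pow (norm_qq_lt_one τ)).tprod_pow]
  simp only [eta_q, h1]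

/-- Transformation of the discriminant under `(α, β; κ, ι) ∈ SL(2, ℤ)`. -/
lemma discriminant_transform {σ σ' : ℍ} (α β κ ι : ℤ) (hdet : α * ι - β * κ = 1)
    (h : (σ' : ℂ) * (κ * σ + ι) = α * σ + β) :
    discriminant σ' = (κ * σ + ι) ^ 12 * discriminant σ := by
  let γ : SL(2, ℤ) := ⟨!![α, β; κ, ι], by rw [Matrix.det_fin_two_of]; exact hdet⟩
  have h1 : (discriminant ∣[(12 : ℤ)] γ) = discriminant :=
    SlashInvariantForm.slash_action_generators_SL2Z discriminant_S_invariant discriminant_T_invariant γ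
  have h2 := congrFun h1 σ
  rw [SL_slash_apply] at h2
  have hd : denom γ σ = κ * σ + ι := by
    rw [ModularGroup.denom_apply]; simp [γ]
  have hne : (κ * σ + ι : ℂ) ≠ 0 := by rw [← hd]; exact denom_ne_zero _ _
  have h3 : γ • σ = σ' := by
    ext
    rw [coe_specialLinearGroup_apply]
    simp only [γ, Matrix.of_apply, Matrix.cons_val',
      Matrix.cons_val_zero, Matrix.cons_val_one]
    simp only [algebraMap_int_eq, eq_intCast, Complex.ofReal_intCast]
    rw [div_eq_iff hne, h]
  rw [h3, hd] at h2
  rw [← h2, zpow_neg]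
  field_simp

/-- `Δ(τ) Δ(Mτ) / (Δ(pτ) Δ(pMτ))`. -/
def dQuot {p M : ℕ} (A : Admissible p M) (τ : ℍ) : ℂ :=
  discriminant τ * discriminant (scale M (by exact_mod_cast A.M_pos) τ) /
    (discriminant (scale p (by exact_mod_cast A.hp.pos) τ) *
      discriminant (scale (p * M : ℕ) (by exact_mod_cast Nat.mul_pos A.hp.pos A.M_pos) τ))

/-- Taking 24th powers replaces η by Δ, whose transformation law carries no multiplier system. -/
lemma fFun_pow_eq_dQuot {p M h r : ℕ} (A : Admissible p M) (hh : (0 : ℝ) < h)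
    (hr : h * r * ((p - 1) * (M + 1)) = 24) (τ : ℍ) :
    fFun p M h r τ ^ 24 = dQuot A (scale h hh τ) ^ r := by
  have hh' : h ≠ 0 := by rintro rfl; simp at hh
  have hp := A.hp.ne_zero
  have hM := A.M_pos.ne'
  set x := qq τ ^ h with hx
  have hx0 : x ≠ 0 := pow_ne_zero _ (qq_ne_zero τ)
  have hx1 : ‖x‖ < 1 := norm_qq_pow_lt_one τ hh'
  rw [dQuot, discriminant_eq, discriminant_eq, discriminant_eq, discriminant_eq, qq_scale,
    qq_scale, qq_scale p, qq_scale (p * M), qq_scale, fFun, ← hx, etaNum, etaNum]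
  have n1 := eulerProd_ne_zero (norm_pow_lt_one_of hx1 hp)
  have n2 := eulerProd_ne_zero (norm_pow_lt_one_of (norm_pow_lt_one_of hx1 hp) hM)
  -- The weight condition says that the powers of q in front of the Euler products contribute
  -- exactly q⁻²⁴.
  have hq : (qq τ) ^ 24 * (x * x ^ M) ^ r = (x ^ p * x ^ (p * M)) ^ r := by
    obtain ⟨k, hk⟩ : ∃ k, p = k + 1 := ⟨p - 1, by have := A.hp.one_lt; omega⟩
    rw [hx, ← hr, hk]
    simp only [← pow_mul, ← pow_add]
    congr 1
    simp only [Nat.add_sub_cancel]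
    ring
  rw [pow_mul x p M] at hq ⊢
  have hq0 := qq_ne_zero τ
  generalize eulerProd x = a, eulerProd (x ^ M) = b at *
  generalize eulerProd ((x ^ p) ^ M) = d at *
  generalize eulerProd (x ^ p) = c at *
  have hxp : x ^ p * (x ^ p) ^ M ≠ 0 := by positivity
  have : x * a ^ 24 * (x ^ M * b ^ 24) / (x ^ p * c ^ 24 * ((x ^ p) ^ M * d ^ 24)) =
      (x * x ^ M) / (x ^ p * (x ^ p) ^ M) * (a * b / (c * d)) ^ 24 := by
    field_simp
  have hk : ((x * x ^ M) / (x ^ p * (x ^ p) ^ M)) ^ r = (qq τ)⁻¹ ^ 24 := by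
    rw [div_pow, div_eq_iff (pow_ne_zero _ hxp), ← hq, inv_pow]
    field_simp
  rw [this, mul_pow, mul_pow _ _ r, hk, ← pow_mul, ← pow_mul, mul_comm r 24]

lemma discriminant_scale {σ τ : ℍ} {δ δ' : ℝ} (hδ : 0 < δ) (hδ' : 0 < δ') (α β κ ι : ℤ)
    (hdet : α * ι - β * κ = 1) (h : (δ : ℂ) * σ * (κ * (δ' * τ) + ι) = α * (δ' * τ) + β) :
    discriminant (scale δ hδ σ) = (κ * (δ' * τ) + ι) ^ 12 * discriminant (scale δ' hδ' τ) := by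
  rw [discriminant_transform (σ := scale δ' hδ' τ) α β κ ι hdet, coe_scale]
  rw [coe_scale, coe_scale, h]

lemma scale_one (τ : ℍ) : scale 1 one_pos τ = τ := by
  ext; rw [coe_scale]; simp

lemma discriminant_scale_left {σ τ : ℍ} {δ' : ℝ} (hδ' : 0 < δ') (α β κ ι : ℤ)
    (hdet : α * ι - β * κ = 1) (h : (σ : ℂ) * (κ * (δ' * τ) + ι) = α * (δ' * τ) + β) :
    discriminant σ = (κ * (δ' * τ) + ι) ^ 12 * discriminant (scale δ' hδ' τ) := by
  have := discriminant_scale (σ := σ) one_pos hδ' α β κ ι hdet (by simpa using h)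
  rwa [scale_one] at this

lemma discriminant_scale_right {σ τ : ℍ} {δ : ℝ} (hδ : 0 < δ) (α β κ ι : ℤ)
    (hdet : α * ι - β * κ = 1) (h : (δ : ℂ) * σ * (κ * τ + ι) = α * τ + β) :
    discriminant (scale δ hδ σ) = (κ * τ + ι) ^ 12 * discriminant τ := by
  have := discriminant_scale (σ := σ) (τ := τ) hδ one_pos α β κ ι hdet (by simpa using h)
  simpa [scale_one] using this

lemma glMat_smul_mul {a b c d : ℝ} (h : 0 < a * d - b * c) (τ : ℍ) :
    ((glMat a b c d h • τ : ℍ) : ℂ) * (c * τ + d) = a * τ + b := by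
  rw [coe_glMat_smul, div_mul_cancel₀ _ (denom_glMat_ne_zero h τ)]

/-- An element of Γ₀(pM) multiplies all four discriminants by the same automorphy factor. The matrix
W_M exchanges Δ(τ) with Δ(Mτ) and Δ(pτ) with Δ(pMτ), and the extra factors M¹² cancel between
numerator and denominator. -/
lemma dQuot_smul {p M : ℕ} (A : Admissible p M) : ALInvariant p M (dQuot A) := by
  intro e x y z w H h τ
  have hσ := glMat_smul_mul h τ
  have hne := denom_glMat_ne_zero h τ
  push_cast at hσ hne
  generalize glMat x y z w h • τ = σ at *
  obtain ⟨z, rfl⟩ := H.dvd_z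
  have hdet := H.det
  have n1 := discriminant_ne_zero (scale p (by exact_mod_cast A.hp.pos) τ)
  have n2 := discriminant_ne_zero
    (scale (p * M : ℕ) (by exact_mod_cast Nat.mul_pos A.hp.pos A.M_pos) τ)
  push_cast at hσ hne
  have hMC : (M : ℂ) ≠ 0 := by exact_mod_cast A.M_pos.ne'
  rw [dQuot, dQuot]
  rcases H.e_eq with rfl | rfl
  · push_cast at hdet
    rw [discriminant_transform (σ := τ) (σ' := σ) x y (p * M * z) w (by linear_combination hdet)
        (by push_cast; linear_combination hσ),
      discriminant_scale (δ := (M : ℕ)) (σ := σ) (τ := τ) (δ' := (M : ℕ))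
        _ (by exact_mod_cast A.M_pos) x (M * y) (p * z) w
        (by linear_combination hdet) (by push_cast; linear_combination M * hσ),
      discriminant_scale (δ := (p : ℕ)) (σ := σ) (τ := τ) (δ' := (p : ℕ))
        _ (by exact_mod_cast A.hp.pos) x (p * y) (M * z) w
        (by linear_combination hdet) (by push_cast; linear_combination p * hσ),
      discriminant_scale (δ := (p * M : ℕ)) (σ := σ) (τ := τ) (δ' := (p * M : ℕ)) _
        (by exact_mod_cast Nat.mul_pos A.hp.pos A.M_pos) x (p * M * y) z w
        (by linear_combination hdet) (by push_cast; linear_combination p * M * hσ)]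
    push_cast
    push_cast at n1 n2
    rw [show (p : ℂ) * z * (M * τ) + w = p * M * z * τ + w by ring,
      show (M : ℂ) * z * (p * τ) + w = p * M * z * τ + w by ring,
      show (z : ℂ) * (p * M * τ) + w = p * M * z * τ + w by ring]
    field_simp
  · have hMZ : (e : ℤ) ≠ 0 := by exact_mod_cast A.M_pos.ne'
    obtain ⟨x, rfl⟩ := H.dvd_x
    obtain ⟨w, rfl⟩ := H.dvd_w
    have hdet' : e * x * w - p * y * z = 1 := mul_left_cancel₀ hMZ (by linear_combination hdet)
    push_cast at hσ hne
    have hσ' : (σ : ℂ) * (p * z * τ + w) * e = e * x * τ + y := by linear_combination hσ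
    rw [discriminant_scale_left (σ := σ) (τ := τ) (δ' := (e : ℕ)) (by exact_mod_cast A.M_pos)
        x y (p * z) (e * w) (by linear_combination hdet') (by push_cast; linear_combination hσ'),
      discriminant_scale_right (σ := σ) (δ := (e : ℕ)) (τ := τ) _ (e * x) y (p * z) w
        (by linear_combination hdet') (by push_cast; linear_combination hσ'),
      discriminant_scale (σ := σ) (δ := (p : ℕ)) (τ := τ) (δ' := (p * e : ℕ)) _
        (by exact_mod_cast Nat.mul_pos A.hp.pos A.M_pos) x (p * y) z (e * w)
        (by linear_combination hdet') (by push_cast; linear_combination p * hσ'),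
      discriminant_scale (σ := σ) (δ := (p * e : ℕ)) (τ := τ) (δ' := (p : ℕ)) _
        (by exact_mod_cast A.hp.pos) (e * x) (p * y) z w
        (by linear_combination hdet') (by push_cast; linear_combination p * hσ')]
    push_cast
    push_cast at n1 n2
    have hne' : (p : ℂ) * z * τ + w ≠ 0 := by
      intro h0
      exact hne (by linear_combination (e : ℂ) * h0)
    rw [show (p : ℂ) * z * (e * τ) + e * w = e * (p * z * τ + w) by ring,
      show (z : ℂ) * (p * e * τ) + e * w = e * (p * z * τ + w) by ring,
      show (z : ℂ) * (p * τ) + w = p * z * τ + w by ring]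
    field_simp

/-- The Fricke involution τ ↦ -1/(pMτ) exchanges numerator and denominator up to a constant. This
transports the expansion at ∞ to the cusp 0. -/
lemma dQuot_invol {p M : ℕ} (A : Admissible p M) (ρ : ℍ) :
    dQuot A (invol (scale (p * M : ℕ) (by exact_mod_cast Nat.mul_pos A.hp.pos A.M_pos) ρ)) *
      dQuot A ρ = p ^ 24 := by
  have hpM : (0 : ℝ) < (p * M : ℕ) := by exact_mod_cast Nat.mul_pos A.hp.pos A.M_pos
  have hσ : ((invol (scale (p * M : ℕ) hpM ρ) : ℍ) : ℂ) * (p * M * ρ) = -1 := by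
    rw [coe_invol, coe_scale]
    have hρ : (ρ : ℂ) ≠ 0 := ρ.ne_zero
    have hMC : (M : ℂ) ≠ 0 := by exact_mod_cast A.M_pos.ne'
    have hpC : (p : ℂ) ≠ 0 := by exact_mod_cast A.hp.ne_zero
    push_cast
    field_simp
  generalize invol (scale (p * M : ℕ) hpM ρ) = σ at *
  have n1 := discriminant_ne_zero (scale p (by exact_mod_cast A.hp.pos) ρ)
  have n2 := discriminant_ne_zero (scale (p * M : ℕ) hpM ρ)
  have n3 := discriminant_ne_zero (scale M (by exact_mod_cast A.M_pos) ρ)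
  have n4 := discriminant_ne_zero ρ
  have hρ : (ρ : ℂ) ≠ 0 := ρ.ne_zero
  have hMC : (M : ℂ) ≠ 0 := by exact_mod_cast A.M_pos.ne'
  have hpC : (p : ℂ) ≠ 0 := by exact_mod_cast A.hp.ne_zero
  rw [dQuot, dQuot,
    discriminant_scale_left (σ := σ) (τ := ρ) hpM 0 (-1) 1 0 (by norm_num)
      (by push_cast; linear_combination hσ),
    discriminant_scale (δ := (M : ℕ)) (σ := σ) (τ := ρ) (δ' := (p : ℕ)) _ (by exact_mod_cast A.hp.pos)
      0 (-1) 1 0 (by norm_num) (by push_cast; linear_combination hσ),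
    discriminant_scale (δ := (p : ℕ)) (σ := σ) (τ := ρ) (δ' := (M : ℕ)) _ (by exact_mod_cast A.M_pos)
      0 (-1) 1 0 (by norm_num) (by push_cast; linear_combination hσ),
    discriminant_scale_right (δ := (p * M : ℕ)) (σ := σ) (τ := ρ) _ 0 (-1) 1 0 (by norm_num)
      (by push_cast; linear_combination hσ)]
  push_cast
  push_cast at n1 n2 n3
  generalize (ρ : ℂ) = x at *
  simp only [one_mul, add_zero]
  field_simp

/-! ### Behaviour of the eta quotient at ∞ and at 0. -/

/-- `p, M, h, r` with `M h r (p - 1) (M + 1) = 24`-type balancing. -/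
structure Params (p M h r : ℕ) : Prop extends Admissible p M where
  weight : h * r * ((p - 1) * (M + 1)) = 24

namespace Params

variable {p M h r : ℕ} (A : Params p M h r)
include A

lemma h_pos : 0 < h := by
  rcases Nat.eq_zero_or_pos h with rfl | h
  · simpa using A.weight
  · exact h

lemma p_ne : p ≠ 0 := A.hp.ne_zero
lemma M_ne : M ≠ 0 := A.M_pos.ne'
lemma h_ne : h ≠ 0 := A.h_pos.ne'

lemma level_pos : (0 : ℝ) < (p * M * h ^ 2 : ℕ) := by
  exact_mod_cast Nat.mul_pos (Nat.mul_pos A.hp.pos A.M_pos) (pow_pos A.h_pos 2)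

/-- The parameters of the `h`-th power. -/
lemma base : Params p M 1 (h * r) := ⟨A.toAdmissible, by rw [one_mul]; exact A.weight⟩

lemma fFun_pow_24 (τ : ℍ) : fFun p M h r τ ^ 24 =
    dQuot A.toAdmissible (scale h (by exact_mod_cast A.h_pos) τ) ^ r :=
  fFun_pow_eq_dQuot A.toAdmissible _ A.weight τ

lemma fFun_ne (τ : ℍ) : fFun p M h r τ ≠ 0 := fFun_ne_zero r A.p_ne A.M_ne A.h_ne τ

lemma holo_f : Holo (fFun p M h r) := holo_fFun r A.p_ne A.M_ne A.h_ne

lemma theta_f : fFun p M h r =Θ[atImInfty] fun τ => Real.exp (2 * π * τ.im) :=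
  isTheta_fFun r A.p_ne A.M_ne A.h_ne

lemma fFun_invol_pow (τ : ℍ) :
    (fFun p M h r (invol τ) * fFun p M h r (affine 0 (p * M * h ^ 2 : ℕ) A.level_pos τ)) ^ 24 =
      ((p : ℂ) ^ r) ^ 24 := by
  have hh : (0 : ℝ) < h := by exact_mod_cast A.h_pos
  have hpM : (0 : ℝ) < (p * M : ℕ) := by exact_mod_cast Nat.mul_pos A.hp.pos A.M_pos
  rw [mul_pow, A.fFun_pow_24, A.fFun_pow_24, ← mul_pow]
  have e1 : scale h hh (invol τ) = invol (scale (p * M : ℕ) hpM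
      (scale h hh (affine 0 (p * M * h ^ 2 : ℕ) A.level_pos τ))) := by
    ext
    simp only [coe_scale, coe_invol, coe_affine]
    have h1 : (h : ℂ) ≠ 0 := by exact_mod_cast A.h_ne
    have h2 : (p : ℂ) ≠ 0 := by exact_mod_cast A.p_ne
    have h3 : (M : ℂ) ≠ 0 := by exact_mod_cast A.M_ne
    have h4 : (τ : ℂ) ≠ 0 := τ.ne_zero
    push_cast
    field_simp
    simp [h4]
  rw [e1, dQuot_invol, ← pow_mul, ← pow_mul, mul_comm]

/-- The 24th root of unity lost in extracting roots disappears in absolute values, which is all that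
orders of growth require. -/
lemma norm_fFun_invol (τ : ℍ) :
    ‖fFun p M h r (invol τ)‖ * ‖fFun p M h r (affine 0 (p * M * h ^ 2 : ℕ) A.level_pos τ)‖ =
      (p : ℝ) ^ r := by
  have h1 := congrArg norm (A.fFun_invol_pow τ)
  rw [norm_pow, norm_pow, norm_mul, norm_pow, Complex.norm_natCast] at h1
  exact (pow_left_inj₀ (by positivity) (by positivity) (by norm_num)).1 h1

lemma theta_f_affine (v w : ℝ) (hw : 0 < w) : (fun τ => fFun p M h r (affine v w hw τ))
    =Θ[atImInfty] fun τ => Real.exp (2 * π * (τ.im / w)) := by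
  have h1 := A.theta_f.1.comp_tendsto (tendsto_affine v w hw)
  have h2 := A.theta_f.2.comp_tendsto (tendsto_affine v w hw)
  simp only [Function.comp_def, im_affine] at h1 h2
  exact ⟨h1, h2⟩

/-- The eta quotient has a simple zero at 0, a cusp of width pMh² for Γ₀(pMh²). -/
lemma theta_f_invol : (fun τ => fFun p M h r (invol τ))
    =Θ[atImInfty] fun τ => Real.exp (-(2 * π * (τ.im / (p * M * h ^ 2 : ℕ)))) := by
  have h1 := (A.theta_f_affine 0 (p * M * h ^ 2 : ℕ) A.level_pos).inv
  have h2 : (fun τ => fFun p M h r (invol τ)) =Θ[atImInfty]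
      fun τ => (p : ℂ) ^ r * (fFun p M h r (affine 0 (p * M * h ^ 2 : ℕ) A.level_pos τ))⁻¹ := by
    refine IsTheta.of_norm_eventuallyEq_norm (Eventually.of_forall fun τ => ?_)
    have hne : ‖fFun p M h r (affine 0 (p * M * h ^ 2 : ℕ) A.level_pos τ)‖ ≠ 0 :=
      norm_ne_zero_iff.2 (A.fFun_ne _)
    simp only [norm_mul, norm_inv, norm_pow, Complex.norm_natCast]
    rw [← A.norm_fFun_invol τ, mul_assoc, mul_inv_cancel₀ hne, mul_one]
  refine h2.trans ?_
  refine (IsTheta.const_mul_left (c := (p : ℂ) ^ r) ?_ h1).trans ?_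
  · exact pow_ne_zero _ (by exact_mod_cast A.p_ne)
  · refine EventuallyEq.isTheta (Eventually.of_forall fun τ => ?_)
    exact (Real.exp_neg _).symm

end Params

/-! ### Groups of type n|h and the Conway-Norton character. -/

/-- `g` is the matrix `(x, y / h; h z, w)` divided by `√e`. -/
def Represents (h e : ℕ) (x y z w : ℤ) (g : SL(2, ℝ)) : Prop :=
  Real.sqrt e • (g : Matrix (Fin 2) (Fin 2) ℝ) = !![(x : ℝ), (y : ℝ) / h; (h : ℝ) * z, (w : ℝ)]

namespace Represents

variable {h e : ℕ} {x y z w x' y' z' w' : ℤ} {g g' : SL(2, ℝ)}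

lemma exists_of_det (hh : 0 < h) (he : 0 < e) (hdet : x * w - y * z = e) :
    ∃ g : SL(2, ℝ), Represents h e x y z w g := by
  have h0 : Real.sqrt e ≠ 0 := by positivity
  have h1 : ((x * w - y * z : ℤ) : ℝ) = ((e : ℤ) : ℝ) := by rw [hdet]
  push_cast at h1
  have hh' : (h : ℝ) ≠ 0 := by positivity
  refine ⟨⟨(Real.sqrt e)⁻¹ • !![(x : ℝ), (y : ℝ) / h; (h : ℝ) * z, (w : ℝ)], ?_⟩, ?_⟩
  · rw [Matrix.det_smul, Matrix.det_fin_two_of, Fintype.card_fin, inv_pow,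
      Real.sq_sqrt (Nat.cast_nonneg e)]
    have he' : (e : ℝ) ≠ 0 := by positivity
    field_simp
    linear_combination h1
  · unfold Represents
    rw [smul_smul, mul_inv_cancel₀ h0, one_smul]

lemma det (hh : 0 < h) (H : Represents h e x y z w g) : x * w - y * z = e := by
  have h1 := congrArg Matrix.det H
  have hh' : (h : ℝ) ≠ 0 := by positivity
  rw [Matrix.det_smul, Matrix.det_fin_two_of, Fintype.card_fin,
      Real.sq_sqrt (Nat.cast_nonneg e), g.2] at h1
  have : ((x * w - y * z : ℤ) : ℝ) = ((e : ℤ) : ℝ) := by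
    push_cast
    field_simp at h1
    linear_combination -h1
  exact_mod_cast this

lemma mul_left (hh : 0 < h) (H : Represents h 1 x y z w g) (H' : Represents h e x' y' z' w' g') :
    Represents h e (x * x' + y * z') (x * y' + y * w') (z * x' + w * z') (z * y' + w * w')
      (g * g') := by
  have hh' : (h : ℝ) ≠ 0 := by positivity
  simp only [Represents, Nat.cast_one, Real.sqrt_one, one_smul] at H H'
  rw [Represents, Matrix.SpecialLinearGroup.coe_mul, ← Matrix.mul_smul, H, H', Matrix.mul_fin_two]
  push_cast
  rw [show (x : ℝ) * x' + y / h * (h * z') = x * x' + y * z' by field_simp,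
    show (x : ℝ) * (y' / h) + y / h * w' = (x * y' + y * w') / h by field_simp,
    show (h : ℝ) * z * x' + w * (h * z') = h * (z * x' + w * z') by ring,
    show (h : ℝ) * z * (y' / h) + w * w' = z * y' + w * w' by field_simp]

lemma mul_right (hh : 0 < h) (H : Represents h e x y z w g) (H' : Represents h 1 x' y' z' w' g') :
    Represents h e (x * x' + y * z') (x * y' + y * w') (z * x' + w * z') (z * y' + w * w')
      (g * g') := by
  have hh' : (h : ℝ) ≠ 0 := by positivity
  simp only [Represents, Nat.cast_one, Real.sqrt_one, one_smul] at H H'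
  rw [Represents, Matrix.SpecialLinearGroup.coe_mul, ← Matrix.smul_mul, H, H', Matrix.mul_fin_two]
  push_cast
  rw [show (x : ℝ) * x' + y / h * (h * z') = x * x' + y * z' by field_simp,
    show (x : ℝ) * (y' / h) + y / h * w' = (x * y' + y * w') / h by field_simp,
    show (h : ℝ) * z * x' + w * (h * z') = h * (z * x' + w * z') by ring,
    show (h : ℝ) * z * (y' / h) + w * w' = z * y' + w * w' by field_simp]

lemma inv (H : Represents h 1 x y z w g) : Represents h 1 w (-y) (-z) x g⁻¹ := by
  simp only [Represents, Nat.cast_one, Real.sqrt_one, one_smul] at H ⊢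
  rw [Matrix.SpecialLinearGroup.coe_inv, H, Matrix.adjugate_fin_two_of]
  push_cast
  congr 3 <;> ring_nf

lemma one : Represents h 1 1 0 0 1 1 := by
  simp [Represents, Matrix.one_fin_two]

lemma zpow_upper (hh : 0 < h) (H : Represents h 1 1 1 0 1 g) (k : ℤ) :
    Represents h 1 1 k 0 1 (g ^ k) := by
  induction k using Int.induction_on with
  | zero => simpa using one
  | succ k ih =>
    have := ih.mul_left hh H
    rw [zpow_add_one]
    convert this using 1 <;> ring
  | pred k ih =>
    have := ih.mul_left hh H.inv
    rw [zpow_sub_one]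
    convert this using 1 <;> ring

lemma zpow_lower {m : ℤ} (hh : 0 < h) (H : Represents h 1 1 0 m 1 g) (k : ℤ) :
    Represents h 1 1 0 (m * k) 1 (g ^ k) := by
  induction k using Int.induction_on with
  | zero => simpa using one
  | succ k ih =>
    have := ih.mul_left hh H
    rw [zpow_add_one]
    convert this using 1 <;> ring
  | pred k ih =>
    have := ih.mul_left hh H.inv
    rw [zpow_sub_one]
    convert this using 1 <;> ring

lemma smul (hh : 0 < h) (H : Represents h e x y z w g)
    (hd : 0 < (x : ℝ) * w - (y / h : ℝ) * (h * z)) (τ : ℍ) :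
    (Matrix.SpecialLinearGroup.toGL g : GL (Fin 2) ℝ) • τ =
      glMat x (y / h : ℝ) (h * z) w hd • τ := by
  have hd1 : 0 < g 0 0 * g 1 1 - g 0 1 * g 1 0 := by
    have := g.2
    rw [Matrix.det_fin_two] at this
    rw [this]; exact one_pos
  have e1 : (Matrix.SpecialLinearGroup.toGL g : GL (Fin 2) ℝ) =
      glMat (g 0 0) (g 0 1) (g 1 0) (g 1 1) hd1 := by
    apply Units.ext
    rw [coe_glMat]
    exact Matrix.eta_fin_two _
  have hs : Real.sqrt e ≠ 0 := by
    have h1 := H.det hh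
    intro h0
    have hh' : (h : ℝ) ≠ 0 := by positivity
    rw [Real.sqrt_eq_zero (Nat.cast_nonneg e)] at h0
    have h2 : ((x * w - y * z : ℤ) : ℝ) = ((e : ℤ) : ℝ) := by rw [h1]
    push_cast at h2
    rw [h0] at h2
    have : (x : ℝ) * w - (y / h : ℝ) * (h * z) = x * w - y * z := by field_simp
    linarith
  rw [e1]
  symm
  have hE : ∀ i j, Real.sqrt e * g i j =
      (!![(x : ℝ), (y : ℝ) / h; (h : ℝ) * z, (w : ℝ)] : Matrix (Fin 2) (Fin 2) ℝ) i j := by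
    intro i j
    rw [← H]
    simp
  refine glMat_smul_eq hd hd1 (Real.sqrt e) hs ?_ ?_ ?_ ?_ τ <;> simp [hE]

end Represents

/-- The parameters of the group `Γ₀(p M h | h) + M`, together with its set of
Atkin-Lehner involutions. -/
structure GroupParams (p M h r : ℕ) (S : Finset ℕ) : Prop extends Params p M h r where
  eq_of_mem : ∀ e ∈ S, e = M
  M_mem : M = 1 ∨ M ∈ S

/-- Conjugation by τ ↦ hτ carries Γ₀(pMh|h)+M to Γ₀(pM)+M; this reduces questions about the former
to the latter. -/
lemma scale_glMat_smul {h : ℕ} (hh : (0 : ℝ) < h) {x y z w : ℝ}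
    (hd : 0 < x * w - y / h * (h * z)) (hd' : 0 < x * w - y * z) (τ : ℍ) :
    scale h hh (glMat x (y / h) (h * z) w hd • τ) = glMat x y z w hd' • scale h hh τ := by
  rw [scale, scale, glMat_smul_glMat_smul, glMat_smul_glMat_smul]
  refine glMat_smul_eq _ _ 1 one_ne_zero ?_ ?_ ?_ ?_ τ <;> field_simp <;> ring

lemma scaled_det_pos {h : ℕ} (hh : (0 : ℝ) < h) {x y z w : ℝ} (hd : 0 < x * w - y * z) :
    0 < x * w - y / h * (h * z) := by
  have : x * w - y / h * (h * z) = x * w - y * z := by field_simp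
  rwa [this]

lemma AtkinLehner.represents_mem_wSet {p M h e : ℕ} {x y z w : ℤ} (H : AtkinLehner p M e x y z w)
    {g : SL(2, ℝ)} (hg : Represents h e x y z w g) : g ∈ wSet (p * M * h) h e := by
  obtain ⟨a, rfl⟩ := H.dvd_x
  obtain ⟨d, rfl⟩ := H.dvd_w
  obtain ⟨c, rfl⟩ := H.dvd_z
  refine ⟨a, y, c, d, hg.trans ?_⟩
  push_cast
  congr 3 <;> ring_nf

lemma exists_represents_of_mem_wSet {p M h e : ℕ} (hh : 0 < h) (he' : e = 1 ∨ e = M)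
    {g : SL(2, ℝ)} (hg : g ∈ wSet (p * M * h) h e) :
    ∃ x y z w : ℤ, AtkinLehner p M e x y z w ∧ Represents h e x y z w g := by
  obtain ⟨a, b, c, d, H⟩ := hg
  have hR : Represents h e (a * e) b (c * (p * M)) (d * e) g := by
    refine H.trans ?_
    push_cast
    congr 3; ring_nf
  exact ⟨_, _, _, _, ⟨he', hR.det hh, by simp, by simp, by simp⟩, hR⟩

namespace GroupParams

variable {p M h r : ℕ} {S : Finset ℕ} (A : GroupParams p M h r S)
include A

lemma h_pos' : (0 : ℝ) < h := by exact_mod_cast A.h_pos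

lemma mem_nhGroup {e : ℕ} {x y z w : ℤ} (H : AtkinLehner p M e x y z w) {g : SL(2, ℝ)}
    (hg : Represents h e x y z w g) : g ∈ nhGroup (p * M * h) h S := by
  refine Subgroup.subset_closure ?_
  have := H.represents_mem_wSet hg
  rcases H.e_eq with rfl | rfl
  · exact Or.inl this
  · rcases A.M_mem with h1 | h1
    · rw [h1] at this ⊢; exact Or.inl this
    · exact Or.inr (Set.mem_biUnion (by exact_mod_cast h1) this)

lemma dQuot_invariant {g : SL(2, ℝ)} (hg : g ∈ nhGroup (p * M * h) h S) (τ : ℍ) :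
    dQuot A.toAdmissible (scale h A.h_pos' ((Matrix.SpecialLinearGroup.toGL g : GL (Fin 2) ℝ) • τ))
      = dQuot A.toAdmissible (scale h A.h_pos' τ) := by
  have key : ∀ e : ℕ, (e = 1 ∨ e = M) → ∀ g ∈ wSet (p * M * h) h e, ∀ τ : ℍ,
      dQuot A.toAdmissible
        (scale h A.h_pos' ((Matrix.SpecialLinearGroup.toGL g : GL (Fin 2) ℝ) • τ))
      = dQuot A.toAdmissible (scale h A.h_pos' τ) := by
    intro e he' g hg τ
    obtain ⟨x, y, z, w, H, hR⟩ := exists_represents_of_mem_wSet A.h_pos he' hg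
    have hd := H.det_pos A.M_pos
    rw [hR.smul A.h_pos (scaled_det_pos A.h_pos' hd), scale_glMat_smul A.h_pos' _ hd,
      dQuot_smul A.toAdmissible e x y z w H]
  induction hg using Subgroup.closure_induction generalizing τ with
  | mem g hg =>
    rcases hg with hg | hg
    · exact key 1 (Or.inl rfl) g hg τ
    · obtain ⟨e, he, hg⟩ := Set.mem_iUnion₂.1 hg
      exact key e (Or.inr (A.eq_of_mem e he)) g hg τ
  | one => simp
  | mul g g' _ _ ih ih' => rw [map_mul, mul_smul, ih, ih']
  | inv g _ ih =>
    rw [← ih, smul_smul, ← map_mul, mul_inv_cancel, map_one, one_smul]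

end GroupParams

lemma mem_wSet_level {p M h : ℕ} {a b c d : ℤ} (hh : 0 < h) {g : SL(2, ℝ)}
    (hg : Represents h 1 a (h * b) (p * M * (h * c)) d g) : g ∈ wSet (p * M * h * h) 1 1 := by
  have hh' : (h : ℝ) ≠ 0 := by positivity
  refine ⟨a, b, c, d, hg.trans ?_⟩
  push_cast
  rw [show (h : ℝ) * b / h = b / 1 by field_simp]
  congr 3 <;> ring_nf

/-- If `h` divides suitable entries of `(x, y; z, w) (1, l; 0, 1) (1, 0; -p M j, 1) (1, -i; 0, 1)`,
the value of `λ` at `(x, y; z, w)` is determined by its values at `(1, 1; 0, 1)` and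
`(1, 0; p M, 1)`. -/
lemma lam_word_one {p M h : ℕ} {Γ : Subgroup SL(2, ℝ)} (hh : 0 < h) {x y c w : ℤ} (X Y g : Γ)
    (hX : Represents h 1 1 1 0 1 (X : SL(2, ℝ)))
    (hY : Represents h 1 1 0 (p * M) 1 (Y : SL(2, ℝ)))
    (hg : Represents h 1 x y (p * M * c) w (g : SL(2, ℝ))) (l j i : ℤ)
    (h1 : (h : ℤ) ∣ c - (w + p * M * c * l) * j)
    (h2 : (h : ℤ) ∣ (y + x * l) - (x - p * M * (y + x * l) * j) * i)
    (lam : Γ →* rootsOfUnity h ℂ) (hlam : IsConwayNorton (p * M * h) h Γ lam) :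
    lam g = lam X ^ (i - l) * lam Y ^ j := by
  obtain ⟨c', hc'⟩ := h1
  obtain ⟨b', hb'⟩ := h2
  have hk := ((hg.mul_left hh (hX.zpow_upper hh l)).mul_left hh (hY.zpow_lower hh (-j))).mul_left hh
    (hX.zpow_upper hh (-i))
  have hk2 : ((g * X ^ l * Y ^ (-j) * X ^ (-i) : Γ) : SL(2, ℝ)) ∈ wSet (p * M * h * h) 1 1 := by
    push_cast
    refine mem_wSet_level (a := x - p * M * (y + x * l) * j) (b := b') (c := c')
      (d := (w + p * M * c * l) - p * M * (c - (w + p * M * c * l) * j) * i) hh ?_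
    rw [← hc', ← hb']
    convert hk using 1 <;> ring
  have := hlam.level _ hk2
  simp only [map_mul, map_zpow] at this
  rw [zpow_sub, zpow_neg, zpow_neg] at *
  generalize lam X = a at *
  generalize lam Y = b at *
  rw [mul_inv_eq_one, mul_inv_eq_iff_eq_mul] at this
  rw [mul_right_comm, ← this, mul_inv_cancel_right]

lemma smul_eq_of_iff {s a b c d : ℝ} {m : Matrix (Fin 2) (Fin 2) ℝ} :
    s • m = !![a, b; c, d] ↔ s * m 0 0 = a ∧ s * m 0 1 = b ∧ s * m 1 0 = c ∧ s * m 1 1 = d := by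
  rw [← Matrix.ext_iff]
  simp [Fin.forall_fin_two, and_assoc]

/-- In 24|4 the matrices W_32 of level 96 are, after division by 4, those elements (2a, y/4; 24c,
2d) of w_2 for which 4 divides a and d. The rule gives λ = 1 there, since 32 exactly divides 96 and
its only prime divides 6. Translations on both sides bring an arbitrary element of w_2 into this
form. -/
lemma lam_word_four {Γ : Subgroup SL(2, ℝ)} (hΓ : wSet 24 4 2 ⊆ Γ) {a y c d : ℤ} (X g : Γ)
    (hX : Represents 4 1 1 1 0 1 (X : SL(2, ℝ)))
    (hg : Represents 4 2 (2 * a) y (6 * c) (2 * d) (g : SL(2, ℝ))) (l i : ℤ)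
    (h1 : 4 ∣ a + 3 * c * l) (h2 : 4 ∣ d + 3 * c * i)
    (lam : Γ →* rootsOfUnity 4 ℂ) (hlam : IsConwayNorton 24 4 Γ lam) :
    lam g = lam X ^ (-(l + i)) := by
  obtain ⟨a', ha'⟩ := h1
  obtain ⟨d', hd'⟩ := h2
  have hs : Real.sqrt (32 : ℕ) = 4 * Real.sqrt (2 : ℕ) := by
    rw [show ((32 : ℕ) : ℝ) = 4 ^ 2 * (2 : ℕ) by norm_num, Real.sqrt_mul (by norm_num),
      Real.sqrt_sq (by norm_num)]
  have hAL : IsAL 24 4 Γ 32 := by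
    refine ⟨⟨by norm_num, by norm_num⟩, ?_, ?_⟩
    · rintro k ⟨a, b, c, d, hk⟩
      refine hΓ ⟨4 * a, b, c, 4 * d, ?_⟩
      rw [hs, smul_eq_of_iff] at hk
      obtain ⟨e1, e2, e3, e4⟩ := hk
      rw [smul_eq_of_iff]
      push_cast at e1 e2 e3 e4 ⊢
      refine ⟨?_, ?_, ?_, ?_⟩ <;> linarith
    · intro q hq hqe
      have : q ∣ 2 ^ 5 := by simpa using hqe
      have := hq.dvd_of_dvd_pow this
      exact this.trans (by norm_num)
  have hk := ((hX.zpow_upper (by norm_num) l).mul_left (by norm_num) hg).mul_right (by norm_num)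
    (hX.zpow_upper (by norm_num) i)
  have hk2 : ((X ^ l * g * X ^ i : Γ) : SL(2, ℝ)) ∈ wSet (24 * 4) 1 32 := by
    refine ⟨a', y + 2 * a * i + 2 * d * l + 6 * c * l * i, c, d', ?_⟩
    have ha'' : ((a + 3 * c * l : ℤ) : ℝ) = ((4 * a' : ℤ) : ℝ) := by rw [ha']
    have hd'' : ((d + 3 * c * i : ℤ) : ℝ) = ((4 * d' : ℤ) : ℝ) := by rw [hd']
    rw [Represents, smul_eq_of_iff] at hk
    obtain ⟨e1, e2, e3, e4⟩ := hk
    rw [hs, smul_eq_of_iff]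
    push_cast at e1 e2 e3 e4 ha'' hd'' ⊢
    refine ⟨?_, ?_, ?_, ?_⟩ <;> linarith
  have := hlam.atkinLehner 32 hAL _ hk2
  simp only [map_mul, map_zpow] at this
  rw [zpow_neg, zpow_add]
  generalize lam X = a at *
  rw [eq_comm, inv_eq_iff_mul_eq_one, ← this]
  rw [mul_right_comm]

/-- Modulo 3 the matrix is reduced to a diagonal one by unipotent matrices. The shift l is needed
because w may vanish modulo 3. -/
lemma exists_ints_mod_three (x y c w : ℤ) (hdet : x * w - y * (2 * c) = 1) :
    ∃ l j i : ℤ, (3 : ℤ) ∣ c - (w + 2 * c * l) * j ∧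
      (3 : ℤ) ∣ (y + x * l) - (x - 2 * (y + x * l) * j) * i := by
  have key : ∀ x y c w : ZMod 3, x * w - y * (2 * c) = 1 → ∃ l j i : ZMod 3,
      c - (w + 2 * c * l) * j = 0 ∧ (y + x * l) - (x - 2 * (y + x * l) * j) * i = 0 := by
    decide
  have h0 := congrArg (Int.cast : ℤ → ZMod 3) hdet
  push_cast at h0
  obtain ⟨l, j, i, h1, h2⟩ := key _ _ _ _ h0
  obtain ⟨l, rfl⟩ := ZMod.intCast_surjective l
  obtain ⟨j, rfl⟩ := ZMod.intCast_surjective j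
  obtain ⟨i, rfl⟩ := ZMod.intCast_surjective i
  refine ⟨l, j, i, (ZMod.intCast_zmod_eq_zero_iff_dvd _ 3).1 ?_,
    (ZMod.intCast_zmod_eq_zero_iff_dvd _ 3).1 ?_⟩ <;> push_cast <;> assumption

/-- The determinant forces w and x - 6yj to be odd, hence to be their own inverses modulo 4; this
explains the witnesses and why no preliminary shift is needed. -/
lemma exists_ints_mod_four (x y c w : ℤ) (hdet : x * w - y * (6 * c) = 1) :
    ∃ j i : ℤ, (4 : ℤ) ∣ c - w * j ∧ (4 : ℤ) ∣ y - (x - 6 * y * j) * i := by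
  have key : ∀ x y c w : ZMod 4, x * w - y * (6 * c) = 1 → 
      c - w * (c * w) = 0 ∧ y - (x - 6 * y * (c * w)) * (y * (x - 6 * y * (c * w))) = 0 := by
    decide
  have h0 := congrArg (Int.cast : ℤ → ZMod 4) hdet
  push_cast at h0
  obtain ⟨h1, h2⟩ := key _ _ _ _ h0
  refine ⟨c * w, y * (x - 6 * y * (c * w)), (ZMod.intCast_zmod_eq_zero_iff_dvd _ 4).1 ?_,
    (ZMod.intCast_zmod_eq_zero_iff_dvd _ 4).1 ?_⟩ <;> push_cast <;> assumption

/-- The determinant forces c to be odd, so c² = 1 modulo 4 and a + 3c·(ca) = 4a = 0. -/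
lemma exists_ints_mod_four' (a y c d : ℤ) (hdet : 2 * a * (2 * d) - y * (6 * c) = 2) :
    ∃ l i : ℤ, (4 : ℤ) ∣ a + 3 * c * l ∧ (4 : ℤ) ∣ d + 3 * c * i := by
  have key : ∀ a y c d : ZMod 4, 2 * a * d - y * (3 * c) = 1 →
      a + 3 * c * (c * a) = 0 ∧ d + 3 * c * (c * d) = 0 := by
    decide
  have h0 : 2 * a * d - y * (3 * c) = 1 := by linarith
  have h0 := congrArg (Int.cast : ℤ → ZMod 4) h0
  push_cast at h0
  obtain ⟨h1, h2⟩ := key _ _ _ _ h0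
  refine ⟨c * a, c * d, (ZMod.intCast_zmod_eq_zero_iff_dvd _ 4).1 ?_,
    (ZMod.intCast_zmod_eq_zero_iff_dvd _ 4).1 ?_⟩ <;> push_cast <;> assumption

/-- Conjugation by τ ↦ -1/τ turns the stabilizer of 0 into translations. -/
lemma invol_lower {j : ℝ} (τ : ℍ) : glMat 1 0 j 1 (by norm_num) • invol τ =
    invol (affine (-j) 1 one_pos τ) := by
  rw [invol, invol, affine, glMat_smul_glMat_smul, glMat_smul_glMat_smul]
  refine glMat_smul_eq _ _ 1 one_ne_zero ?_ ?_ ?_ ?_ τ <;> ring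

lemma affine_affine {v w v' : ℝ} (hw : 0 < w) (τ : ℍ) :
    affine v w hw (affine v' 1 one_pos τ) = affine (v + v') w hw τ := by
  ext; simp only [coe_affine]; push_cast; ring

lemma affine_zero_one (τ : ℍ) : affine 0 1 one_pos τ = τ := by
  ext; simp [coe_affine]

/-- The pairs `(p, M)` occurring with a given `h`. -/
def AdmissibleIndex (p M h : ℕ) : Prop := h = 1 ∨ (p = 2 ∧ M = 1 ∧ h = 3) ∨ (p = 3 ∧ M = 2 ∧ h = 4)

namespace GroupParams

variable {p M h r : ℕ} {S : Finset ℕ} (A : GroupParams p M h r S)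
include A

/-- The exponents do not depend on λ. This is what makes the infimum over all λ in the fixing group
harmless. -/
lemma exists_word (hI : AdmissibleIndex p M h) {e : ℕ} {x y z w : ℤ} (H : AtkinLehner p M e x y z w)
    (X Y g : nhGroup (p * M * h) h S) (hX : Represents h 1 1 1 0 1 (X : SL(2, ℝ)))
    (hY : Represents h 1 1 0 (p * M) 1 (Y : SL(2, ℝ)))
    (hg : Represents h e x y z w (g : SL(2, ℝ))) :
    ∃ u v : ℤ, ∀ lam : nhGroup (p * M * h) h S →* rootsOfUnity h ℂ,
      IsConwayNorton (p * M * h) h (nhGroup (p * M * h) h S) lam →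
        lam g = lam X ^ u * lam Y ^ v := by
  obtain ⟨c, rfl⟩ := H.dvd_z
  have hdet := H.det
  rcases hI with rfl | ⟨rfl, rfl, rfl⟩ | ⟨rfl, rfl, rfl⟩
  -- For h = 1 the target of λ is trivial.
  · refine ⟨0, 0, fun lam _ => Subtype.ext ?_⟩
    have h1 : ∀ v : rootsOfUnity 1 ℂ, (v : ℂˣ) = 1 := fun v => by
      have := v.2
      rwa [mem_rootsOfUnity, pow_one] at this
    rw [h1, h1]
  · have he : e = 1 := by rcases H.e_eq with h | h <;> exact h
    subst he
    push_cast at hdet hg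
    obtain ⟨l, j, i, h1, h2⟩ := exists_ints_mod_three x y c w (by linear_combination hdet)
    exact ⟨i - l, j, fun lam hlam => lam_word_one (M := 1) (p := 2) (c := c) A.h_pos X Y g hX hY hg
      l j i (by push_cast; convert h1 using 1) (by push_cast; convert h2 using 1)
      lam hlam⟩
  · rcases H.e_eq with rfl | rfl
    · push_cast at hdet hg
      obtain ⟨j, i, h1, h2⟩ := exists_ints_mod_four x y c w (by linear_combination hdet)
      exact ⟨i - 0, j, fun lam hlam => lam_word_one (M := 2) (p := 3) (c := c) A.h_pos X Y g hX hY hg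
        0 j i (by push_cast; convert h1 using 1; ring) (by push_cast; convert h2 using 1; ring)
        lam hlam⟩
    · obtain ⟨a, rfl⟩ := H.dvd_x
      obtain ⟨d, rfl⟩ := H.dvd_w
      push_cast at hdet hg
      obtain ⟨l, i, h1, h2⟩ := exists_ints_mod_four' a y c d (by linear_combination hdet)
      refine ⟨-(l + i), 0, fun lam hlam => ?_⟩
      rw [zpow_zero, mul_one]
      refine lam_word_four ?_ X g hX (y := y) (a := a) (c := c) (d := d) hg l i h1 h2 lam hlam
      rcases A.M_mem with h3 | h3
      · norm_num at h3
      · exact fun k hk => Subgroup.subset_closure (Or.inr (Set.mem_biUnion (by exact_mod_cast h3) hk))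

/-- The sign depends on whether the Fricke involution belongs to the group. This need not be
decided: later steps use only that ε² = 1. -/
lemma exists_lam_Y (X Y : nhGroup (p * M * h) h S) (hX : Represents h 1 1 1 0 1 (X : SL(2, ℝ)))
    (hY : Represents h 1 1 0 (p * M) 1 (Y : SL(2, ℝ))) :
    ∃ ε : ℤ, ε * ε = 1 ∧ ∀ lam : nhGroup (p * M * h) h S →* rootsOfUnity h ℂ,
      IsConwayNorton (p * M * h) h (nhGroup (p * M * h) h S) lam → lam Y = lam X ^ ε := by
  have hX' : ((X : SL(2, ℝ)) : Matrix (Fin 2) (Fin 2) ℝ) = !![1, 1 / (h : ℝ); 0, 1] := by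
    simpa [Represents] using hX
  have hY' : ((Y : SL(2, ℝ)) : Matrix (Fin 2) (Fin 2) ℝ) = !![1, 0; ((p * M * h : ℕ) : ℝ), 1] := by
    have : (h : ℝ) * (p * M) = p * M * h := by ring
    simpa [Represents, this] using hY
  by_cases hF : HasFricke (p * M * h * h) (nhGroup (p * M * h) h S)
  · refine ⟨-1, by norm_num, fun lam hlam => ?_⟩
    rw [zpow_neg_one]
    refine Subtype.ext (Units.ext ?_)
    rw [hlam.y_eq_of_fricke hF Y hY', Subgroup.coe_inv, Units.val_inv_eq_inv_val,
      hlam.x_eq X hX', Complex.exp_neg, inv_inv]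
  · refine ⟨1, by norm_num, fun lam hlam => ?_⟩
    rw [zpow_one]
    refine Subtype.ext (Units.ext ?_)
    rw [hlam.y_eq_of_not_fricke hF Y hY', hlam.x_eq X hX']

lemma mem_fixingGroup (g : nhGroup (p * M * h) h S)
    (hg : ∀ lam : nhGroup (p * M * h) h S →* rootsOfUnity h ℂ,
      IsConwayNorton (p * M * h) h (nhGroup (p * M * h) h S) lam → lam g = 1) :
    (Matrix.SpecialLinearGroup.toGL (g : SL(2, ℝ)) : GL (Fin 2) ℝ) ∈
      fixingGroup (p * M * h) h S := by
  refine Subgroup.mem_map_of_mem _ (Subgroup.mem_map.2 ⟨g, ?_, rfl⟩)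
  rw [Subgroup.mem_iInf]
  exact fun lam => hg lam.1 lam.2

lemma exists_of_mem_fixingGroup {k : GL (Fin 2) ℝ} (hk : k ∈ fixingGroup (p * M * h) h S) :
    ∃ g ∈ nhGroup (p * M * h) h S, Matrix.SpecialLinearGroup.toGL g = k := by
  obtain ⟨g, hg, rfl⟩ := Subgroup.mem_map.1 hk
  obtain ⟨g', _, rfl⟩ := Subgroup.mem_map.1 hg
  exact ⟨_, g'.2, rfl⟩

lemma fFun_pow_invariant {k : GL (Fin 2) ℝ} (hk : k ∈ fixingGroup (p * M * h) h S) (τ : ℍ) :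
    fFun p M h r (k • τ) ^ 24 = fFun p M h r τ ^ 24 := by
  obtain ⟨g, hg, rfl⟩ := A.exists_of_mem_fixingGroup hk
  rw [A.fFun_pow_24, A.fFun_pow_24, A.dQuot_invariant hg]

lemma glMat_mem_fixingGroup {a b c d : ℤ} (hdet : a * d - b * (p * M * h ^ 2 * c) = 1)
    (hd : 0 < (a : ℝ) * d - b * (p * M * h ^ 2 * c)) :
    glMat a b (p * M * h ^ 2 * c) d hd ∈ fixingGroup (p * M * h) h S := by
  have h0 := A.h_pos'
  obtain ⟨g, hg⟩ := Represents.exists_of_det (x := a) (y := h * b) (z := p * M * (h * c)) (w := d)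
    A.h_pos one_pos (by push_cast; linear_combination hdet)
  have hm : g ∈ nhGroup (p * M * h) h S := A.mem_nhGroup (e := 1)
    ⟨Or.inl rfl, hg.det A.h_pos, by simp, by simp, Dvd.intro _ rfl⟩ hg
  have hK := A.mem_fixingGroup ⟨g, hm⟩ fun lam hlam =>
    hlam.level _ (mem_wSet_level A.h_pos hg)
  convert hK using 1
  apply Units.ext
  rw [coe_glMat]
  simp only [Represents, Nat.cast_one, Real.sqrt_one, one_smul] at hg
  refine Eq.trans ?_ hg.symm
  push_cast
  rw [show (h : ℝ) * b / h = b by field_simp]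
  congr 3; ring_nf

/-- A fixing group contains `W x^k` and `W y^j` for every Atkin-Lehner matrix `W` and suitable
`k, j`. -/
lemma exists_mem_fixingGroup (hI : AdmissibleIndex p M h) {e : ℕ} {x y z w : ℤ}
    (H : AtkinLehner p M e x y z w) (hd : 0 < (x : ℝ) * w - y / h * (h * z)) :
    (∃ k : ℤ, ∃ g ∈ fixingGroup (p * M * h) h S, ∀ τ : ℍ,
      g • τ = glMat x (y / h) (h * z) w hd • affine (k / h) 1 one_pos τ) ∧
    ∃ k : ℤ, ∃ g ∈ fixingGroup (p * M * h) h S, ∀ τ : ℍ,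
      g • τ = glMat x (y / h) (h * z) w hd • glMat 1 0 k 1 (by norm_num) • τ := by
  have hh := A.h_pos
  have h0 := A.h_pos'
  have he : 0 < e := by rcases H.e_eq with rfl | rfl; exacts [one_pos, A.M_pos]
  obtain ⟨g, hg⟩ := Represents.exists_of_det hh he H.det
  obtain ⟨X, hX⟩ := Represents.exists_of_det (x := 1) (y := 1) (z := 0) (w := 1)
    hh one_pos (by norm_num)
  obtain ⟨Y, hY⟩ := Represents.exists_of_det (x := 1) (y := 0) (z := p * M) (w := 1)
    hh one_pos (by norm_num)
  have mX : X ∈ nhGroup (p * M * h) h S := A.mem_nhGroup (e := 1)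
    ⟨Or.inl rfl, by norm_num, by simp, by simp, by simp⟩ hX
  have mY : Y ∈ nhGroup (p * M * h) h S := A.mem_nhGroup (e := 1)
    ⟨Or.inl rfl, by norm_num, by simp, by simp, by simp⟩ hY
  have mg := A.mem_nhGroup H hg
  obtain ⟨u, v, huv⟩ := A.exists_word hI H ⟨X, mX⟩ ⟨Y, mY⟩ ⟨g, mg⟩ hX hY hg
  obtain ⟨ε, hε, hY'⟩ := A.exists_lam_Y ⟨X, mX⟩ ⟨Y, mY⟩ hX hY
  constructor
  -- With λ(Y) = λ(X)^ε one has λ(g) = λ(X)^(u + εv), which a power of X cancels. A power of Y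
  -- cancels it as well, because ε is its own inverse.
  · refine ⟨-(u + ε * v), _, A.mem_fixingGroup (⟨g, mg⟩ * ⟨X, mX⟩ ^ (-(u + ε * v)))
      fun lam hlam => ?_, fun τ => ?_⟩
    · rw [map_mul, map_zpow, huv lam hlam, hY' lam hlam, ← zpow_mul, ← zpow_add, ← zpow_add,
        add_neg_cancel, zpow_zero]
    · push_cast
      rw [map_mul, mul_smul, hg.smul hh hd, (hX.zpow_upper hh _).smul hh (by simp)]
      congr 1
      refine glMat_smul_eq _ _ 1 one_ne_zero ?_ ?_ ?_ ?_ τ <;> simp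
  · refine ⟨h * (p * M * (-(v + ε * u))), _, A.mem_fixingGroup
      (⟨g, mg⟩ * ⟨Y, mY⟩ ^ (-(v + ε * u))) fun lam hlam => ?_, fun τ => ?_⟩
    · rw [map_mul, map_zpow, huv lam hlam, hY' lam hlam, ← zpow_mul, ← zpow_mul, ← zpow_add,
        ← zpow_add, show u + ε * v + ε * -(v + ε * u) = 0 by linear_combination -u * hε, zpow_zero]
    · push_cast
      rw [map_mul, mul_smul, hg.smul hh hd, (hY.zpow_lower hh _).smul hh (by simp)]
      congr 1
      refine glMat_smul_eq _ _ 1 one_ne_zero ?_ ?_ ?_ ?_ τ <;> simp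

/-- A function invariant under the fixing group is transformed by an Atkin-Lehner matrix only
through a translation by a multiple of 1/h, which does not affect boundedness at i∞. -/
lemma invariant_infty (hI : AdmissibleIndex p M h) {f : ℍ → ℂ}
    (hf : ∀ k ∈ fixingGroup (p * M * h) h S, ∀ τ, f (k • τ) = f τ) {e : ℕ} {x y z w : ℤ}
    (H : AtkinLehner p M e x y z w) (hd : 0 < (x : ℝ) * w - y / h * (h * z)) :
    ∃ k : ℤ, ∀ τ : ℍ, f (glMat x (y / h) (h * z) w hd • τ) = f (affine (k / h) 1 one_pos τ) := by
  obtain ⟨k, g, hg, hgτ⟩ := (A.exists_mem_fixingGroup hI H hd).1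
  refine ⟨-k, fun τ => ?_⟩
  rw [← hf g hg (affine _ _ _ τ), hgτ, affine_affine]
  have : (k : ℝ) / h + ((-k : ℤ) : ℝ) / h = 0 := by push_cast; ring
  rw [this, affine_zero_one]

/-- The analogue at the cusp 0: the correction is a power of y, which becomes a translation after
conjugation by τ ↦ -1/τ. -/
lemma invariant_zero (hI : AdmissibleIndex p M h) {f : ℍ → ℂ}
    (hf : ∀ k ∈ fixingGroup (p * M * h) h S, ∀ τ, f (k • τ) = f τ) {e : ℕ} {x y z w : ℤ}
    (H : AtkinLehner p M e x y z w) (hd : 0 < (x : ℝ) * w - y / h * (h * z)) :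
    ∃ k : ℤ, ∀ τ : ℍ, f (glMat x (y / h) (h * z) w hd • invol τ) =
      f (invol (affine k 1 one_pos τ)) := by
  obtain ⟨k, g, hg, hgτ⟩ := (A.exists_mem_fixingGroup hI H hd).2
  refine ⟨k, fun τ => ?_⟩
  rw [← hf g hg (invol (affine _ _ _ τ)), hgτ, invol_lower, affine_affine]
  have : -(k : ℝ) + (k : ℝ) = 0 := by ring
  rw [this, affine_zero_one]

end GroupParams

/-! ### From functions on ℍ to power series, and decay at i∞. -/

lemma exists_qq_eq {q : ℂ} (hq : ‖q‖ < 1) (hq0 : q ≠ 0) : ∃ τ : ℍ, qq τ = q := by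
  have h2 : (2 * π * Complex.I : ℂ) ≠ 0 := Complex.two_pi_I_ne_zero
  have him : 0 < (Complex.log q / (2 * π * Complex.I)).im := by
    have h3 : Complex.log q / (2 * π * Complex.I) = -Complex.I * Complex.log q / (2 * π : ℝ) := by
      push_cast
      have : (π : ℂ) ≠ 0 := by exact_mod_cast Real.pi_ne_zero
      have hI := Complex.I_ne_zero
      field_simp
      linear_combination Complex.log q * Complex.I_sq
    rw [h3, Complex.div_ofReal_im]
    have h4 : Real.log ‖q‖ < 0 := Real.log_neg (norm_pos_iff.2 hq0) hq
    have : (-Complex.I * Complex.log q).im = -Real.log ‖q‖ := by simp [Complex.log_re]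
    rw [this]
    have := Real.pi_pos
    exact div_pos (by linarith) (by linarith)
  refine ⟨⟨_, him⟩, ?_⟩
  rw [qq]
  change Complex.exp (2 * π * Complex.I * (Complex.log q / (2 * π * Complex.I))) = q
  rw [mul_div_cancel₀ _ h2, Complex.exp_log hq0]

/-- A power series in `q` that converges on the upper half plane converges on the unit disc. -/
lemma exists_hasVal_of_hasSum {F : ℂ⟦X⟧} {f : ℍ → ℂ}
    (h : ∀ τ, HasSum (fun n : ℕ => PowerSeries.coeff n F * qq τ ^ n) (f τ)) :
    ∃ v, HasVal F v ∧ ∀ τ, v (qq τ) = f τ := by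
  have hs : ∀ q : ℂ, ‖q‖ < 1 → Summable fun n : ℕ => PowerSeries.coeff n F * q ^ n := by
    intro q hq
    rcases eq_or_ne q 0 with rfl | h0
    · exact summable_of_ne_finset_zero (s := {0}) fun n hn => by
        rw [zero_pow (by simpa using hn), mul_zero]
    · obtain ⟨τ, rfl⟩ := exists_qq_eq hq h0
      exact (h τ).summable
  exact ⟨fun q => ∑' n : ℕ, PowerSeries.coeff n F * q ^ n, fun q hq => (hs q hq).hasSum,
    fun τ => (h τ).tsum_eq⟩

/-- The function `q f(τ)` of `q`, for `f` with a `q`-expansion with at most a simple pole at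
`∞`. -/
lemma HasQExpansion.exists_hasVal {f : ℍ → ℂ} {a : ℤ → ℂ} (hf : HasQExpansion f a)
    (ha : ∀ m < -1, a m = 0) :
    ∃ v, HasVal (PowerSeries.mk fun n => a (n - 1)) v ∧ ∀ τ, v (qq τ) = f τ * qq τ := by
  refine exists_hasVal_of_hasSum fun τ => ?_
  have hinj : Function.Injective (fun n : ℕ => (n : ℤ) - 1) := fun a b h => by simpa using h
  have h1 := (hinj.hasSum_iff (f := fun m : ℤ =>
    a m * Complex.exp (2 * π * Complex.I * m * τ)) (a := f τ) ?_).2 (hf τ)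
  · refine (h1.mul_right (qq τ)).congr_fun fun n => ?_
    simp only [Function.comp, PowerSeries.coeff_mk]
    rw [mul_assoc, qq, ← Complex.exp_add, ← Complex.exp_nat_mul]
    congr 2
    push_cast
    ring
  · intro m hm
    rw [ha, zero_mul]
    by_contra! h
    exact hm ⟨(m + 1).toNat, by simp only; omega⟩

/-- A bounded holomorphic `H`-periodic function on `ℍ` converges exponentially at `i∞`. -/
lemma exists_isBigO_sub {f : ℍ → ℂ} (hol : Holo f) (hb : IsBoundedAtImInfty f) {H : ℕ} (hH : H ≠ 0)
    (hper : ∀ τ, f (affine H 1 one_pos τ) = f τ) :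
    ∃ c : ℂ, (fun τ => f τ - c) =O[atImInfty] fun τ => Real.exp (-(2 * π * (τ.im / H))) := by
  refine ⟨valueAtInfty f, ?_⟩
  have := exp_decay_sub_atImInfty (f := f) (h := H) (by positivity) ?_ hol.mdiff hb
  · refine this.congr_right fun τ => ?_
    congr 1; ring
  · intro w
    by_cases hw : 0 < w.im
    · have h' : 0 < (w + (H : ℝ)).im := by simpa using hw
      simp only [Function.comp, ofComplex_apply_of_im_pos hw]
      rw [ofComplex_apply_of_im_pos h', ← hper ⟨w, hw⟩]
      congr 1
      ext
      rw [coe_affine]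
      simp
    · have h' : (w + (H : ℝ)).im ≤ 0 := by simpa using hw
      simp only [Function.comp]
      rw [ofComplex_apply_eq_of_im_nonpos h' (not_lt.1 hw)]

/-- A holomorphic function with a constant power is constant. -/
lemma const_of_pow_const {f : ℍ → ℂ} (hol : Holo f) {n : ℕ} (hn : n ≠ 0) {k : ℂ}
    (hf : ∀ τ, f τ ^ n = k) : ∃ c, ∀ τ, f τ = c := by
  rcases eq_or_ne k 0 with rfl | hk
  · exact ⟨0, fun τ => eq_zero_of_pow_eq_zero (hf τ)⟩
  have hopen : IsOpen {z : ℂ | 0 < z.im} := isOpen_lt continuous_const Complex.continuous_im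
  have hpre : IsPreconnected {z : ℂ | 0 < z.im} := (convex_halfSpace_im_gt 0).isPreconnected
  have hne : ∀ τ, f τ ≠ 0 := fun τ h0 => hk (by rw [← hf τ, h0, zero_pow hn])
  have hd : {z : ℂ | 0 < z.im}.EqOn (deriv fun z => f (ofComplex z)) 0 := by
    intro z hz
    have h1 := (hol.differentiableAt (hopen.mem_nhds hz)).hasDerivAt
    have h2 := h1.pow n
    have h3 : (fun z => f (ofComplex z)) ^ n = fun _ => k := funext fun z => hf _
    rw [h3] at h2
    have h4 := h2.unique (hasDerivAt_const z k)
    simpa [hn, hne, pow_eq_zero_iff'] using h4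
  obtain ⟨c, hc⟩ := hopen.exists_is_const_of_deriv_eq_zero hpre hol hd
  exact ⟨c, fun τ => by simpa using hc _ τ.im_pos⟩

lemma glMat_invol_isParabolic {c : ℝ} (hc : c ≠ 0) :
    (glMat 1 0 c 1 (by norm_num)).IsParabolic := by
  refine ⟨?_, ?_⟩
  · rintro ⟨a, ha⟩
    have := congrFun (congrFun ha 1) 0
    rw [coe_glMat] at this
    simp at this
    exact hc this.symm
  · rw [coe_glMat, Matrix.discr_fin_two, Matrix.trace_fin_two_of, Matrix.det_fin_two_of]
    norm_num

lemma exists_reduced {u v : ℤ} (h : u ≠ 0 ∨ v ≠ 0) :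
    ∃ a c : ℤ, IsCoprime a c ∧ a * v = c * u := by
  have hg : Int.gcd u v ≠ 0 := by
    rw [Ne, Int.gcd_eq_zero_iff]; tauto
  obtain ⟨a, ha⟩ := Int.gcd_dvd_left u v
  obtain ⟨c, hc⟩ := Int.gcd_dvd_right u v
  refine ⟨a, c, ?_, ?_⟩
  · have := Int.gcd_eq_gcd_ab u v
    refine ⟨Int.gcdA u v, Int.gcdB u v,
      mul_left_cancel₀ (a := (Int.gcd u v : ℤ)) (by exact_mod_cast hg) ?_⟩
    conv_rhs => rw [mul_one, this]
    conv_rhs => enter [1, 1]; rw [ha]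
    conv_rhs => enter [2, 1]; rw [hc]
    ring
  · conv_lhs => rw [hc]
    conv_rhs => rw [ha]
    ring

lemma isBoundedAtImInfty_const_mul_of_isBigO {f : ℍ → ℂ} {g : ℍ → ℂ} {k : ℍ → ℝ}
    (hf : f =O[atImInfty] k) (hg : g =Θ[atImInfty] k) (hk : ∀ τ, k τ ≠ 0) :
    IsBoundedAtImInfty (fun τ => f τ / g τ) := by
  have h1 := hf.mul hg.inv.1
  rw [IsBoundedAtImInfty, BoundedAtFilter]
  refine h1.trans (EventuallyEq.isBigO (Eventually.of_forall fun τ => ?_))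
  simp [mul_inv_cancel₀ (hk τ)]

/-! ### Identification of the Hauptmodul with the eta quotient. -/

namespace GroupParams

variable {p M h r : ℕ} {S : Finset ℕ} (A : GroupParams p M h r S)
include A

/-- The principal criterion: a holomorphic function invariant under the fixing group with at most a
simple pole at `∞`, bounded at `0`, agrees with `fFun` up to an additive constant. -/
lemma eq_fFun_add_const (hI : AdmissibleIndex p M h) {f : ℍ → ℂ} (hol : Holo f)
    (hf : ∀ k ∈ fixingGroup (p * M * h) h S, ∀ τ, f (k • τ) = f τ)
    (hinf : Tendsto (fun τ => f τ * qq τ) atImInfty (𝓝 1))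
    (hzero : IsBoundedAtImInfty fun τ => f (invol τ)) : ∃ c : ℂ, ∀ τ, f τ = fFun p M h r τ + c := by
  have hN : p * M * h ^ 2 ≠ 0 := by exact_mod_cast A.level_pos.ne'
  have : NeZero (p * M * h ^ 2) := ⟨hN⟩
  have hhol0 : Holo (fun τ => f (invol τ)) := hol.comp_smul (by norm_num)
  have hper : ∀ τ, f (invol (affine (p * M * h ^ 2 : ℕ) 1 one_pos τ)) = f (invol τ) := by
    intro τ
    have h1 := hf _ (A.glMat_mem_fixingGroup (a := 1) (b := 0) (c := -1) (d := 1) (by norm_num)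
      (by norm_num)) (invol τ)
    rw [← h1]
    have h2 := invol_lower (j := -(p * M * h ^ 2 : ℕ)) τ
    rw [neg_neg] at h2
    rw [← h2]
    congr 1
    refine glMat_smul_eq _ _ 1 one_ne_zero ?_ ?_ ?_ ?_ _ <;> push_cast <;> ring
  -- Here c is the value of f at the cusp 0. The decay of f - c matches the simple zero of `fFun` at
  -- 0, so their quotient stays bounded there.
  obtain ⟨c, hc⟩ := exists_isBigO_sub hhol0 hzero hN hper
  -- The 24th power is taken because only the 24th power of `fFun` is known to be invariant so far.
  set G : ℍ → ℂ := fun τ => ((f τ - c) / fFun p M h r τ) ^ 24 with hG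
  have holQ : Holo (fun τ => (f τ - c) / fFun p M h r τ) := by
    simpa only [div_eq_mul_inv] using (hol.sub (Holo.const c)).mul (A.holo_f.inv A.fFun_ne)
  have limQ : Tendsto (fun τ => (f τ - c) / fFun p M h r τ) atImInfty (𝓝 1) := by
    have h1 := tendsto_fFun_mul_qq r A.p_ne A.M_ne A.h_ne
    have h2 := (hinf.sub (tendsto_qq.const_mul c)).div h1 one_ne_zero
    rw [mul_zero, sub_zero, div_one] at h2
    refine h2.congr fun τ => ?_
    simp only [Pi.div_apply]
    rw [← sub_mul, mul_div_mul_right _ _ (qq_ne_zero τ)]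
  have hGK : ∀ k ∈ fixingGroup (p * M * h) h S, ∀ τ, G (k • τ) = G τ := by
    intro k hk τ
    simp only [hG, div_pow]
    rw [hf k hk, A.fFun_pow_invariant hk]
  have bG : IsBoundedAtImInfty G := by
    have := (limQ.pow 24).isBigO_one ℝ
    exact this
  have bG0 : IsBoundedAtImInfty fun τ => G (invol τ) := by
    have := isBoundedAtImInfty_const_mul_of_isBigO hc A.theta_f_invol (fun _ => (Real.exp_pos _).ne')
    exact (IsBigO.pow this 24).congr_right fun _ => one_pow 24
  have holG : Holo G := holQ.pow 24
  clear_value G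
  obtain ⟨k, hk⟩ := const_of_bounded (N := p * M * h ^ 2) (f := G) holG (by
    intro γ hγ τ
    rw [Gamma0_mem, ZMod.intCast_zmod_eq_zero_iff_dvd] at hγ
    obtain ⟨c', hc'⟩ := hγ
    have hdet := γ.det_coe
    rw [Matrix.det_fin_two, hc'] at hdet
    push_cast at hdet hc'
    have hd : 0 < ((γ 0 0 : ℤ) : ℝ) * (γ 1 1 : ℤ) - (γ 0 1 : ℤ) * (p * M * h ^ 2 * c') := by
      have : ((γ 0 0 : ℤ) : ℝ) * (γ 1 1 : ℤ) - (γ 0 1 : ℤ) * (p * M * h ^ 2 * c') = 1 := by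
        exact_mod_cast hdet
      rw [this]; exact one_pos
    rw [← hGK _ (A.glMat_mem_fixingGroup hdet hd) τ, sl_smul_eq_glMat]
    congr 1
    refine glMat_smul_eq _ _ 1 one_ne_zero ?_ ?_ ?_ ?_ _ <;> simp [hc']) (by
    intro γ
    -- The cusp γ∞ is multiplied by h and written in lowest terms a/c', so that the classification
    -- of cusps for Γ₀(pM)+M applies.
    obtain ⟨a, c', hac, hrel⟩ := exists_reduced (u := h * γ 0 0) (v := γ 1 0) (by
      by_contra! hcon
      have h1 := col_eq γ
      have h2 : (γ 0 0 : ℤ) = 0 := by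
        have := hcon.1
        have hh : (h : ℤ) ≠ 0 := by exact_mod_cast A.h_ne
        exact (mul_eq_zero.1 this).resolve_left hh
      rw [h2, hcon.2] at h1
      exact not_isCoprime_zero_zero h1)
    have hrel' : (a : ℝ) * (γ 1 0 : ℤ) = c' * (h * (γ 0 0 : ℤ)) := by exact_mod_cast hrel
    have nz : (a : ℝ) ≠ 0 ∨ (c' : ℝ) ≠ 0 := by
      by_contra! hcon
      have h1 : a = 0 := by exact_mod_cast hcon.1
      have h2 : c' = 0 := by exact_mod_cast hcon.2
      rw [h1, h2] at hac
      exact not_isCoprime_zero_zero hac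
    have transfer : ∀ x z : ℤ, x * c' = z * a → (x : ℝ) * (γ 1 0 : ℤ) = h * z * (γ 0 0 : ℤ) := by
      intro x z hxz
      have hxz' : (x : ℝ) * c' = z * a := by exact_mod_cast hxz
      rcases nz with h0 | h0
      · refine mul_left_cancel₀ h0 ?_
        linear_combination (x : ℝ) * hrel' + h * (γ 0 0 : ℤ) * hxz'
      · refine mul_left_cancel₀ h0 ?_
        linear_combination (γ 1 0 : ℤ) * hxz' + z * hrel'
    by_cases hc : (p : ℤ) ∣ c'
    · obtain ⟨e, x, y, z, w, H, hx⟩ := A.exists_smul_infty hac hc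
      have hd := scaled_det_pos A.h_pos' (H.det_pos A.M_pos)
      obtain ⟨k, hk⟩ := A.invariant_infty hI hGK H hd
      apply bounded_transport (g := glMat x (y / h) (h * z) w hd)
      · exact transfer x z hx
      · simp only [hk]
        exact bG.comp_tendsto (tendsto_affine _ _ _)
    · obtain ⟨e, x, y, z, w, H, hx⟩ := A.exists_smul_zero hac hc
      have hd := scaled_det_pos A.h_pos' (H.det_pos A.M_pos)
      obtain ⟨k, hk⟩ := A.invariant_zero hI hGK H hd
      have hS : (0 : ℝ) < 0 * 0 - (-1) * 1 := by norm_num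
      apply bounded_transport (g := glMat x (y / h) (h * z) w hd * glMat 0 (-1) 1 0 hS)
      · rw [Units.val_mul, coe_glMat, coe_glMat, Matrix.mul_fin_two]
        simp only [Matrix.of_apply, Matrix.cons_val', Matrix.cons_val_zero, Matrix.cons_val_one]
        have := transfer y w hx
        have h0 := A.h_pos'
        field_simp
        linear_combination this
      · simp only [mul_smul]
        have hfun : (fun τ : ℍ => G (glMat x (y / h) (h * z) w hd • glMat 0 (-1) 1 0 hS • τ)) =
          (fun τ => G (invol τ)) ∘ affine k 1 one_pos := funext hk
        rw [hfun]
        exact bG0.comp_tendsto (tendsto_affine k 1 one_pos))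
  obtain ⟨k', hk'⟩ := const_of_pow_const holQ (n := 24) (by norm_num) (k := k)
    fun τ => by rw [← hk τ, hG]
  -- Both f and `fFun` have leading term q⁻¹, so the constant quotient is 1.
  have hk1 : k' = 1 := by
    refine tendsto_nhds_unique ?_ limQ
    simp only [hk']
    exact tendsto_const_nhds
  refine ⟨c, fun τ => ?_⟩
  have := hk' τ
  rw [hk1, div_eq_one_iff_eq (A.fFun_ne τ)] at this
  linear_combination this

/-- The cusp `0` is a cusp of the fixing group. -/
lemma isCusp_zero : IsCusp ((0 : ℝ) : OnePoint ℝ) (fixingGroup (p * M * h) h S) := by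
  refine ⟨_, A.glMat_mem_fixingGroup (a := 1) (b := 0) (c := 1) (d := 1) (by norm_num)
    (by norm_num), ?_, ?_⟩
  · have h0 : (p * M * h ^ 2 * (1 : ℤ) : ℝ) ≠ 0 := by
      have := A.level_pos.ne'
      push_cast at this ⊢
      simpa using this
    convert glMat_invol_isParabolic h0 using 2 <;> simp
  · rw [OnePoint.smul_some_eq_ite]
    simp [coe_glMat]

/-- The cusps `0` and `∞` are inequivalent under the fixing group. -/
lemma not_equivalent_zero :
    ¬ ∃ g ∈ fixingGroup (p * M * h) h S, g • OnePoint.infty = ((0 : ℝ) : OnePoint ℝ) := by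
  rintro ⟨g, hg, hg0⟩
  have hg00 : g 0 0 = 0 := by
    rw [OnePoint.smul_infty_eq_ite] at hg0
    split_ifs at hg0 with h1
    · exact absurd hg0 (OnePoint.infty_ne_coe _)
    have : g 0 0 / g 1 0 = 0 := OnePoint.coe_injective hg0
    exact (div_eq_zero_iff.1 this).resolve_right h1
  have hS : (0 : ℝ) < 0 * 0 - (-1) * 1 := by norm_num
  set J := glMat 0 (-1) 1 0 hS with hJ
  set u := J⁻¹ * g with hu
  have hu10 : u 1 0 = 0 := by
    have h1 : J * u = g := mul_inv_cancel_left _ _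
    have h2 : (J * u) 0 0 = 0 := by rw [h1, hg00]
    rw [Units.val_mul, Matrix.mul_apply, Fin.sum_univ_two, hJ, coe_glMat] at h2
    simpa using h2
  have h3 : ∀ τ : ℍ, g • τ = invol (u • τ) := by
    intro τ
    change g • τ = J • u • τ
    rw [smul_smul, hu, mul_inv_cancel_left]
  -- An equivalence of the two cusps would make the invariant function f^24 tend to 0 at i∞, where
  -- it has a pole.
  have t1 : Tendsto (fun τ : ℍ => fFun p M h r (g • τ) ^ 24) atImInfty (𝓝 0) := by
    have h4 : Tendsto (fun τ => fFun p M h r (invol τ)) atImInfty (𝓝 0) := by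
      refine A.theta_f_invol.1.trans_tendsto ?_
      have := tendsto_im_atImInfty_iff.1 (tendsto_id (α := ℍ) (x := atImInfty))
      exact Real.tendsto_exp_neg_atTop_nhds_zero.comp
        ((this.atTop_div_const A.level_pos).const_mul_atTop (by positivity))
    have h5 := (h4.comp (tendsto_smul_atImInfty hu10)).pow 24
    simp only [Function.comp_def, ← h3] at h5
    simpa using h5
  simp only [A.fFun_pow_invariant hg] at t1
  have t2 : Tendsto (fun τ : ℍ => (fFun p M h r τ * qq τ) ^ 24) atImInfty (𝓝 0) := by
    have := t1.mul (tendsto_qq.pow 24)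
    simpa [mul_pow] using this
  have t3 := (tendsto_fFun_mul_qq r A.p_ne A.M_ne A.h_ne).pow 24
  have := tendsto_nhds_unique t2 t3
  norm_num at this

/-- The normalized Hauptmodul is `fFun` up to an additive constant. -/
theorem hauptmodul_eq (hI : AdmissibleIndex p M h) {T : ℍ → ℂ}
    (hT : IsNormalizedHauptmodul (fixingGroup (p * M * h) h S) T) :
    ∃ c : ℂ, ∀ τ, T τ = fFun p M h r τ + c := by
  obtain ⟨a, ha, ha1, _, hlow⟩ := hT.expansion
  obtain ⟨v, hv, hvT⟩ := ha.exists_hasVal hlow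
  refine A.eq_fFun_add_const hI hT.holomorphic hT.modular.invariant ?_ ?_
  · have := (hv.tendsto.comp tendsto_qq)
    simpa [Function.comp_def, hvT, ha1] using this
  · have h1 := hT.bounded _ A.isCusp_zero A.not_equivalent_zero
    have hS : (0 : ℝ) < 0 * 0 - (-1) * 1 := by norm_num
    have h2 := h1 (glMat 0 (-1) 1 0 hS) (by
      rw [OnePoint.smul_infty_eq_ite]
      simp [coe_glMat])
    refine h2.congr_left fun τ => ?_
    have hdet : ((glMat 0 (-1) 1 0 hS : GL (Fin 2) ℝ) : Matrix (Fin 2) (Fin 2) ℝ).det = 1 := by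
      rw [coe_glMat, Matrix.det_fin_two_of]; norm_num
    have hσ : UpperHalfPlane.σ (glMat 0 (-1) 1 0 hS) = ContinuousAlgEquiv.refl ℝ ℂ := by
      rw [UpperHalfPlane.σ, if_pos]
      rw [Matrix.GeneralLinearGroup.val_det_apply, hdet]; exact one_pos
    rw [slash_def]
    simp [invol, hdet, hσ]

/-- The `h`-th power of the Hauptmodul is invariant under `Γ₀(p M) + M`. -/
theorem alInvariant_of_hauptmodul (hI : AdmissibleIndex p M h) {T : ℍ → ℂ}
    (hT : IsNormalizedHauptmodul (fixingGroup (p * M * h) h S) T) :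
    ALInvariant p M (fFun p M 1 (h * r)) := by
  obtain ⟨c, hc⟩ := A.hauptmodul_eq hI hT
  have hinv : ∀ k ∈ fixingGroup (p * M * h) h S, ∀ τ, fFun p M h r (k • τ) = fFun p M h r τ := by
    intro k hk τ
    have := hT.modular.invariant k hk τ
    rw [hc, hc] at this
    exact add_right_cancel this
  intro e x y z w H hd τ
  have hd' := scaled_det_pos A.h_pos' hd
  obtain ⟨k, hk⟩ := A.invariant_infty hI hinv H hd'
  -- Writing τ = hσ expresses t(τ) as f(σ)^h; translations of σ by k/h become translations of τ by
  -- k, under which t is periodic.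
  have hs : scale h A.h_pos' (affine 0 h A.h_pos' τ) = τ := by
    ext
    rw [coe_scale, coe_affine]
    have : (h : ℂ) ≠ 0 := by exact_mod_cast A.h_ne
    push_cast
    field_simp
    simp
  rw [← hs]
  set σ := affine 0 h A.h_pos' τ
  rw [← scale_glMat_smul A.h_pos' hd' hd, ← fFun_pow r A.h_pos', hk, fFun_pow r A.h_pos']
  have : scale h A.h_pos' (affine (k / h) 1 one_pos σ) =
      affine k 1 one_pos (scale h A.h_pos' σ) := by
    apply UpperHalfPlane.ext
    simp only [coe_scale, coe_affine]
    have : (h : ℂ) ≠ 0 := by exact_mod_cast A.h_ne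
    push_cast
    field_simp
  rw [this]
  have hq : ∀ τ : ℍ, qq (affine k 1 one_pos τ) = qq τ := by
    intro τ
    rw [qq, qq, coe_affine, Complex.exp_eq_exp_iff_exists_int]
    exact ⟨k, by push_cast; ring⟩
  rw [fFun, fFun, hq]

end GroupParams

/-! ### The functions f((τ + k)/p) and the operator U_p. -/

/-- `τ ↦ f((τ + k) / p)` for a residue class `k` modulo `p`. -/
def twist (p : ℕ) [Fact p.Prime] (f : ℍ → ℂ) (k : ZMod p) (τ : ℍ) : ℂ :=
  f (affine k.val p (by exact_mod_cast (Fact.out : p.Prime).pos) τ)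

section twist

variable {p M : ℕ} [Fact p.Prime] (A : Admissible p M) {f : ℍ → ℂ}

lemma natCast_prime_pos (p : ℕ) [Fact p.Prime] : (0 : ℝ) < p := by
  exact_mod_cast (Fact.out : p.Prime).pos

include A in
lemma AtkinLehner.isUnit_mod {e : ℕ} {x y z w : ℤ} (H : AtkinLehner p M e x y z w) :
    (x : ZMod p) * w ≠ 0 ∧ (z : ZMod p) = 0 := by
  have hz : (z : ZMod p) = 0 := by
    rw [ZMod.intCast_zmod_eq_zero_iff_dvd]
    exact (Dvd.intro _ rfl).trans H.dvd_z
  refine ⟨?_, hz⟩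
  have h1 := congrArg (Int.cast : ℤ → ZMod p) H.det
  push_cast at h1
  rw [hz, mul_zero, sub_zero] at h1
  rw [h1]
  rcases H.e_eq with rfl | rfl
  · simp
  · intro h0
    rw [ZMod.natCast_eq_zero_iff] at h0
    exact (Nat.Prime.coprime_iff_not_dvd A.hp).1 A.coprime h0

include A in
/-- Atkin-Lehner matrices permute the twists of an invariant function. -/
lemma exists_perm_twist (hf : ALInvariant p M f) {e : ℕ} {x y z w : ℤ}
    (H : AtkinLehner p M e x y z w) (hd : 0 < (x : ℝ) * w - y * z) :
    ∃ σ : Equiv.Perm (ZMod p), ∀ k τ, twist p f k (glMat x y z w hd • τ) = twist p f (σ k) τ := by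
  obtain ⟨hxw, hz⟩ := H.isUnit_mod A
  have hx : (x : ZMod p) ≠ 0 := left_ne_zero_of_mul hxw
  have hw : (w : ZMod p) ≠ 0 := right_ne_zero_of_mul hxw
  have hinj : Function.Injective fun k : ZMod p => (x : ZMod p)⁻¹ * (y + k * w) := by
    intro k k' hk
    have := mul_left_cancel₀ (inv_ne_zero hx) hk
    exact mul_right_cancel₀ hw (add_left_cancel this)
  refine ⟨Equiv.ofBijective _ (Finite.injective_iff_bijective.1 hinj), fun k τ => ?_⟩
  rw [Equiv.ofBijective_apply]
  -- The class k' is the one for which (1, k; 0, p)·W = W'·(1, k'; 0, p) with W' an integral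
  -- Atkin-Lehner matrix of the same type as W.
  set k' : ZMod p := (x : ZMod p)⁻¹ * (y + k * w) with hk'
  have hdvd : (p : ℤ) ∣ y + k.val * w - k'.val * (x + k.val * z) := by
    rw [← ZMod.intCast_zmod_eq_zero_iff_dvd]
    push_cast
    rw [ZMod.natCast_zmod_val, ZMod.natCast_zmod_val, hz, mul_zero, add_zero, hk']
    field_simp
    ring
  obtain ⟨B, hB⟩ := hdvd
  have H' : AtkinLehner p M e (x + k.val * z) B (p * z) (w - k'.val * z) := by
    have hez : (e : ℤ) ∣ z := by
      refine dvd_trans ?_ H.dvd_z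
      rcases H.e_eq with rfl | rfl
      · simp
      · exact Dvd.intro_left _ rfl
    refine ⟨H.e_eq, ?_, dvd_add H.dvd_x (hez.mul_left _), dvd_sub H.dvd_w (hez.mul_left _),
      H.dvd_z.mul_left _⟩
    linear_combination H.det + z * hB
  have hd' := H'.det_pos A.M_pos
  rw [twist, twist, ← hf _ _ _ _ _ H' hd' (affine k'.val p _ τ)]
  congr 1
  rw [affine, affine, glMat_smul_glMat_smul, glMat_smul_glMat_smul]
  have hB' : (y : ℝ) + k.val * w - k'.val * (x + k.val * z) = p * B := by exact_mod_cast hB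
  refine glMat_smul_eq _ _ 1 one_ne_zero ?_ ?_ ?_ ?_ τ <;> push_cast
  · ring
  · linear_combination hB'
  · ring
  · ring

include A in
lemma ALInvariant.sum_twist (hf : ALInvariant p M f) :
    ALInvariant p M fun τ => ∑ k, twist p f k τ := by
  intro e x y z w H hd τ
  obtain ⟨σ, hσ⟩ := exists_perm_twist A hf H hd
  simp only [hσ]
  exact Equiv.sum_comp σ fun k => twist p f k τ

include A in
lemma ALInvariant.prod_twist (hf : ALInvariant p M f) :
    ALInvariant p M fun τ => ∏ k, twist p f k τ := by
  intro e x y z w H hd τ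
  obtain ⟨σ, hσ⟩ := exists_perm_twist A hf H hd
  simp only [hσ]
  exact Equiv.prod_comp σ fun k => twist p f k τ

lemma Holo.twist (hf : Holo f) (k : ZMod p) : Holo (twist p f k) :=
  hf.comp_smul _

lemma twist_zero_invol (τ : ℍ) :
    twist p f 0 (invol τ) = f (invol (scale p (natCast_prime_pos p) τ)) := by
  rw [twist]
  congr 1
  rw [affine, invol, invol, scale, glMat_smul_glMat_smul, glMat_smul_glMat_smul]
  refine glMat_smul_eq _ _ 1 one_ne_zero ?_ ?_ ?_ ?_ τ <;> simp

include A in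
-- For k ≠ 0 the map τ ↦ (-1/τ + k)/p sends i∞ to the cusp k/p, which W_M carries to ∞. Only the
-- class k = 0 stays at the cusp 0.
lemma exists_twist_invol (hf : ALInvariant p M f) {k : ZMod p} (hk : k ≠ 0) :
    ∃ d : ℤ, ∀ τ, twist p f k (invol τ) = f (affine (d * M) (p * M)
      (mul_pos (natCast_prime_pos p) (by exact_mod_cast A.M_pos)) τ) := by
  have hkp : IsCoprime (p : ℤ) k.val := by
    apply A.p_coprime_of_not_dvd
    rw [← ZMod.intCast_zmod_eq_zero_iff_dvd]
    push_cast
    rwa [ZMod.natCast_zmod_val]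
  obtain ⟨u, v, huv⟩ : IsCoprime (p : ℤ) (M * k.val) := A.isCoprime.mul_right hkp
  have H : AtkinLehner p M M (M * k.val) (-u) (M * p) (M * v) :=
    ⟨Or.inr rfl, by linear_combination M * huv, by simp, by simp, by rw [mul_comm]⟩
  have hd := H.det_pos A.M_pos
  have hM : (0 : ℝ) < M := by exact_mod_cast A.M_pos
  refine ⟨-v, fun τ => ?_⟩
  rw [← hf _ _ _ _ _ H hd (affine _ (p * M) _ τ), twist]
  congr 1
  have huv' : (u : ℝ) * p + v * (M * k.val) = 1 := by exact_mod_cast huv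
  rw [affine, affine, invol, glMat_smul_glMat_smul, glMat_smul_glMat_smul]
  symm
  refine glMat_smul_eq _ _ M hM.ne' ?_ ?_ ?_ ?_ τ <;> push_cast
  · ring
  · linear_combination (-M : ℝ) * huv'
  · ring
  · ring

end twist

lemma qq_affine (k : ℝ) {w : ℝ} (hw : 0 < w) (τ : ℍ) :
    qq (affine k w hw τ) = qq (affine 0 w hw τ) * Complex.exp (2 * π * Complex.I * k / w) := by
  rw [qq, qq, coe_affine, coe_affine, ← Complex.exp_add]
  congr 1
  push_cast
  ring

lemma qq_affine_zero_pow {p : ℕ} (hp : (0 : ℝ) < p) (τ : ℍ) : qq (affine 0 p hp τ) ^ p = qq τ := by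
  rw [← qq_scale p hp]
  congr 1
  apply UpperHalfPlane.ext
  rw [coe_scale, coe_affine]
  have : (p : ℂ) ≠ 0 := by
    have := hp.ne'
    exact_mod_cast this
  push_cast
  field_simp
  simp

section sums

variable {p : ℕ} [Fact p.Prime]

/-- `exp(2πi/p)`. -/
def zetaP (p : ℕ) : ℂ := Complex.exp (2 * π * Complex.I / p)

lemma isPrimitiveRoot_zetaP (p : ℕ) [Fact p.Prime] : IsPrimitiveRoot (zetaP p) p :=
  Complex.isPrimitiveRoot_exp p (Fact.out : p.Prime).ne_zero

lemma qq_twist (k : ZMod p) (τ : ℍ) : qq (affine k.val p (natCast_prime_pos p) τ) =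
    qq (affine 0 p (natCast_prime_pos p) τ) * zetaP p ^ k.val := by
  rw [qq_affine, zetaP, ← Complex.exp_nat_mul]
  congr 2
  push_cast
  ring

lemma sum_zetaP_pow (n : ℕ) :
    ∑ k : ZMod p, (zetaP p ^ k.val) ^ n = if p ∣ n then (p : ℂ) else 0 := by
  have hprim := isPrimitiveRoot_zetaP p
  obtain ⟨p', rfl⟩ : ∃ p', p = p' + 1 := ⟨p - 1, by have := (Fact.out : p.Prime).pos; omega⟩
  have h1 : ∑ k : ZMod (p' + 1), (zetaP (p' + 1) ^ k.val) ^ n =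
      ∑ i ∈ Finset.range (p' + 1), (zetaP (p' + 1) ^ n) ^ i := by
    rw [Finset.sum_range]
    refine Finset.sum_congr rfl fun k _ => ?_
    rw [← pow_mul, ← pow_mul, mul_comm]
    rfl
  rw [h1]
  split_ifs with h
  · rw [(hprim.pow_eq_one_iff_dvd n).2 h]
    simp
  · have hne : zetaP (p' + 1) ^ n ≠ 1 := fun h' => h ((hprim.pow_eq_one_iff_dvd n).1 h')
    rw [geom_sum_eq hne, ← pow_mul, mul_comm, pow_mul, hprim.pow_eq_one, one_pow, sub_self,
      zero_div]

/-- Summing a power series in `q` over all `τ ↦ (τ + k) / p` extracts every `p`-th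
coefficient. -/
lemma HasVal.sum_twist {G : ℂ⟦X⟧} {v : ℂ → ℂ} (hG : HasVal G v) :
    ∀ τ : ℍ, HasSum (fun j : ℕ => p * PowerSeries.coeff (p * j) G * qq τ ^ j)
      (∑ k, twist p (fun τ => v (qq τ)) k τ) := by
  intro τ
  have hp0 := (Fact.out : p.Prime).pos
  have h1 : HasSum (fun n : ℕ => ∑ k : ZMod p, PowerSeries.coeff n G *
      qq (affine k.val p (natCast_prime_pos p) τ) ^ n) (∑ k, twist p (fun τ => v (qq τ)) k τ) :=
    hasSum_sum fun k _ => hG _ (norm_qq_lt_one _)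
  set u := qq (affine 0 p (natCast_prime_pos p) τ) with hu
  have hinj : Function.Injective (fun n : ℕ => p * n) :=
    fun a b h => Nat.eq_of_mul_eq_mul_left hp0 h
  have h2 : ∀ n : ℕ, ∑ k : ZMod p, PowerSeries.coeff n G *
      qq (affine k.val p (natCast_prime_pos p) τ) ^ n =
      PowerSeries.coeff n G * u ^ n * if p ∣ n then (p : ℂ) else 0 := by
    intro n
    rw [← sum_zetaP_pow, Finset.mul_sum]
    refine Finset.sum_congr rfl fun k _ => ?_
    rw [qq_twist, mul_pow, mul_assoc]
  simp only [h2] at h1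
  rw [← hinj.hasSum_iff] at h1
  · refine h1.congr_fun fun j => ?_
    simp only [Function.comp, dvd_mul_right, if_true]
    rw [pow_mul, hu, qq_affine_zero_pow]
    ring
  · intro n hn
    rw [if_neg, mul_zero]
    rintro ⟨j, rfl⟩
    exact hn ⟨j, rfl⟩

/-- The polar term q⁻¹ is killed by U_p because p does not divide -1. The exponent -1 is represented
by p - 1 modulo p. -/
lemma sum_twist_inv_qq (τ : ℍ) : ∑ k : ZMod p, twist p (fun τ => (qq τ)⁻¹) k τ = 0 := by
  have hp1 := (Fact.out : p.Prime).one_lt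
  have h1 : ∀ k : ZMod p, twist p (fun τ => (qq τ)⁻¹) k τ =
      (qq (affine 0 p (natCast_prime_pos p) τ))⁻¹ * (zetaP p ^ k.val) ^ (p - 1) := by
    intro k
    rw [twist, qq_twist, mul_inv]
    congr 1
    refine inv_eq_of_mul_eq_one_right ?_
    rw [← pow_succ', Nat.sub_add_cancel hp1.le, ← pow_mul, mul_comm, pow_mul,
      (isPrimitiveRoot_zetaP p).pow_eq_one, one_pow]
  simp only [h1]
  rw [← Finset.mul_sum, sum_zetaP_pow, if_neg, mul_zero]
  intro h
  have := Nat.le_of_dvd (by omega) h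
  omega

end sums

/-! ### The function s = 1/t and orders of the twists at the cusp 0. -/

/-- The power series of `s = 1 / t`, where `t = fFun p M 1 R`. -/
def sSeries (p M R : ℕ) (hp : p ≠ 0) (hM : M ≠ 0) : ℤ⟦X⟧ :=
  PowerSeries.X * invSeries (fSeries p M 1 R hp hM one_ne_zero)

/-- The function `s` in terms of `q`. -/
def sVal (p M R : ℕ) (q : ℂ) : ℂ :=
  q * ((etaNum M (q ^ 1) / etaNum M ((q ^ 1) ^ p)) ^ R)⁻¹

lemma hasVal_sSeries (p M R : ℕ) (hp : p ≠ 0) (hM : M ≠ 0) :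
    HasVal (toC (sSeries p M R hp hM)) (sVal p M R) := by
  rw [sSeries, map_mul, PowerSeries.map_X]
  refine HasVal.X.mul (hasVal_invSeries (constantCoeff_fSeries _ _ _ _ _ _ _)
    (hasVal_fSeries p M 1 R hp hM one_ne_zero) fun q hq => pow_ne_zero _ ?_)
  exact etaQuot_ne_zero hp hM one_ne_zero hq

lemma sVal_qq (p M R : ℕ) (τ : ℍ) : sVal p M R (qq τ) = (fFun p M 1 R τ)⁻¹ := by
  rw [sVal, fFun, mul_inv, inv_inv]

/-- The operator `U_p` on power series. -/
def uSeries (p : ℕ) (F : ℤ⟦X⟧) : ℤ⟦X⟧ := PowerSeries.mk fun n => PowerSeries.coeff (p * n) F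

lemma sum_twist_hasVal {p : ℕ} [Fact p.Prime] {F : ℤ⟦X⟧} {v : ℂ → ℂ} (hF : HasVal (toC F) v) :
    ∃ w, HasVal (toC ((p : ℤ⟦X⟧) * uSeries p F)) w ∧
      ∀ τ, w (qq τ) = ∑ k, twist p (fun τ => v (qq τ)) k τ := by
  refine exists_hasVal_of_hasSum fun τ => (hF.sum_twist τ).congr_fun fun n => ?_
  rw [← nsmul_eq_mul, map_nsmul, map_nsmul, PowerSeries.coeff_map, PowerSeries.coeff_map, uSeries,
    PowerSeries.coeff_mk, nsmul_eq_mul]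

lemma HasVal.zpow_X_mul_isBigO {F : ℂ⟦X⟧} {v : ℂ → ℂ} {n : ℕ} (hF : HasVal F v)
    (hn : PowerSeries.X ^ n ∣ F) : ∃ G w, HasVal G w ∧ ∀ q, ‖q‖ < 1 → v q = q ^ n * w q := by
  obtain ⟨G, rfl⟩ := hn
  have h1 : ∀ τ, HasSum (fun n : ℕ => PowerSeries.coeff n G * qq τ ^ n)
      (v (qq τ) * (qq τ ^ n)⁻¹) := by
    intro τ
    have h0 := qq_ne_zero τ
    have h2 := (hF (qq τ) (norm_qq_lt_one τ)).mul_right (qq τ ^ n)⁻¹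
    have hinj : Function.Injective (fun i : ℕ => i + n) := add_left_injective n
    rw [← hinj.hasSum_iff] at h2
    · refine h2.congr_fun fun i => ?_
      simp only [Function.comp, PowerSeries.coeff_X_pow_mul', Nat.le_add_left, if_true,
        Nat.add_sub_cancel, pow_add]
      field_simp
    · intro i hi
      rw [PowerSeries.coeff_X_pow_mul', if_neg, zero_mul, zero_mul]
      intro hle
      exact hi ⟨i - n, Nat.sub_add_cancel hle⟩
  obtain ⟨w, hw, _⟩ := exists_hasVal_of_hasSum h1
  refine ⟨G, w, hw, fun q hq => (hF q hq).unique ?_⟩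
  have hX : HasVal (PowerSeries.X ^ n) (fun q : ℂ => q ^ n) := HasVal.X.pow n
  exact hX.mul hw q hq

namespace Params

variable {p M R : ℕ} (A : Params p M 1 R)
include A

lemma tendsto_t_invol : Tendsto (fun τ => fFun p M 1 R (invol τ)) atImInfty (𝓝 0) := by
  refine A.theta_f_invol.1.trans_tendsto ?_
  have := tendsto_im_atImInfty_iff.1 (tendsto_id (α := ℍ) (x := atImInfty))
  exact Real.tendsto_exp_neg_atTop_nhds_zero.comp
    ((this.atTop_div_const A.level_pos).const_mul_atTop (by positivity))

lemma bounded_t_invol : IsBoundedAtImInfty fun τ => fFun p M 1 R (invol τ) :=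
  A.tendsto_t_invol.isBigO_one ℝ

/-- A modular function for `Γ₀(p M) + M` without poles on `ℍ` vanishes if the order of its zero
at `∞` exceeds the order of its pole at `0`. -/
lemma eq_zero_of_X_pow_dvd (ht : ALInvariant p M (fFun p M 1 R)) {f : ℍ → ℂ} {F : ℂ⟦X⟧} {v : ℂ → ℂ}
    (hF : HasVal F v) (hf : ∀ τ, f τ = v (qq τ)) (inv : ALInvariant p M f) {m : ℕ}
    (hm : PowerSeries.X ^ (m + 1) ∣ F)
    (hzero : IsBoundedAtImInfty fun τ => f (invol τ) * fFun p M 1 R (invol τ) ^ m) (τ : ℍ) :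
    f τ = 0 := by
  have hol : Holo f := by
    have : f = fun τ => v (qq τ) := funext hf
    rw [this]; exact hF.holo
  obtain ⟨G, w, hw, hvw⟩ := hF.zpow_X_mul_isBigO hm
  have hlim : Tendsto (fun τ => f τ * fFun p M 1 R τ ^ m) atImInfty (𝓝 0) := by
    have h1 := ((hw.tendsto.comp tendsto_qq).mul tendsto_qq).mul
      ((tendsto_fFun_mul_qq R A.p_ne A.M_ne A.h_ne).pow m)
    rw [mul_zero, zero_mul] at h1
    refine h1.congr fun τ => ?_
    rw [hf, hvw _ (norm_qq_lt_one τ)]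
    simp only [Function.comp]
    ring
  obtain ⟨c, hc⟩ := const_of_ALInvariant A.toAdmissible (f := fun τ => f τ * fFun p M 1 R τ ^ m)
    (hol.mul (A.holo_f.pow m))
    (fun e x y z w H h τ => by simp only [inv _ _ _ _ _ H h, ht _ _ _ _ _ H h])
    (hlim.isBigO_one ℝ) hzero
  have hc0 : c = 0 := by
    simp only [hc] at hlim
    exact tendsto_nhds_unique tendsto_const_nhds hlim
  have := hc τ
  rw [hc0] at this
  exact (mul_eq_zero.1 this).resolve_right (pow_ne_zero _ (A.fFun_ne τ))

lemma theta_t_invol : (fun τ => fFun p M 1 R (invol τ))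
    =Θ[atImInfty] fun τ => Real.exp (-(2 * π * (τ.im / (p * M)))) := by
  have := A.theta_f_invol
  simpa using this

/-- In the local parameter exp(2πiτ/(pM)), in which t has a simple zero at 0, the class k = 0 has a
zero of order p. -/
lemma theta_twist_zero [Fact p.Prime] : (fun τ => twist p (fFun p M 1 R) 0 (invol τ))
    =Θ[atImInfty] fun τ => Real.exp (-(2 * π * (τ.im / (p * M)))) ^ p := by
  simp only [twist_zero_invol]
  have h1 := A.theta_t_invol.1.comp_tendsto (tendsto_scale p (natCast_prime_pos p))
  have h2 := A.theta_t_invol.2.comp_tendsto (tendsto_scale p (natCast_prime_pos p))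
  simp only [Function.comp_def, im_scale] at h1 h2
  have he : ∀ τ : ℍ, Real.exp (-(2 * π * (p * τ.im / (p * M)))) =
      Real.exp (-(2 * π * (τ.im / (p * M)))) ^ p := by
    intro τ
    rw [← Real.exp_nat_mul]
    congr 1
    ring
  simp only [he] at h1 h2
  exact ⟨h1, h2⟩

/-- The classes k ≠ 0 each have a simple pole at 0, inherited from the pole of t at ∞. -/
lemma theta_twist [Fact p.Prime] (ht : ALInvariant p M (fFun p M 1 R)) {k : ZMod p} (hk : k ≠ 0) :
    (fun τ => twist p (fFun p M 1 R) k (invol τ))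
      =Θ[atImInfty] fun τ => (Real.exp (-(2 * π * (τ.im / (p * M)))))⁻¹ := by
  obtain ⟨d, hd⟩ := exists_twist_invol A.toAdmissible ht hk
  simp only [hd, ← Real.exp_neg, neg_neg]
  exact A.theta_f_affine _ _ _

/-- The reciprocals of the twists have a pole of order at most p at 0, which bounds by p the degree
in s of their sum. -/
lemma bounded_twist_inv [Fact p.Prime] (ht : ALInvariant p M (fFun p M 1 R)) (k : ZMod p) :
    IsBoundedAtImInfty fun τ => (twist p (fFun p M 1 R) k (invol τ))⁻¹ *
      fFun p M 1 R (invol τ) ^ p := by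
  have hpos : ∀ τ : ℍ, Real.exp (-(2 * π * (τ.im / (p * M)))) ≠ 0 := fun τ => (Real.exp_pos _).ne'
  rcases eq_or_ne k 0 with rfl | hk
  · have h1 := A.theta_twist_zero.inv.1.mul (A.theta_t_invol.1.pow p)
    refine h1.congr_right fun τ => ?_
    exact inv_mul_cancel₀ (pow_ne_zero _ (hpos τ))
  · have h1 := (A.theta_twist ht hk).inv.1.mul (A.bounded_t_invol.pow p)
    refine h1.trans ?_
    have h2 : Tendsto (fun τ : ℍ => Real.exp (-(2 * π * (τ.im / (p * M))))) atImInfty (𝓝 0) := by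
      have := tendsto_im_atImInfty_iff.1 (tendsto_id (α := ℍ) (x := atImInfty))
      have hl := A.level_pos
      push_cast at hl
      rw [mul_one] at hl
      exact Real.tendsto_exp_neg_atTop_nhds_zero.comp
        ((this.atTop_div_const hl).const_mul_atTop (by positivity))
    refine (h2.isBigO_one ℝ).congr_left fun τ => ?_
    simp

/-- The twists themselves have at most a simple pole at 0, so their sum is at most linear in s. -/
lemma bounded_twist [Fact p.Prime] (ht : ALInvariant p M (fFun p M 1 R)) (k : ZMod p) :
    IsBoundedAtImInfty fun τ => twist p (fFun p M 1 R) k (invol τ) * fFun p M 1 R (invol τ) := by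
  have hpos : ∀ τ : ℍ, Real.exp (-(2 * π * (τ.im / (p * M)))) ≠ 0 := fun τ => (Real.exp_pos _).ne'
  rcases eq_or_ne k 0 with rfl | hk
  · have h1 : IsBoundedAtImInfty fun τ => twist p (fFun p M 1 R) 0 (invol τ) := by
      simp only [twist_zero_invol]
      exact A.bounded_t_invol.comp_tendsto (tendsto_scale p (natCast_prime_pos p))
    exact (h1.mul A.bounded_t_invol).congr_right fun τ => by simp
  · have h1 := (A.theta_twist ht hk).1.mul A.theta_t_invol.1
    refine h1.congr_right fun τ => ?_
    exact inv_mul_cancel₀ (hpos τ)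

/-- The product of the twists has the same divisor as t, so the two are proportional. The factor
comes from comparing leading terms at ∞. -/
lemma prod_twist [Fact p.Prime] (ht : ALInvariant p M (fFun p M 1 R)) (τ : ℍ) :
    ∏ k, twist p (fFun p M 1 R) k τ = (∏ k : ZMod p, zetaP p ^ k.val)⁻¹ * fFun p M 1 R τ := by
  have hpos : ∀ τ : ℍ, Real.exp (-(2 * π * (τ.im / (p * M)))) ≠ 0 := fun τ => (Real.exp_pos _).ne'
  have hz : ∏ k : ZMod p, zetaP p ^ k.val ≠ 0 :=
    Finset.prod_ne_zero_iff.2 fun k _ => pow_ne_zero _ (Complex.exp_ne_zero _)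
  have hq : ∀ τ : ℍ, ∏ k : ZMod p, qq (affine k.val p (natCast_prime_pos p) τ) =
      qq τ * ∏ k : ZMod p, zetaP p ^ k.val := by
    intro τ
    simp only [qq_twist]
    rw [Finset.prod_mul_distrib, Finset.prod_const, Finset.card_univ, ZMod.card, qq_affine_zero_pow]
  have lim : Tendsto (fun τ => (∏ k, twist p (fFun p M 1 R) k τ) * (fFun p M 1 R τ)⁻¹) atImInfty
      (𝓝 (∏ k : ZMod p, zetaP p ^ k.val)⁻¹) := by
    have h1 := tendsto_fFun_mul_qq R A.p_ne A.M_ne A.h_ne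
    have h2 : Tendsto (fun τ => ∏ k : ZMod p, (twist p (fFun p M 1 R) k τ *
        qq (affine k.val p (natCast_prime_pos p) τ))) atImInfty (𝓝 (∏ k : ZMod p, 1)) :=
      tendsto_finsetProd _ fun k _ => h1.comp (tendsto_affine _ _ _)
    have h3 := (h2.div h1 one_ne_zero).mul_const (∏ k : ZMod p, zetaP p ^ k.val)⁻¹
    rw [Finset.prod_const_one, div_one, one_mul] at h3
    refine h3.congr fun τ => ?_
    simp only [Pi.div_apply]
    rw [Finset.prod_mul_distrib, hq]
    have := qq_ne_zero τ
    have := A.fFun_ne τ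
    field_simp
  obtain ⟨c, hc⟩ := const_of_ALInvariant A.toAdmissible
    (f := fun τ => (∏ k, twist p (fFun p M 1 R) k τ) * (fFun p M 1 R τ)⁻¹)
    ((Holo.prod fun k _ => A.holo_f.twist k).mul (A.holo_f.inv A.fFun_ne))
    (fun e x y z w H h τ => by
      simp only [ALInvariant.prod_twist A.toAdmissible ht _ _ _ _ _ H h, ht _ _ _ _ _ H h])
    (lim.isBigO_one ℝ) (by
      -- Order at the cusp 0: p from the class k = 0, minus p - 1 from the others, minus 1 from
      -- division by t, which makes 0.
      have h0 : ∀ k ∈ (Finset.univ.erase (0 : ZMod p)),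
          (fun τ => twist p (fFun p M 1 R) k (invol τ))
          =O[atImInfty] fun τ => (Real.exp (-(2 * π * (τ.im / (p * M)))))⁻¹ := fun k hk =>
        (A.theta_twist ht (Finset.ne_of_mem_erase hk)).1
      have h1 := (A.theta_twist_zero.1.mul (IsBigO.finsetProd h0)).mul A.theta_t_invol.inv.1
      refine (h1.congr_left fun τ => ?_).congr_right fun τ => ?_
      · rw [Finset.mul_prod_erase _ (fun k => twist p (fFun p M 1 R) k (invol τ))
          (Finset.mem_univ _)]
      · rw [Finset.prod_const, Finset.card_erase_of_mem (Finset.mem_univ _), Finset.card_univ,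
          ZMod.card, mul_assoc, ← pow_succ, Nat.sub_add_cancel (Fact.out : p.Prime).one_lt.le,
          inv_pow, mul_inv_cancel₀ (pow_ne_zero _ (hpos τ))]
        rfl)
  have hc' : c = (∏ k : ZMod p, zetaP p ^ k.val)⁻¹ := by
    simp only [hc] at lim
    exact tendsto_nhds_unique tendsto_const_nhds lim
  have h1 := hc τ
  rw [hc', mul_inv_eq_iff_eq_mul₀ (A.fFun_ne τ)] at h1
  exact h1

end Params

/-! ### Truncated power series -/

/-- `l` lists the first coefficients of `F`. -/
def HasCoeffs (F : ℤ⟦X⟧) (l : List ℤ) : Prop :=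
  ∀ n < l.length, PowerSeries.coeff n F = l.getD n 0

/-- Truncated multiplication. -/
def mulList (a b : List ℤ) : List ℤ :=
  (List.range a.length).map fun n =>
    ((List.range (n + 1)).map fun i => a.getD i 0 * b.getD (n - i) 0).sum

/-- Truncated substitution of `X ^ k`. -/
def expandList (k : ℕ) (a : List ℤ) : List ℤ :=
  (List.range a.length).map fun n => if k ∣ n then a.getD (n / k) 0 else 0

/-- The truncation of `1`. -/
def oneList (N : ℕ) : List ℤ := (List.range N).map fun n => if n = 0 then 1 else 0

/-- Truncated powers. -/
def powList (a : List ℤ) : ℕ → List ℤ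
  | 0 => oneList a.length
  | r + 1 => mulList (powList a r) a

lemma getD_map_range {N n : ℕ} (hn : n < N) (f : ℕ → ℤ) :
    ((List.range N).map f).getD n 0 = f n := by
  rw [List.getD_eq_getElem _ _ (by simpa using hn)]
  simp

lemma length_mulList (a b : List ℤ) : (mulList a b).length = a.length := by simp [mulList]

lemma length_expandList (k : ℕ) (a : List ℤ) : (expandList k a).length = a.length := by
  simp [expandList]

lemma length_powList (a : List ℤ) (r : ℕ) : (powList a r).length = a.length := by
  induction r with
  | zero => simp [powList, oneList]
  | succ r ih => rw [powList, length_mulList, ih]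

namespace HasCoeffs

variable {F G : ℤ⟦X⟧} {a b : List ℤ}

lemma mul (hF : HasCoeffs F a) (hG : HasCoeffs G b) (hab : a.length = b.length) :
    HasCoeffs (F * G) (mulList a b) := by
  intro n hn
  rw [length_mulList] at hn
  rw [mulList, getD_map_range hn, PowerSeries.coeff_mul,
    Finset.Nat.sum_antidiagonal_eq_sum_range_succ_mk]
  have h1 : ∑ i ∈ Finset.range (n + 1), a.getD i 0 * b.getD (n - i) 0 =
    ((List.range (n + 1)).map fun i => a.getD i 0 * b.getD (n - i) 0).sum := rfl
  rw [← h1]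
  refine Finset.sum_congr rfl fun i hi => ?_
  have hi' := Finset.mem_range.1 hi
  rw [hF i (by omega), hG (n - i) (by omega)]

lemma expand (hF : HasCoeffs F a) {k : ℕ} (hk : k ≠ 0) :
    HasCoeffs (PowerSeries.expand k hk F) (expandList k a) := by
  intro n hn
  rw [length_expandList] at hn
  rw [expandList, getD_map_range hn]
  split_ifs with h
  · obtain ⟨m, rfl⟩ := h
    rw [PowerSeries.coeff_expand_mul, Nat.mul_div_cancel_left _ (Nat.pos_of_ne_zero hk)]
    exact hF _ (lt_of_le_of_lt (Nat.le_mul_of_pos_left m (Nat.pos_of_ne_zero hk)) hn)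
  · exact PowerSeries.coeff_expand_of_not_dvd _ _ _ h

lemma pow (hF : HasCoeffs F a) (r : ℕ) : HasCoeffs (F ^ r) (powList a r) := by
  induction r with
  | zero =>
    intro n hn
    rw [powList, oneList] at *
    rw [getD_map_range (by simpa using hn), pow_zero, PowerSeries.coeff_one]
  | succ r ih =>
    rw [pow_succ, powList]
    exact ih.mul hF (length_powList a r)

/-- Coefficients of a quotient are verified by multiplication: a candidate agreeing with F after
multiplication by the unit G agrees with F to that order. -/
lemma of_mul (hG : HasCoeffs G b) (hG0 : PowerSeries.constantCoeff G = 1) {c : List ℤ}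
    (hH : HasCoeffs (F * G) (mulList c b)) (hcb : c.length = b.length) : HasCoeffs F c := by
  set P : ℤ⟦X⟧ := PowerSeries.mk fun n => c.getD n 0
  have hP : HasCoeffs P c := fun n _ => PowerSeries.coeff_mk _ _
  have hPG := hP.mul hG hcb
  have h1 : PowerSeries.X ^ c.length ∣ (F - P) * G := by
    rw [PowerSeries.X_pow_dvd_iff]
    intro m hm
    rw [← length_mulList c b] at hm
    rw [sub_mul, map_sub, hH m hm, hPG m hm, sub_self]
  have h2 : PowerSeries.X ^ c.length ∣ F - P := by
    have := h1.mul_right (invSeries G)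
    rwa [mul_assoc, mul_invSeries hG0, mul_one] at this
  intro n hn
  have := PowerSeries.X_pow_dvd_iff.1 h2 n hn
  rw [map_sub, sub_eq_zero] at this
  rw [this, hP n hn]

end HasCoeffs

lemma hasCoeffs_pentagonal :
    HasCoeffs (PowerSeries.pentagonalSeries ℤ) [1, -1, -1, 0, 0, 1, 0, 1, 0, 0] := by
  -- Below 10 the pentagonal numbers are 0, 1, 2, 5, 7, attained for -2 ≤ k ≤ 2.
  have h0 : ∀ k : ℤ, pentagonal k < 10 → -3 < k ∧ k < 3 := by
    intro k hk
    have := two_mul_natCast_pentagonal k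
    have h2 : k * (3 * k - 1) < 20 := by rw [← this]; omega
    constructor <;> nlinarith
  have hz : ∀ n < 10, n ∉ [0, 1, 2, 5, 7] →
      PowerSeries.coeff n (PowerSeries.pentagonalSeries ℤ) = 0 := by
    intro n hn hn'
    apply PowerSeries.coeff_pentagonalSeries_eq_zero
    rintro ⟨k, rfl⟩
    obtain ⟨h1, h2⟩ := h0 k hn
    interval_cases k <;> exact hn' (by decide)
  have hv : ∀ k : ℤ, PowerSeries.coeff (pentagonal k) (PowerSeries.pentagonalSeries ℤ) =
      Int.negOnePow k := PowerSeries.coeff_pentagonalSeries_pentagonal ℤ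
  intro n hn
  have hn' : n < 10 := hn
  interval_cases n
  · simpa [pentagonal_def] using hv 0
  · simpa [pentagonal_def] using hv 1
  · simpa [pentagonal_def] using hv (-1)
  · exact hz 3 (by norm_num) (by decide)
  · exact hz 4 (by norm_num) (by decide)
  · exact hv 2
  · exact hz 6 (by norm_num) (by decide)
  · exact hv (-2)
  · exact hz 8 (by norm_num) (by decide)
  · exact hz 9 (by norm_num) (by decide)

/-- The first coefficients of `∏ (1 - q^n) (1 - q^(M n))`. -/
def etaNumList (M : ℕ) : List ℤ :=
  mulList [1, -1, -1, 0, 0, 1, 0, 1, 0, 0] (expandList M [1, -1, -1, 0, 0, 1, 0, 1, 0, 0])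

lemma hasCoeffs_etaNumSeries {M : ℕ} (hM : M ≠ 0) :
    HasCoeffs (etaNumSeries M hM) (etaNumList M) :=
  hasCoeffs_pentagonal.mul (hasCoeffs_pentagonal.expand hM) rfl

lemma fSeries_mul {p M R : ℕ} (hp : p ≠ 0) (hM : M ≠ 0) :
    fSeries p M 1 R hp hM one_ne_zero * PowerSeries.expand p hp (etaNumSeries M hM) ^ R =
      etaNumSeries M hM ^ R := by
  have h1 := mul_invSeries (constantCoeff_expand_etaNumSeries p M hp hM)
  rw [fSeries, PowerSeries.expand_one, etaQuotSeries, AlgHom.id_apply, ← mul_pow, mul_assoc,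
    mul_comm (invSeries _), h1, mul_one]

lemma sSeries_mul_fSeries {p M R : ℕ} (hp : p ≠ 0) (hM : M ≠ 0) :
    sSeries p M R hp hM * fSeries p M 1 R hp hM one_ne_zero = PowerSeries.X := by
  rw [sSeries, mul_assoc, mul_comm (invSeries _), mul_invSeries (constantCoeff_fSeries _ _ _ _ _ _ _),
    mul_one]

lemma hasCoeffs_fSeries {p M R : ℕ} (hp : p ≠ 0) (hM : M ≠ 0) {c : List ℤ} (hc : c.length = 10)
    (h : mulList c (powList (expandList p (etaNumList M)) R) = powList (etaNumList M) R) :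
    HasCoeffs (fSeries p M 1 R hp hM one_ne_zero) c := by
  have hE := hasCoeffs_etaNumSeries hM
  refine HasCoeffs.of_mul ((hE.expand hp).pow R) ?_ ?_ ?_
  · rw [map_pow, constantCoeff_expand_etaNumSeries, one_pow]
  · rw [fSeries_mul, h]
    exact hE.pow R
  · rw [hc, length_powList, length_expandList]
    rfl

lemma hasCoeffs_X : HasCoeffs PowerSeries.X [0, 1, 0, 0, 0, 0, 0, 0, 0, 0] := by
  intro n hn
  have hn' : n < 10 := hn
  rw [PowerSeries.coeff_X]
  interval_cases n <;> rfl

lemma hasCoeffs_sSeries {p M R : ℕ} (hp : p ≠ 0) (hM : M ≠ 0) {c f : List ℤ} (hc : c.length = 10)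
    (hf' : f.length = 10) (hf : HasCoeffs (fSeries p M 1 R hp hM one_ne_zero) f)
    (h : mulList c f = [0, 1, 0, 0, 0, 0, 0, 0, 0, 0]) : HasCoeffs (sSeries p M R hp hM) c := by
  refine hf.of_mul (constantCoeff_fSeries _ _ _ _ _ _ _) ?_ (by rw [hc, hf'])
  rw [sSeries_mul_fSeries, h]
  exact hasCoeffs_X

/-! ### The modular equations between s(τ) and s(pτ). -/

lemma twist_zero_scale {p : ℕ} [Fact p.Prime] (f : ℍ → ℂ) (τ : ℍ) :
    twist p f 0 (scale p (natCast_prime_pos p) τ) = f τ := by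
  rw [twist]
  congr 1
  apply UpperHalfPlane.ext
  rw [coe_affine, coe_scale]
  have h0 : (p : ℂ) ≠ 0 := by exact_mod_cast (Fact.out : p.Prime).ne_zero
  push_cast
  rw [ZMod.val_zero, Nat.cast_zero, add_zero, mul_div_cancel_left₀ _ h0]

lemma HasVal.sum {ι : Type*} {s : Finset ι} {F : ι → ℂ⟦X⟧} {f : ι → ℂ → ℂ}
    (h : ∀ i ∈ s, HasVal (F i) (f i)) : HasVal (∑ i ∈ s, F i) (fun q => ∑ i ∈ s, f i q) := by
  intro q hq
  simp only [map_sum, Finset.sum_mul]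
  exact hasSum_sum fun i hi => h i hi q hq

lemma HasVal.intCast (c : ℤ) : HasVal (c : ℂ⟦X⟧) (fun _ => (c : ℂ)) := by
  simpa using HasVal.const (c : ℂ)

lemma isBoundedAtImInfty_sum {ι : Type*} {s : Finset ι} {f : ι → ℍ → ℂ}
    (h : ∀ i ∈ s, IsBoundedAtImInfty (f i)) : IsBoundedAtImInfty fun τ => ∑ i ∈ s, f i τ := by
  classical
  induction s using Finset.induction_on with
  | empty =>
    simp only [Finset.sum_empty]
    exact isBigO_zero (1 : ℍ → ℝ) atImInfty
  | insert a s ha ih =>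
    simp only [Finset.sum_insert ha]
    exact IsBigO.add (h a (Finset.mem_insert_self a s))
      (ih fun i hi => h i (Finset.mem_insert_of_mem hi))

/-- An identity of integral power series may be checked on the upper half plane. -/
lemma series_eq_of_forall {F G : ℤ⟦X⟧} {f g : ℂ → ℂ} (hF : HasVal (toC F) f)
    (hG : HasVal (toC G) g) (h : ∀ τ : ℍ, f (qq τ) = g (qq τ)) : F = G := by
  apply toC_injective
  -- Points of ℍ say nothing about q = 0; multiplication by X makes both sides vanish there.
  refine mul_left_cancel₀ (PowerSeries.X_ne_zero (R := ℂ)) ?_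
  refine (HasVal.X.mul hF).unique ((HasVal.X.mul hG).congr fun q hq => ?_)
  rcases eq_or_ne q 0 with rfl | h0
  · simp
  · obtain ⟨τ, rfl⟩ := exists_qq_eq hq h0
    rw [h τ]

namespace Params

variable {p M R : ℕ} (A : Params p M 1 R)
include A

/-- A modular function for `Γ₀(p M) + M` without poles on `ℍ` or at `∞` is a polynomial in `s`
that can be read off from its first coefficients. -/
lemma eq_sum_pow (ht : ALInvariant p M (fFun p M 1 R)) {f : ℍ → ℂ} {F : ℤ⟦X⟧} {v : ℂ → ℂ}
    (hF : HasVal (toC F) v) (hf : ∀ τ, v (qq τ) = f τ) (inv : ALInvariant p M f) {m : ℕ}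
    (hzero : IsBoundedAtImInfty fun τ => f (invol τ) * fFun p M 1 R (invol τ) ^ m) (c : ℕ → ℤ)
    (hm : PowerSeries.X ^ (m + 1) ∣
      F - ∑ i ∈ Finset.range (m + 1), (c i : ℤ⟦X⟧) * sSeries p M R A.p_ne A.M_ne ^ i) (τ : ℍ) :
    f τ = ∑ i ∈ Finset.range (m + 1), (c i : ℂ) * ((fFun p M 1 R τ)⁻¹) ^ i := by
  have hS := hasVal_sSeries p M R A.p_ne A.M_ne
  have hP : HasVal (toC (∑ i ∈ Finset.range (m + 1),
      (c i : ℤ⟦X⟧) * sSeries p M R A.p_ne A.M_ne ^ i))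
      (fun q => ∑ i ∈ Finset.range (m + 1), (c i : ℂ) * sVal p M R q ^ i) := by
    simp only [map_sum, map_mul, map_pow, map_intCast]
    exact HasVal.sum fun i _ => (HasVal.intCast _).mul (hS.pow i)
  have hsub := hF.sub hP
  rw [← map_sub] at hsub
  have hdvd := map_dvd toC hm
  rw [map_pow, PowerSeries.map_X] at hdvd
  refine sub_eq_zero.1 (A.eq_zero_of_X_pow_dvd ht (m := m)
    (f := fun τ => f τ - ∑ i ∈ Finset.range (m + 1), (c i : ℂ) * ((fFun p M 1 R τ)⁻¹) ^ i)
    hsub (fun τ => ?_) ?_ hdvd ?_ τ)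
  · simp only [hf, sVal_qq]
  · intro e x y z w H h τ
    simp only [inv _ _ _ _ _ H h, ht _ _ _ _ _ H h]
  · have h2 : IsBoundedAtImInfty fun τ => ∑ i ∈ Finset.range (m + 1),
        (c i : ℂ) * fFun p M 1 R (invol τ) ^ (m - i) := by
      refine isBoundedAtImInfty_sum fun i _ => ?_
      have h3 : IsBoundedAtImInfty fun τ => fFun p M 1 R (invol τ) ^ (m - i) :=
        (IsBigO.pow A.bounded_t_invol (m - i)).congr_right fun _ => one_pow _
      exact IsBigO.const_mul_left h3 _
    refine (IsBigO.sub hzero h2).congr_left fun τ => ?_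
    rw [sub_mul, Finset.sum_mul]
    congr 1
    refine Finset.sum_congr rfl fun i hi => ?_
    have hi' := Finset.mem_range_succ_iff.1 hi
    have hne := pow_ne_zero i (A.fFun_ne (invol τ))
    rw [mul_assoc, ← Nat.add_sub_cancel' hi', pow_add, ← mul_assoc (_ ^ i), inv_pow,
      inv_mul_cancel₀ hne, one_mul, Nat.add_sub_cancel_left]

lemma sum_twist_inv_eq [Fact p.Prime] (ht : ALInvariant p M (fFun p M 1 R)) (c : ℕ → ℤ)
    (hc : PowerSeries.X ^ (p + 1) ∣ (p : ℤ⟦X⟧) * uSeries p (sSeries p M R A.p_ne A.M_ne) -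
      ∑ i ∈ Finset.range (p + 1), (c i : ℤ⟦X⟧) * sSeries p M R A.p_ne A.M_ne ^ i) (τ : ℍ) :
    ∑ k, (twist p (fFun p M 1 R) k τ)⁻¹ =
      ∑ i ∈ Finset.range (p + 1), (c i : ℂ) * ((fFun p M 1 R τ)⁻¹) ^ i := by
  obtain ⟨w, hw, hwτ⟩ := sum_twist_hasVal (p := p) (hasVal_sSeries p M R A.p_ne A.M_ne)
  simp only [sVal_qq] at hwτ
  have inv : ALInvariant p M fun τ => (fFun p M 1 R τ)⁻¹ := fun e x y z w H h τ => by
    simp only [ht _ _ _ _ _ H h]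
  refine A.eq_sum_pow ht hw hwτ (ALInvariant.sum_twist (p := p) A.toAdmissible inv) ?_ c hc τ
  simp only [Finset.sum_mul]
  exact isBoundedAtImInfty_sum fun k _ => A.bounded_twist_inv ht k

/-- The power series of `t - 1 / q`. -/
lemma exists_hasVal_tail : HasVal
    (toC (PowerSeries.mk fun n => PowerSeries.coeff (n + 1)
      (fSeries p M 1 R A.p_ne A.M_ne one_ne_zero)))
    (fun q => if q = 0 then PowerSeries.coeff 1
      (toC (fSeries p M 1 R A.p_ne A.M_ne one_ne_zero)) else
      q⁻¹ * ((etaNum M (q ^ 1) / etaNum M ((q ^ 1) ^ p)) ^ R - 1)) := by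
  have hf := hasVal_fSeries p M 1 R A.p_ne A.M_ne one_ne_zero
  intro q hq
  have h1 := (hasSum_nat_add_iff' 1).2 (hf q hq)
  beta_reduce at h1 ⊢
  split_ifs with h0
  · subst h0
    convert hasSum_single 0 ?_ using 1
    · simp
    · intro n hn
      rw [zero_pow hn, mul_zero]
  · have h2 := h1.mul_left q⁻¹
    have h3 : PowerSeries.coeff 0 (toC (fSeries p M 1 R A.p_ne A.M_ne one_ne_zero)) = 1 := by
      rw [PowerSeries.coeff_map, PowerSeries.coeff_zero_eq_constantCoeff_apply,
        constantCoeff_fSeries, map_one]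
    rw [Finset.sum_range_one, pow_zero, mul_one, h3] at h2
    refine h2.congr_fun fun n => ?_
    rw [PowerSeries.coeff_map, PowerSeries.coeff_mk, PowerSeries.coeff_map, pow_succ]
    field_simp

lemma sum_twist_eq [Fact p.Prime] (ht : ALInvariant p M (fFun p M 1 R)) (c : ℕ → ℤ)
    (hc : PowerSeries.X ^ 2 ∣ (p : ℤ⟦X⟧) * uSeries p (PowerSeries.mk fun n =>
      PowerSeries.coeff (n + 1) (fSeries p M 1 R A.p_ne A.M_ne one_ne_zero)) -
      ∑ i ∈ Finset.range 2, (c i : ℤ⟦X⟧) * sSeries p M R A.p_ne A.M_ne ^ i) (τ : ℍ) :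
    ∑ k, twist p (fFun p M 1 R) k τ =
      ∑ i ∈ Finset.range 2, (c i : ℂ) * ((fFun p M 1 R τ)⁻¹) ^ i := by
  obtain ⟨w, hw, hwτ⟩ := sum_twist_hasVal (p := p) A.exists_hasVal_tail
  refine A.eq_sum_pow ht hw (fun τ => ?_) (ALInvariant.sum_twist (p := p) A.toAdmissible ht) (m := 1) ?_ c
    hc τ
  · have h0 := sum_twist_inv_qq (p := p) τ
    rw [hwτ, ← sub_zero (∑ k, twist p (fFun p M 1 R) k τ)]
    refine Eq.trans ?_ (congrArg (fun z => ∑ k, twist p (fFun p M 1 R) k τ - z) h0)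
    rw [← Finset.sum_sub_distrib]
    refine Finset.sum_congr rfl fun k _ => ?_
    simp only [twist, if_neg (qq_ne_zero _)]
    rw [fFun]
    ring
  · simp only [Finset.sum_mul, pow_one]
    exact isBoundedAtImInfty_sum fun k _ => A.bounded_twist ht k

lemma sVal_qq_pow (τ : ℍ) : sVal p M R (qq τ ^ p) =
    (fFun p M 1 R (scale p (by exact_mod_cast A.hp.pos) τ))⁻¹ := by
  rw [← qq_scale p (by exact_mod_cast A.hp.pos), sVal_qq]

end Params

/-- The modular equation of degree `2`. -/
theorem modular_equation_two {M R : ℕ} (A : Params 2 M 1 R) (ht : ALInvariant 2 M (fFun 2 M 1 R))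
    {a b : ℤ} (hc : PowerSeries.X ^ 3 ∣ 2 * uSeries 2 (sSeries 2 M R A.p_ne A.M_ne) -
      ((a : ℤ⟦X⟧) * sSeries 2 M R A.p_ne A.M_ne + (b : ℤ⟦X⟧) * sSeries 2 M R A.p_ne A.M_ne ^ 2)) :
    sSeries 2 M R A.p_ne A.M_ne ^ 2 =
      ((a : ℤ⟦X⟧) * PowerSeries.expand 2 two_ne_zero (sSeries 2 M R A.p_ne A.M_ne) +
        (b : ℤ⟦X⟧) * PowerSeries.expand 2 two_ne_zero (sSeries 2 M R A.p_ne A.M_ne) ^ 2) *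
        sSeries 2 M R A.p_ne A.M_ne +
      PowerSeries.expand 2 two_ne_zero (sSeries 2 M R A.p_ne A.M_ne) := by
  have : Fact (Nat.Prime 2) := ⟨A.hp⟩
  have hS := hasVal_sSeries 2 M R A.p_ne A.M_ne
  have hY : HasVal (toC (PowerSeries.expand 2 two_ne_zero (sSeries 2 M R A.p_ne A.M_ne)))
      (fun q => sVal 2 M R (q ^ 2)) := by
    rw [PowerSeries.map_expand]; exact hS.expand two_ne_zero
  refine series_eq_of_forall (f := fun q => sVal 2 M R q ^ 2)
    (g := fun q => (a * sVal 2 M R (q ^ 2) + b * sVal 2 M R (q ^ 2) ^ 2) * sVal 2 M R q +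
      sVal 2 M R (q ^ 2)) ?_ ?_ fun τ => ?_
  · rw [map_pow]; exact hS.pow 2
  · simp only [map_add, map_mul, map_pow, map_intCast]
    exact ((((HasVal.intCast a).mul hY).add ((HasVal.intCast b).mul (hY.pow 2))).mul hS).add hY
  · simp only [A.sVal_qq_pow, sVal_qq]
    -- At the point 2τ the class k = 0 returns s(τ). So s(τ) is a root of the quadratic whose
    -- coefficients are the trace and the product, both in ℤ[s(2τ)].
    set σ := scale (2 : ℕ) (natCast_prime_pos 2) τ with hσ
    have e1 := A.sum_twist_inv_eq ht (fun i => if i = 1 then a else if i = 2 then b else 0)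
      (by simpa [Finset.sum_range_succ] using hc) σ
    have e2 := A.prod_twist ht σ
    have z1 : ∏ k : ZMod 2, zetaP 2 ^ k.val = -1 := by
      refine (Fin.prod_univ_two _).trans ?_
      change zetaP 2 ^ 0 * zetaP 2 ^ 1 = -1
      rw [(isPrimitiveRoot_zetaP 2).eq_neg_one_of_two_right]
      norm_num
    rw [z1] at e2
    have s1 : ∀ f : ZMod 2 → ℂ, ∑ k, f k = f 0 + f 1 := fun f => Fin.sum_univ_two f
    have s2 : ∀ f : ZMod 2 → ℂ, ∏ k, f k = f 0 * f 1 := fun f => Fin.prod_univ_two f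
    rw [s1] at e1
    rw [s2] at e2
    have h0 := twist_zero_scale (p := 2) (fFun 2 M 1 R) τ
    rw [← hσ] at h0
    rw [h0] at e1 e2
    have n0 := A.fFun_ne τ
    have n1 : twist 2 (fFun 2 M 1 R) 1 σ ≠ 0 := A.fFun_ne _
    have nσ := A.fFun_ne σ
    simp [Finset.sum_range_succ] at e1
    generalize twist 2 (fFun 2 M 1 R) 1 σ = t1 at *
    generalize fFun 2 M 1 R τ = t0 at *
    generalize fFun 2 M 1 R σ = T at *
    have e3 : t0⁻¹ * t1⁻¹ = -T⁻¹ := by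
      rw [← mul_inv, e2, mul_inv]; norm_num
    linear_combination (t0⁻¹) * e1 - e3

/-- The modular equation of degree `3`. -/
theorem modular_equation_three {M R : ℕ} (A : Params 3 M 1 R)
    (ht : ALInvariant 3 M (fFun 3 M 1 R)) {a b c d e : ℤ}
    (hc : PowerSeries.X ^ 4 ∣ 3 * uSeries 3 (sSeries 3 M R A.p_ne A.M_ne) -
      ((a : ℤ⟦X⟧) * sSeries 3 M R A.p_ne A.M_ne + (b : ℤ⟦X⟧) * sSeries 3 M R A.p_ne A.M_ne ^ 2 +
        (c : ℤ⟦X⟧) * sSeries 3 M R A.p_ne A.M_ne ^ 3))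
    (hd : PowerSeries.X ^ 2 ∣ 3 * uSeries 3 (PowerSeries.mk fun n =>
      PowerSeries.coeff (n + 1) (fSeries 3 M 1 R A.p_ne A.M_ne one_ne_zero)) +
      ((d : ℤ⟦X⟧) + (e : ℤ⟦X⟧) * sSeries 3 M R A.p_ne A.M_ne)) :
    sSeries 3 M R A.p_ne A.M_ne ^ 3 =
      ((a : ℤ⟦X⟧) * PowerSeries.expand 3 three_ne_zero (sSeries 3 M R A.p_ne A.M_ne) +
        (b : ℤ⟦X⟧) * PowerSeries.expand 3 three_ne_zero (sSeries 3 M R A.p_ne A.M_ne) ^ 2 +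
        (c : ℤ⟦X⟧) * PowerSeries.expand 3 three_ne_zero (sSeries 3 M R A.p_ne A.M_ne) ^ 3) *
        sSeries 3 M R A.p_ne A.M_ne ^ 2 +
      ((d : ℤ⟦X⟧) * PowerSeries.expand 3 three_ne_zero (sSeries 3 M R A.p_ne A.M_ne) +
        (e : ℤ⟦X⟧) * PowerSeries.expand 3 three_ne_zero (sSeries 3 M R A.p_ne A.M_ne) ^ 2) *
        sSeries 3 M R A.p_ne A.M_ne +
      PowerSeries.expand 3 three_ne_zero (sSeries 3 M R A.p_ne A.M_ne) := by
  have : Fact (Nat.Prime 3) := ⟨A.hp⟩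
  have hS := hasVal_sSeries 3 M R A.p_ne A.M_ne
  have hY : HasVal (toC (PowerSeries.expand 3 three_ne_zero (sSeries 3 M R A.p_ne A.M_ne)))
      (fun q => sVal 3 M R (q ^ 3)) := by
    rw [PowerSeries.map_expand]; exact hS.expand three_ne_zero
  refine series_eq_of_forall (f := fun q => sVal 3 M R q ^ 3)
    (g := fun q => (a * sVal 3 M R (q ^ 3) + b * sVal 3 M R (q ^ 3) ^ 2 +
      c * sVal 3 M R (q ^ 3) ^ 3) * sVal 3 M R q ^ 2 +
      (d * sVal 3 M R (q ^ 3) + e * sVal 3 M R (q ^ 3) ^ 2) * sVal 3 M R q +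
      sVal 3 M R (q ^ 3)) ?_ ?_ fun τ => ?_
  · rw [map_pow]; exact hS.pow 3
  · simp only [map_add, map_mul, map_pow, map_intCast]
    exact (((((HasVal.intCast a).mul hY).add ((HasVal.intCast b).mul (hY.pow 2))).add
      ((HasVal.intCast c).mul (hY.pow 3))).mul (hS.pow 2)).add
      ((((HasVal.intCast d).mul hY).add ((HasVal.intCast e).mul (hY.pow 2))).mul hS) |>.add hY
  · simp only [A.sVal_qq_pow, sVal_qq]
    set σ := scale (3 : ℕ) (natCast_prime_pos 3) τ with hσ
    have e1 := A.sum_twist_inv_eq ht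
      (fun i => if i = 1 then a else if i = 2 then b else if i = 3 then c else 0)
      (by simpa [Finset.sum_range_succ] using hc) σ
    have e2 := A.prod_twist ht σ
    have e3 := A.sum_twist_eq ht (fun i => if i = 0 then -d else -e)
      (by
        simp only [Finset.sum_range_succ, Finset.sum_range_zero]
        convert hd using 1
        push_cast
        simp
        ring) σ
    have z1 : ∏ k : ZMod 3, zetaP 3 ^ k.val = 1 := by
      refine (Fin.prod_univ_three _).trans ?_
      change zetaP 3 ^ 0 * zetaP 3 ^ 1 * zetaP 3 ^ 2 = 1
      rw [← pow_add, ← pow_add]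
      exact (isPrimitiveRoot_zetaP 3).pow_eq_one
    rw [z1, inv_one, one_mul] at e2
    have s1 : ∀ f : ZMod 3 → ℂ, ∑ k, f k = f 0 + f 1 + f 2 := fun f => Fin.sum_univ_three f
    have s2 : ∀ f : ZMod 3 → ℂ, ∏ k, f k = f 0 * f 1 * f 2 := fun f => Fin.prod_univ_three f
    rw [s1] at e1 e3
    rw [s2] at e2
    have h0 := twist_zero_scale (p := 3) (fFun 3 M 1 R) τ
    rw [← hσ] at h0
    rw [h0] at e1 e2 e3
    have n0 := A.fFun_ne τ
    have n1 : twist 3 (fFun 3 M 1 R) 1 σ ≠ 0 := A.fFun_ne _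
    have n2 : twist 3 (fFun 3 M 1 R) 2 σ ≠ 0 := A.fFun_ne _
    have nσ := A.fFun_ne σ
    simp [Finset.sum_range_succ] at e1 e3
    generalize twist 3 (fFun 3 M 1 R) 1 σ = t1 at *
    generalize twist 3 (fFun 3 M 1 R) 2 σ = t2 at *
    generalize fFun 3 M 1 R τ = t0 at *
    generalize fFun 3 M 1 R σ = T at *
    have f3 : t0⁻¹ * t1⁻¹ * t2⁻¹ = T⁻¹ := by rw [← e2, mul_inv, mul_inv]
    -- The second symmetric function of the reciprocals is the sum of the t's divided by their
    -- product.
    have f2 : t0⁻¹ * t1⁻¹ + t0⁻¹ * t2⁻¹ + t1⁻¹ * t2⁻¹ = T⁻¹ * (-d + -(e * T⁻¹)) := by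
      rw [← e3, ← f3]
      field_simp
      ring
    linear_combination (t0⁻¹) ^ 2 * e1 - t0⁻¹ * f2 + f3

/-! ### The trace of a power series over `ℤ⟦X ^ p⟧` -/

lemma expand_injective {R : Type*} [CommRing R] {p : ℕ} (hp : p ≠ 0) :
    Function.Injective (PowerSeries.expand p hp : R⟦X⟧ → R⟦X⟧) := by
  intro F G h
  ext n
  rw [← PowerSeries.coeff_expand_mul p hp F, h, PowerSeries.coeff_expand_mul]

lemma rescale_expand {R : Type*} [CommRing R] {p : ℕ} (hp : p ≠ 0) {ζ : R} (hζ : ζ ^ p = 1)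
    (F : R⟦X⟧) :
    PowerSeries.rescale ζ (PowerSeries.expand p hp F) = PowerSeries.expand p hp F := by
  ext n
  rw [PowerSeries.coeff_rescale]
  by_cases h : p ∣ n
  · obtain ⟨m, rfl⟩ := h
    rw [pow_mul, hζ, one_pow, one_mul]
  · rw [PowerSeries.coeff_expand_of_not_dvd _ _ _ h, mul_zero]

/-- The substitutions X ↦ ζ^k X are the conjugations over series in X^p, so p·U_p is a trace. -/
lemma sum_rescale {p : ℕ} (hp : p ≠ 0) {ζ : ℂ} (hζ : IsPrimitiveRoot ζ p) (F : ℤ⟦X⟧) :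
    ∑ k ∈ Finset.range p, PowerSeries.rescale (ζ ^ k) (toC F) =
      p * toC (PowerSeries.expand p hp (uSeries p F)) := by
  ext n
  rw [map_sum]
  simp only [PowerSeries.coeff_rescale]
  rw [← Finset.sum_mul, ← nsmul_eq_mul, map_nsmul, nsmul_eq_mul, PowerSeries.coeff_map,
    PowerSeries.coeff_map]
  by_cases h : p ∣ n
  · obtain ⟨m, rfl⟩ := h
    rw [PowerSeries.coeff_expand_mul, uSeries, PowerSeries.coeff_mk]
    congr 1
    rw [Finset.sum_congr rfl fun k _ => by
      rw [← pow_mul, mul_left_comm, pow_mul, hζ.pow_eq_one, one_pow]]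
    simp
  · rw [PowerSeries.coeff_expand_of_not_dvd _ _ _ h]
    have h1 : ζ ^ n ≠ 1 := fun h' => h (hζ.dvd_of_pow_eq_one n h')
    have h2 : ∑ k ∈ Finset.range p, (ζ ^ k) ^ n = 0 := by
      simp only [← pow_mul, mul_comm _ n]
      simp only [pow_mul]
      rw [geom_sum_eq h1, ← pow_mul, mul_comm, pow_mul, hζ.pow_eq_one, one_pow, sub_self, zero_div]
    rw [h2, zero_mul, map_zero, mul_zero]

lemma uSeries_add (p : ℕ) (F G : ℤ⟦X⟧) : uSeries p (F + G) = uSeries p F + uSeries p G := by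
  ext n; simp [uSeries]

lemma uSeries_intCast_mul (p : ℕ) (c : ℤ) (F : ℤ⟦X⟧) :
    uSeries p ((c : ℤ⟦X⟧) * F) = (c : ℤ⟦X⟧) * uSeries p F := by
  ext n; simp [uSeries, ← zsmul_eq_mul]

/-- Power series over `ℤ` are determined by their images under `p • expand p`. -/
lemma eq_of_natCast_mul_expand {p : ℕ} (hp : p ≠ 0) {F G : ℤ⟦X⟧}
    (h : (p : ℂ⟦X⟧) * toC (PowerSeries.expand p hp F) =
      (p : ℂ⟦X⟧) * toC (PowerSeries.expand p hp G)) : F = G := by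
  have hp' : (p : ℂ⟦X⟧) ≠ 0 := by
    rw [← map_natCast (PowerSeries.C (R := ℂ))]
    exact (map_ne_zero_iff _ PowerSeries.C_injective).2 (by exact_mod_cast hp)
  exact expand_injective hp (toC_injective (mul_left_cancel₀ hp' h))

/-- Linearity of the trace: series in X^p are fixed by every substitution X ↦ ζ^k X. -/
lemma uSeries_expand_mul {p : ℕ} (hp : p ≠ 0) (G F : ℤ⟦X⟧) :
    uSeries p (PowerSeries.expand p hp G * F) = G * uSeries p F := by
  have hζ := Complex.isPrimitiveRoot_exp p hp
  apply eq_of_natCast_mul_expand hp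
  rw [← sum_rescale hp hζ, map_mul, map_mul, map_mul, mul_left_comm, ← sum_rescale hp hζ, Finset.mul_sum]
  refine Finset.sum_congr rfl fun k _ => ?_
  rw [map_mul, PowerSeries.map_expand, rescale_expand]
  rw [pow_right_comm, hζ.pow_eq_one, one_pow]

lemma uSeries_one {p : ℕ} (hp : p ≠ 0) : uSeries p 1 = 1 := by
  ext n
  rw [uSeries, PowerSeries.coeff_mk, PowerSeries.coeff_one, PowerSeries.coeff_one]
  simp [hp]

/-- Conjugates of a series with linear coefficient 1 are distinct, so differences of roots may be
cancelled. -/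
lemma rescale_ne {F : ℂ⟦X⟧} (hF : PowerSeries.coeff 1 F = 1) {z w : ℂ} (h : z ≠ w) :
    PowerSeries.rescale z F - PowerSeries.rescale w F ≠ 0 := by
  intro h0
  have := congrArg (PowerSeries.coeff 1) h0
  rw [map_sub, PowerSeries.coeff_rescale, PowerSeries.coeff_rescale, hF] at this
  exact h (by simpa [sub_eq_zero] using this)

section two

variable {σ u v : ℤ⟦X⟧}

/-- The trace of a root of a quadratic equation. -/
lemma uSeries_root_two (h1 : PowerSeries.coeff 1 σ = 1)
    (h : σ ^ 2 = PowerSeries.expand 2 two_ne_zero u * σ + PowerSeries.expand 2 two_ne_zero v) :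
    2 * uSeries 2 σ = u := by
  have hζ : IsPrimitiveRoot (-1 : ℂ) 2 := IsPrimitiveRoot.neg_one 0 (by norm_num)
  apply expand_injective two_ne_zero
  apply toC_injective
  rw [map_mul, map_mul]
  have h2 := sum_rescale two_ne_zero hζ σ
  rw [Finset.sum_range_succ, Finset.sum_range_one] at h2
  have h3 := congrArg (fun F => PowerSeries.rescale ((-1 : ℂ) ^ 0) (toC F)) h
  have h4 := congrArg (fun F => PowerSeries.rescale ((-1 : ℂ) ^ 1) (toC F)) h
  simp only [map_mul, map_add, map_pow, PowerSeries.map_expand] at h3 h4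
  rw [rescale_expand two_ne_zero (by norm_num), rescale_expand two_ne_zero (by norm_num)] at h3 h4
  have hne := rescale_ne (F := toC σ) (z := (-1 : ℂ) ^ 0) (w := (-1) ^ 1)
    (by rw [PowerSeries.coeff_map, h1, map_one]) (by norm_num)
  simp only [PowerSeries.map_expand, map_ofNat]
  simp only [PowerSeries.map_expand] at h2
  push_cast at h2
  rw [← h2]
  -- Subtracting the equations of σ(X) and σ(-X) and cancelling their difference leaves the sum of
  -- the roots.
  apply mul_left_cancel₀ hne
  linear_combination h3 - h4

lemma uSeries_pow_two (h : σ ^ 2 = PowerSeries.expand 2 two_ne_zero u * σ +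
    PowerSeries.expand 2 two_ne_zero v) (i : ℕ) :
    uSeries 2 (σ ^ (i + 2)) = u * uSeries 2 (σ ^ (i + 1)) + v * uSeries 2 (σ ^ i) := by
  rw [← uSeries_expand_mul two_ne_zero, ← uSeries_expand_mul two_ne_zero, ← uSeries_add]
  congr 1
  linear_combination σ ^ i * h

end two

section three

variable {σ u v w : ℤ⟦X⟧}

/-- The first two power sums of the roots of a cubic equation. -/
lemma uSeries_root_three (h1 : PowerSeries.coeff 1 σ = 1)
    (h : σ ^ 3 = PowerSeries.expand 3 three_ne_zero u * σ ^ 2 +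
      PowerSeries.expand 3 three_ne_zero v * σ + PowerSeries.expand 3 three_ne_zero w) :
    3 * uSeries 3 σ = u ∧ 3 * uSeries 3 (σ ^ 2) = u ^ 2 + 2 * v := by
  obtain ⟨ζ, hζ⟩ : ∃ ζ : ℂ, IsPrimitiveRoot ζ 3 := ⟨_, Complex.isPrimitiveRoot_exp 3 three_ne_zero⟩
  have h2 := fun F => sum_rescale three_ne_zero hζ F
  simp only [Finset.sum_range_succ, Finset.sum_range_zero, zero_add] at h2
  have root : ∀ k, PowerSeries.rescale (ζ ^ k) (toC σ) ^ 3 =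
      PowerSeries.expand 3 three_ne_zero (toC u) * PowerSeries.rescale (ζ ^ k) (toC σ) ^ 2 +
      PowerSeries.expand 3 three_ne_zero (toC v) * PowerSeries.rescale (ζ ^ k) (toC σ) +
      PowerSeries.expand 3 three_ne_zero (toC w) := by
    intro k
    have h3 := congrArg (fun F => PowerSeries.rescale (ζ ^ k) (toC F)) h
    have hk : (ζ ^ k) ^ 3 = 1 := by rw [← pow_mul, mul_comm, pow_mul, hζ.pow_eq_one, one_pow]
    simp only [map_mul, map_add, map_pow, PowerSeries.map_expand] at h3
    simpa only [rescale_expand three_ne_zero hk] using h3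
  have hne : ∀ i j, i < 3 → j < 3 → i ≠ j → PowerSeries.rescale (ζ ^ i) (toC σ) -
      PowerSeries.rescale (ζ ^ j) (toC σ) ≠ 0 := fun i j hi hj hij =>
    rescale_ne (by rw [PowerSeries.coeff_map, h1, map_one]) fun he => hij (hζ.pow_inj hi hj he)
  have n01 := hne 0 1 (by norm_num) (by norm_num) (by norm_num)
  have n02 := hne 0 2 (by norm_num) (by norm_num) (by norm_num)
  have n12 := hne 1 2 (by norm_num) (by norm_num) (by norm_num)
  have r0 := root 0
  have r1 := root 1
  have r2 := root 2
  have t1 := h2 σ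
  have t2 := h2 (σ ^ 2)
  simp only [map_pow] at t2
  generalize PowerSeries.rescale (ζ ^ 0) (toC σ) = x at *
  generalize PowerSeries.rescale (ζ ^ 1) (toC σ) = y at *
  generalize PowerSeries.rescale (ζ ^ 2) (toC σ) = z at *
  -- Divided differences of the cubic at pairs of roots; a second difference gives x + y + z = u.
  -- The sum of squares is then u² + 2v, since the second symmetric function is -v.
  have e01 : x ^ 2 + x * y + y ^ 2 = PowerSeries.expand 3 three_ne_zero (toC u) * (x + y) +
      PowerSeries.expand 3 three_ne_zero (toC v) := by
    apply mul_left_cancel₀ n01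
    linear_combination r0 - r1
  have e02 : x ^ 2 + x * z + z ^ 2 = PowerSeries.expand 3 three_ne_zero (toC u) * (x + z) +
      PowerSeries.expand 3 three_ne_zero (toC v) := by
    apply mul_left_cancel₀ n02
    linear_combination r0 - r2
  have e : x + y + z = PowerSeries.expand 3 three_ne_zero (toC u) := by
    apply mul_left_cancel₀ n12
    linear_combination e01 - e02
  constructor <;> apply expand_injective three_ne_zero <;> apply toC_injective
  · simp only [map_mul, PowerSeries.map_expand, map_ofNat] at t1 ⊢
    push_cast at t1
    rw [← t1, e]
  · simp only [map_mul, map_add, map_pow, PowerSeries.map_expand, map_ofNat] at t2 ⊢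
    push_cast at t2
    rw [← t2, ← e]
    rw [← e] at e01
    linear_combination 2 * e01

lemma uSeries_pow_three (h : σ ^ 3 = PowerSeries.expand 3 three_ne_zero u * σ ^ 2 +
      PowerSeries.expand 3 three_ne_zero v * σ + PowerSeries.expand 3 three_ne_zero w) (i : ℕ) :
    uSeries 3 (σ ^ (i + 3)) = u * uSeries 3 (σ ^ (i + 2)) + v * uSeries 3 (σ ^ (i + 1)) +
      w * uSeries 3 (σ ^ i) := by
  rw [← uSeries_expand_mul three_ne_zero, ← uSeries_expand_mul three_ne_zero,
    ← uSeries_expand_mul three_ne_zero, ← uSeries_add, ← uSeries_add]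
  congr 1
  linear_combination σ ^ i * h

end three

/-! ### The image of `1 / σ` under `U_p` -/

/-- The power series part of `f / X` after applying `U_p`. -/
def tailSeries (p : ℕ) (f : ℤ⟦X⟧) : ℤ⟦X⟧ :=
  PowerSeries.mk fun n => PowerSeries.coeff (p * n + 1) f

/-- The factor X^(p-1) instead of X⁻¹ keeps everything inside power series: it shifts the image of
f/X by one power of X. -/
lemma uSeries_X_pow_mul {p : ℕ} (hp : 2 ≤ p) (f : ℤ⟦X⟧) :
    uSeries p (PowerSeries.X ^ (p - 1) * f) = PowerSeries.X * tailSeries p f := by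
  ext n
  rw [uSeries, PowerSeries.coeff_mk, PowerSeries.coeff_X_pow_mul']
  cases n with
  | zero => rw [if_neg (by omega), PowerSeries.coeff_zero_X_mul]
  | succ n =>
    rw [if_pos (by rw [mul_add]; omega), PowerSeries.coeff_succ_X_mul, tailSeries,
      PowerSeries.coeff_mk]
    have : p * (n + 1) - (p - 1) = p * n + 1 := by rw [mul_add]; omega
    rw [this]

lemma coeff_one_of_mul_eq_X {f σ : ℤ⟦X⟧} (hf : PowerSeries.constantCoeff f = 1)
    (hσ : σ * f = PowerSeries.X) :
    PowerSeries.coeff 1 σ = 1 := by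
  have h : σ = PowerSeries.X * invSeries f := by
    rw [← hσ, mul_assoc, mul_invSeries hf, mul_one]
  rw [h, ← zero_add 1, PowerSeries.coeff_succ_X_mul, PowerSeries.coeff_zero_eq_constantCoeff_apply,
    constantCoeff_invSeries]

/-- Write Y = σ(X²). Dividing the equation by Yσ gives 1/σ = σ/Y - g(Y). Applying 2U_2, with 2U_2(σ)
= σg, yields g - 2g = -g. -/
lemma tailSeries_two {f σ g : ℤ⟦X⟧} (hf : PowerSeries.constantCoeff f = 1)
    (hσ : σ * f = PowerSeries.X)
    (h : σ ^ 2 = PowerSeries.expand 2 two_ne_zero (σ * g) * σ +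
      PowerSeries.expand 2 two_ne_zero σ) :
    2 * tailSeries 2 f = -g := by
  have hU := uSeries_root_two (coeff_one_of_mul_eq_X hf hσ) h
  have hF := congrArg (PowerSeries.expand 2 two_ne_zero) hσ
  rw [map_mul, PowerSeries.expand_X] at hF
  have h1 : PowerSeries.expand 2 two_ne_zero f * σ =
      PowerSeries.expand 2 two_ne_zero (PowerSeries.X * g) * 1 + PowerSeries.X ^ (2 - 1) * f := by
    apply mul_left_cancel₀ (PowerSeries.X_ne_zero (R := ℤ))
    rw [map_mul] at h ⊢
    rw [PowerSeries.expand_X]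
    linear_combination f * PowerSeries.expand 2 two_ne_zero f * h -
      (PowerSeries.expand 2 two_ne_zero f * σ -
        PowerSeries.expand 2 two_ne_zero g * PowerSeries.X ^ 2) * hσ +
      (PowerSeries.expand 2 two_ne_zero g * σ * f + f) * hF
  have h2 := congrArg (uSeries 2) h1
  rw [uSeries_add, uSeries_expand_mul, uSeries_expand_mul, uSeries_one two_ne_zero,
    uSeries_X_pow_mul le_rfl] at h2
  apply mul_left_cancel₀ (PowerSeries.X_ne_zero (R := ℤ))
  linear_combination -2 * h2 + f * hU + g * hσ

/-- Write Y = σ(X³). Then 1/σ = σ²/Y - g(Y)σ - k(Y), and 3U_3 of the right side is (σg² + 2k) - σg²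
- 3k = -k by the power sums of the roots. -/
lemma tailSeries_three {f σ g k : ℤ⟦X⟧} (hf : PowerSeries.constantCoeff f = 1)
    (hσ : σ * f = PowerSeries.X)
    (h : σ ^ 3 = PowerSeries.expand 3 three_ne_zero (σ * g) * σ ^ 2 +
      PowerSeries.expand 3 three_ne_zero (σ * k) * σ + PowerSeries.expand 3 three_ne_zero σ) :
    3 * tailSeries 3 f = -k := by
  obtain ⟨hU, hU2⟩ := uSeries_root_three (coeff_one_of_mul_eq_X hf hσ) h
  have hF := congrArg (PowerSeries.expand 3 three_ne_zero) hσ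
  rw [map_mul, PowerSeries.expand_X] at hF
  have h1 : PowerSeries.expand 3 three_ne_zero f * σ ^ 2 =
      PowerSeries.expand 3 three_ne_zero (PowerSeries.X * g) * σ +
      PowerSeries.expand 3 three_ne_zero (PowerSeries.X * k) * 1 +
        PowerSeries.X ^ (3 - 1) * f := by
    apply mul_left_cancel₀ (PowerSeries.X_ne_zero (R := ℤ))
    rw [map_mul, map_mul] at h ⊢
    rw [PowerSeries.expand_X]
    linear_combination f * PowerSeries.expand 3 three_ne_zero f * h -
      (PowerSeries.expand 3 three_ne_zero f * σ ^ 2 -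
        PowerSeries.expand 3 three_ne_zero g * PowerSeries.X ^ 3 * σ -
        PowerSeries.expand 3 three_ne_zero k * PowerSeries.X ^ 3) * hσ +
      (PowerSeries.expand 3 three_ne_zero g * σ ^ 2 * f +
        PowerSeries.expand 3 three_ne_zero k * σ * f + f) * hF
  have h2 := congrArg (uSeries 3) h1
  rw [uSeries_add, uSeries_add, uSeries_expand_mul, uSeries_expand_mul, uSeries_expand_mul,
    uSeries_one three_ne_zero, uSeries_X_pow_mul (by norm_num)] at h2
  apply mul_left_cancel₀ (PowerSeries.X_ne_zero (R := ℤ))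
  linear_combination -3 * h2 + f * hU2 - PowerSeries.X * g * hU + (g ^ 2 * σ + 2 * k) * hσ

/-! ### Roots of the modular equations of degrees two and three -/

lemma exists_eq_X_mul {f σ : ℤ⟦X⟧} (hf : PowerSeries.constantCoeff f = 1)
    (hσ : σ * f = PowerSeries.X) :
    ∃ v : ℤ⟦X⟧, σ = PowerSeries.X * v ∧ PowerSeries.constantCoeff v = 1 :=
  ⟨invSeries f, by rw [← hσ, mul_assoc, mul_invSeries hf, mul_one], constantCoeff_invSeries f⟩

lemma ne_zero_of_eq_X_pow_mul {F G : ℤ⟦X⟧} {n : ℕ} (h : F = PowerSeries.X ^ n * G)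
    (hG : PowerSeries.constantCoeff G ≠ 0) : F ≠ 0 := by
  rw [h]
  refine mul_ne_zero (pow_ne_zero _ PowerSeries.X_ne_zero) ?_
  rintro rfl
  exact hG (map_zero _)

lemma expand_comm {m n : ℕ} (hm : m ≠ 0) (hn : n ≠ 0) (F : ℤ⟦X⟧) :
    PowerSeries.expand m hm (PowerSeries.expand n hn F) =
      PowerSeries.expand n hn (PowerSeries.expand m hm F) := by
  rw [← PowerSeries.expand_mul, ← PowerSeries.expand_mul]
  simp only [mul_comm]

/-- The cube root of a solution of a modular equation of degree two. -/
lemma modular_equation_cube_root {f σ s : ℤ⟦X⟧} (hf : PowerSeries.constantCoeff f = 1)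
    (hσ : σ * f = PowerSeries.X) (hs : σ ^ 3 = PowerSeries.expand 3 three_ne_zero s)
    (h : s ^ 2 = (48 * PowerSeries.expand 2 two_ne_zero s +
      4096 * PowerSeries.expand 2 two_ne_zero s ^ 2) * s + PowerSeries.expand 2 two_ne_zero s) :
    σ ^ 2 = 16 * PowerSeries.expand 2 two_ne_zero σ ^ 2 * σ + PowerSeries.expand 2 two_ne_zero σ := by
  obtain ⟨v, hv, hv0⟩ := exists_eq_X_mul hf hσ
  have h1 := congrArg (PowerSeries.expand 3 three_ne_zero) h
  simp only [map_add, map_mul, map_pow, map_ofNat] at h1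
  rw [expand_comm three_ne_zero two_ne_zero, ← hs, map_pow] at h1
  have hY : PowerSeries.expand 2 two_ne_zero σ =
      PowerSeries.X ^ 2 * PowerSeries.expand 2 two_ne_zero v := by
    rw [hv, map_mul, PowerSeries.expand_X]
  have hw : PowerSeries.constantCoeff (PowerSeries.expand 2 two_ne_zero v) = 1 := by
    rw [PowerSeries.constantCoeff_expand, hv0]
  set y := PowerSeries.expand 2 two_ne_zero σ
  generalize PowerSeries.expand 2 two_ne_zero v = w at hY hw
  -- With a = σ², b = 16y²σ and c = y, the equation for s reads a³ - b³ - c³ - 3abc = 0, which has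
  -- the factor a - b - c. The other factor is X⁴ times a series with constant term 3.
  have hne : (σ ^ 2) ^ 2 + (16 * y ^ 2 * σ) ^ 2 + y ^ 2 + σ ^ 2 * (16 * y ^ 2 * σ) + σ ^ 2 * y -
      16 * y ^ 2 * σ * y ≠ 0 := by
    refine ne_zero_of_eq_X_pow_mul (n := 4) (G := v ^ 4 + 256 * PowerSeries.X ^ 6 * w ^ 4 * v ^ 2 +
      w ^ 2 + 16 * PowerSeries.X ^ 3 * v ^ 3 * w ^ 2 + v ^ 2 * w - 16 * PowerSeries.X ^ 3 * w ^ 3 * v)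
      ?_ ?_
    · rw [hv, hY]; ring
    · simp [hv0, hw]
  apply mul_left_cancel₀ hne
  linear_combination h1

/-- The fourth root of a solution of a modular equation of degree three. -/
lemma modular_equation_fourth_root {f σ s : ℤ⟦X⟧} (hf : PowerSeries.constantCoeff f = 1)
    (hσ : σ * f = PowerSeries.X) (hs : σ ^ 4 = PowerSeries.expand 4 four_ne_zero s)
    (h : s ^ 3 = (54 * PowerSeries.expand 3 three_ne_zero s +
      972 * PowerSeries.expand 3 three_ne_zero s ^ 2 +
      6561 * PowerSeries.expand 3 three_ne_zero s ^ 3) * s ^ 2 +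
      (12 * PowerSeries.expand 3 three_ne_zero s +
        81 * PowerSeries.expand 3 three_ne_zero s ^ 2) * s +
      PowerSeries.expand 3 three_ne_zero s) :
    σ ^ 3 = 9 * PowerSeries.expand 3 three_ne_zero σ ^ 3 * σ ^ 2 +
      3 * PowerSeries.expand 3 three_ne_zero σ ^ 2 * σ + PowerSeries.expand 3 three_ne_zero σ := by
  obtain ⟨v, hv, hv0⟩ := exists_eq_X_mul hf hσ
  have h1 := congrArg (PowerSeries.expand 4 four_ne_zero) h
  simp only [map_add, map_mul, map_pow, map_ofNat] at h1
  rw [expand_comm four_ne_zero three_ne_zero, ← hs, map_pow] at h1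
  have hY : PowerSeries.expand 3 three_ne_zero σ =
      PowerSeries.X ^ 3 * PowerSeries.expand 3 three_ne_zero v := by
    rw [hv, map_mul, PowerSeries.expand_X]
  have hw : PowerSeries.constantCoeff (PowerSeries.expand 3 three_ne_zero v) = 1 := by
    rw [PowerSeries.constantCoeff_expand, hv0]
  set y := PowerSeries.expand 3 three_ne_zero σ
  generalize PowerSeries.expand 3 three_ne_zero v = w at hY hw
  -- Let P(σ) be the cubic σ³ - 9y³σ² - 3y²σ - y. The equation for s is, up to sign, the product of
  -- P(σ), P(-σ), P(iσ) and P(-iσ). The factor here is P(-σ); `hne2` treats -P(iσ)P(-iσ). Their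
  -- lowest coefficients are -2.
  have hne1 : -σ ^ 3 - 9 * y ^ 3 * σ ^ 2 + 3 * y ^ 2 * σ - y ≠ 0 := by
    refine ne_zero_of_eq_X_pow_mul (n := 3) (G := -v ^ 3 - 9 * PowerSeries.X ^ 8 * w ^ 3 * v ^ 2 +
      3 * PowerSeries.X ^ 4 * w ^ 2 * v - w) ?_ ?_
    · rw [hv, hY]; ring
    · simp [hv0, hw]
  have hne2 : -σ ^ 6 - (6 * y ^ 2 + 81 * y ^ 6) * σ ^ 4 + 9 * y ^ 4 * σ ^ 2 - y ^ 2 ≠ 0 := by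
    refine ne_zero_of_eq_X_pow_mul (n := 6) (G := -v ^ 6 -
      (6 * PowerSeries.X ^ 4 * w ^ 2 + 81 * PowerSeries.X ^ 16 * w ^ 6) * v ^ 4 +
      9 * PowerSeries.X ^ 8 * w ^ 4 * v ^ 2 - w ^ 2) ?_ ?_
    · rw [hv, hY]; ring
    · simp [hv0, hw]
  apply mul_left_cancel₀ (mul_ne_zero hne1 hne2)
  linear_combination h1

/-! ### Lattices of power series -/

/-- The additive group generated by the `p ^ e * σ ^ j` with `P j` and `A j + w ≤ D e`. -/
def lattice (p : ℕ) (σ : ℤ⟦X⟧) (D A : ℕ) (P : ℕ → Prop) (w : ℤ) : AddSubgroup ℤ⟦X⟧ :=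
  AddSubgroup.closure {F | ∃ e j : ℕ, P j ∧ (A * j + w : ℤ) ≤ D * e ∧ F = (p : ℤ⟦X⟧) ^ e * σ ^ j}

namespace lattice

variable {p : ℕ} {σ F : ℤ⟦X⟧} {D A : ℕ} {P Q : ℕ → Prop} {w w' : ℤ}

lemma intCast_mul_mem (c : ℤ) (hF : F ∈ lattice p σ D A P w) :
    (c : ℤ⟦X⟧) * F ∈ lattice p σ D A P w := by
  rw [← zsmul_eq_mul]
  exact zsmul_mem hF c

/-- Multiplication by a monomial. -/
lemma mul_mem (m l : ℕ) {c : ℤ} (hc : (p : ℤ) ^ m ∣ c) (hP : ∀ j, P j → Q (j + l))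
    (hw : w' + A * l ≤ w + D * m) (hF : F ∈ lattice p σ D A P w) :
    (c : ℤ⟦X⟧) * σ ^ l * F ∈ lattice p σ D A Q w' := by
  obtain ⟨d, rfl⟩ := hc
  have h1 : (((p : ℤ) ^ m * d : ℤ) : ℤ⟦X⟧) * σ ^ l * F = (d : ℤ⟦X⟧) * ((p : ℤ⟦X⟧) ^ m * σ ^ l * F) := by
    push_cast; ring
  rw [h1]
  clear h1
  apply intCast_mul_mem
  induction hF using AddSubgroup.closure_induction with
  | mem x hx =>
    obtain ⟨e, j, hj, he, rfl⟩ := hx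
    refine AddSubgroup.subset_closure ⟨e + m, j + l, hP j hj, ?_, by ring⟩
    push_cast
    linarith
  | zero => rw [mul_zero]; exact zero_mem _
  | add x y _ _ hx hy => rw [mul_add]; exact add_mem hx hy
  | neg x _ hx => rw [mul_neg]; exact neg_mem hx

lemma monomial_mem (m l : ℕ) {c : ℤ} (hc : (p : ℤ) ^ m ∣ c) (hP : P l)
    (hw : (A * l + w : ℤ) ≤ D * m) : (c : ℤ⟦X⟧) * σ ^ l ∈ lattice p σ D A P w := by
  obtain ⟨d, rfl⟩ := hc
  have h1 : (((p : ℤ) ^ m * d : ℤ) : ℤ⟦X⟧) * σ ^ l = (d : ℤ⟦X⟧) * ((p : ℤ⟦X⟧) ^ m * σ ^ l) := by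
    push_cast; ring
  rw [h1]
  exact intCast_mul_mem _ (AddSubgroup.subset_closure ⟨m, l, hP, hw, rfl⟩)

lemma dvd_coeff (hF : F ∈ lattice p σ D A P w) {N : ℕ}
    (hN : ∀ j e : ℕ, P j → (A * j + w : ℤ) ≤ D * e → N ≤ e) (n : ℕ) :
    (p : ℤ) ^ N ∣ PowerSeries.coeff n F := by
  induction hF using AddSubgroup.closure_induction with
  | mem x hx =>
    obtain ⟨e, j, hj, he, rfl⟩ := hx
    have h1 : (p : ℤ⟦X⟧) ^ e * σ ^ j = (p ^ e : ℤ) • σ ^ j := by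
      rw [zsmul_eq_mul]; push_cast; rfl
    rw [h1, map_zsmul, smul_eq_mul]
    exact (pow_dvd_pow _ (hN j e hj he)).mul_right _
  | zero => rw [map_zero]; exact dvd_zero _
  | add x y _ _ hx hy => rw [map_add]; exact dvd_add hx hy
  | neg x _ hx => rw [map_neg]; exact hx.neg_right

/-- A generator p^e σ^j of weight w has D·e ≥ A·j + w. If U_p(σ^j) has weight δ - A·j, the factor
p^e raises the weight to at least w + δ; so only the powers of σ need to be checked. -/
lemma uSeries_mem {δ : ℤ} (hU : ∀ i, P i → uSeries p (σ ^ i) ∈ lattice p σ D A P (δ - A * i))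
    (hF : F ∈ lattice p σ D A P w) : uSeries p F ∈ lattice p σ D A P (w + δ) := by
  have hneg : ∀ x : ℤ⟦X⟧, uSeries p (-x) = -uSeries p x := fun x => by ext; simp [uSeries]
  induction hF using AddSubgroup.closure_induction with
  | mem x hx =>
    obtain ⟨e, j, hj, he, rfl⟩ := hx
    have h1 : (p : ℤ⟦X⟧) ^ e = ((p ^ e : ℤ) : ℤ⟦X⟧) := by push_cast; rfl
    rw [h1, uSeries_intCast_mul]
    have h2 := mul_mem (Q := P) (w' := w + δ) e 0 (c := (p : ℤ) ^ e) dvd_rfl (fun j hj => hj)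
      (by push_cast; linarith) (hU j hj)
    simpa using h2
  | zero =>
    have : uSeries p 0 = 0 := by ext; simp [uSeries]
    rw [this]; exact zero_mem _
  | add x y _ _ hx hy => rw [uSeries_add]; exact add_mem hx hy
  | neg x _ hx => rw [hneg]; exact neg_mem hx

lemma uSeries_iterate_mem {δ : ℤ}
    (hU : ∀ i, P i → uSeries p (σ ^ i) ∈ lattice p σ D A P (δ - A * i))
    (hF : F ∈ lattice p σ D A P w) (k : ℕ) :
    (uSeries p)^[k] F ∈ lattice p σ D A P (w + k * δ) := by
  induction k with
  | zero => simpa using hF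
  | succ k ih =>
    rw [Function.iterate_succ_apply']
    have := uSeries_mem hU ih
    convert this using 2
    push_cast
    ring

end lattice

/-! ### Gain of p-adic valuation under iteration of U_p. -/

lemma ofNat_ne_zero_series (n : ℕ) [n.AtLeastTwo] : (ofNat(n) : ℤ⟦X⟧) ≠ 0 := fun h => by
  have := congrArg PowerSeries.constantCoeff h
  rw [map_ofNat, map_zero] at this
  exact OfNat.ofNat_ne_zero n this

/-- Divisibility of iterates of `U_2` for the modular equation
`σ² = (a Y + b Y²) σ + Y`, `Y = σ(X²)`. -/
theorem dvd_coeff_iterate_two {σ : ℤ⟦X⟧} (h1 : PowerSeries.coeff 1 σ = 1) {a b c : ℤ} {A α β γ : ℕ}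
    (h : σ ^ 2 = PowerSeries.expand 2 two_ne_zero (σ * (2 * ((a : ℤ⟦X⟧) + (b : ℤ⟦X⟧) * σ))) * σ +
      PowerSeries.expand 2 two_ne_zero σ)
    (ha : (2 : ℤ) ^ α ∣ a) (hα : A ≤ 2 * α) (hb : (2 : ℤ) ^ β ∣ b) (hβ : 2 * A ≤ 2 * β)
    (hc : (2 : ℤ) ^ γ ∣ c) (hγ : A ≤ 2 * γ) (k n : ℕ) :
    (2 : ℤ) ^ (A * (k + 1) / 2) ∣ PowerSeries.coeff n ((uSeries 2)^[k] ((c : ℤ⟦X⟧) * σ)) := by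
  have hU1 : uSeries 2 σ = a * σ + b * σ ^ 2 := by
    have := uSeries_root_two h1 h
    apply mul_left_cancel₀ (ofNat_ne_zero_series 2)
    rw [this]; ring
  have hU2 := uSeries_pow_two h
  have hP : ∀ l j : ℕ, 1 ≤ j → 1 ≤ j + l := fun l j hj => by omega
  have key : ∀ i : ℕ, uSeries 2 (σ ^ (i + 1)) ∈
        lattice 2 σ 2 A (fun j => 1 ≤ j) (A - A * (i + 1 : ℕ)) ∧
      uSeries 2 (σ ^ (i + 2)) ∈ lattice 2 σ 2 A (fun j => 1 ≤ j) (A - A * (i + 2 : ℕ)) := by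
    -- The term 2aσ of the recurrence preserves the required weight without any divisibility. The
    -- divisibility of a is needed only for U_2(σ) itself; that of b enters in both places.
    have step : ∀ (i : ℕ), uSeries 2 (σ ^ (i + 1)) ∈
        lattice 2 σ 2 A (fun j => 1 ≤ j) (A - A * (i + 1 : ℕ)) →
        ((1 : ℤ) : ℤ⟦X⟧) * σ ^ 1 * uSeries 2 (σ ^ i) ∈
          lattice 2 σ 2 A (fun j => 1 ≤ j) (A - A * (i + 2 : ℕ)) →
        uSeries 2 (σ ^ (i + 2)) ∈ lattice 2 σ 2 A (fun j => 1 ≤ j) (A - A * (i + 2 : ℕ)) := by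
      intro i h1 h2
      have e : uSeries 2 (σ ^ (i + 2)) = ((2 * a : ℤ) : ℤ⟦X⟧) * σ ^ 1 * uSeries 2 (σ ^ (i + 1)) +
          ((2 * b : ℤ) : ℤ⟦X⟧) * σ ^ 2 * uSeries 2 (σ ^ (i + 1)) +
          ((1 : ℤ) : ℤ⟦X⟧) * σ ^ 1 * uSeries 2 (σ ^ i) := by
        rw [hU2]; push_cast; ring
      rw [e]
      refine add_mem (add_mem ?_ ?_) h2
      · exact lattice.mul_mem 0 1 (by simp) (hP 1) (by push_cast; linarith) h1
      · refine lattice.mul_mem β 2 (hb.mul_left 2) (hP 2) ?_ h1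
        push_cast
        nlinarith [(by exact_mod_cast hβ : (2 * A : ℤ) ≤ 2 * β)]
    intro i
    induction i with
    | zero =>
      have h0 : uSeries 2 (σ ^ (0 + 1)) ∈
          lattice 2 σ 2 A (fun j => 1 ≤ j) (A - A * (0 + 1 : ℕ)) := by
        rw [zero_add, pow_one, hU1]
        have e : (a : ℤ⟦X⟧) * σ + (b : ℤ⟦X⟧) * σ ^ 2 = (a : ℤ⟦X⟧) * σ ^ 1 + (b : ℤ⟦X⟧) * σ ^ 2 := by
          rw [pow_one]
        rw [e]
        refine add_mem (lattice.monomial_mem α 1 ha le_rfl ?_)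
          (lattice.monomial_mem β 2 hb (by norm_num) ?_)
        · push_cast; linarith [(by exact_mod_cast hα : (A : ℤ) ≤ 2 * α)]
        · push_cast; linarith [(by exact_mod_cast hβ : (2 * A : ℤ) ≤ 2 * β)]
      refine ⟨h0, step 0 h0 ?_⟩
      rw [pow_zero, uSeries_one two_ne_zero, mul_one]
      exact lattice.monomial_mem 0 1 (by simp) le_rfl (by push_cast; linarith)
    | succ i ih =>
      refine ⟨ih.2, step (i + 1) ih.2 ?_⟩
      exact lattice.mul_mem 0 1 (by simp) (hP 1) (by push_cast; nlinarith) ih.1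
  have h0 : (c : ℤ⟦X⟧) * σ ∈ lattice 2 σ 2 A (fun j => 1 ≤ j) 0 := by
    have := lattice.monomial_mem (σ := σ) (D := 2) (A := A) (P := fun j => 1 ≤ j) (w := 0) γ 1 hc
      le_rfl (by push_cast; linarith [(by exact_mod_cast hγ : (A : ℤ) ≤ 2 * γ)])
    rwa [pow_one] at this
  have h2 := lattice.uSeries_iterate_mem (δ := A) (fun i hi => by
    obtain ⟨i, rfl⟩ := Nat.exists_eq_succ_of_ne_zero (by omega : i ≠ 0)
    exact (key i).1) h0 k
  refine lattice.dvd_coeff h2 ?_ n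
  -- Since j ≥ 1, the inequality A·j + A·k ≤ 2e gives e ≥ A(k + 1)/2: the weight of σ itself
  -- accounts for the extra step.
  intro j e hj he
  rw [Nat.div_le_iff_le_mul_add_pred two_pos]
  have hj' : (1 : ℤ) ≤ j := by exact_mod_cast hj
  zify
  push_cast at he
  nlinarith [(by positivity : (0 : ℤ) ≤ A)]

/-- Divisibility of iterates of `U_3` for the modular equation of `6+2`. -/
theorem dvd_coeff_iterate_three {σ : ℤ⟦X⟧} (h1 : PowerSeries.coeff 1 σ = 1)
    (h : σ ^ 3 = PowerSeries.expand 3 three_ne_zero (σ * (54 + 972 * σ + 6561 * σ ^ 2)) * σ ^ 2 +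
      PowerSeries.expand 3 three_ne_zero (σ * (12 + 81 * σ)) * σ +
      PowerSeries.expand 3 three_ne_zero σ) (k n : ℕ) :
    (3 : ℤ) ^ (3 * (k + 1) / 2) ∣
      PowerSeries.coeff n ((uSeries 3)^[k] (((-27 : ℤ) : ℤ⟦X⟧) * σ)) := by
  obtain ⟨hU1, hU2⟩ := uSeries_root_three h1 h
  have hU3 := uSeries_pow_three h
  have hP : ∀ l j : ℕ, 1 ≤ j → 1 ≤ j + l := fun l j hj => by omega
  have e1 : uSeries 3 (σ ^ 1) = ((18 : ℤ) : ℤ⟦X⟧) * σ ^ 1 + ((324 : ℤ) : ℤ⟦X⟧) * σ ^ 2 +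
      ((2187 : ℤ) : ℤ⟦X⟧) * σ ^ 3 := by
    apply mul_left_cancel₀ (ofNat_ne_zero_series 3)
    rw [pow_one, hU1]
    push_cast
    ring
  -- One third of u² + 2v for u = 54σ + 972σ² + 6561σ³ and v = 12σ + 81σ².
  have e2 : uSeries 3 (σ ^ 2) = ((8 : ℤ) : ℤ⟦X⟧) * σ ^ 1 + ((1026 : ℤ) : ℤ⟦X⟧) * σ ^ 2 +
      ((34992 : ℤ) : ℤ⟦X⟧) * σ ^ 3 + ((551124 : ℤ) : ℤ⟦X⟧) * σ ^ 4 +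
      ((4251528 : ℤ) : ℤ⟦X⟧) * σ ^ 5 + ((14348907 : ℤ) : ℤ⟦X⟧) * σ ^ 6 := by
    apply mul_left_cancel₀ (ofNat_ne_zero_series 3)
    rw [hU2]
    push_cast
    ring
  let L : ℕ → AddSubgroup ℤ⟦X⟧ := fun i => lattice 3 σ 2 3 (fun j => 1 ≤ j) (3 - 3 * i)
  have step : ∀ i : ℕ, ((1 : ℤ) : ℤ⟦X⟧) * σ ^ 1 * uSeries 3 (σ ^ i) ∈ L (i + 3) →
      uSeries 3 (σ ^ (i + 1)) ∈ L (i + 1) → uSeries 3 (σ ^ (i + 2)) ∈ L (i + 2) →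
      uSeries 3 (σ ^ (i + 3)) ∈ L (i + 3) := by
    intro i m0 m1 m2
    have e : uSeries 3 (σ ^ (i + 3)) =
        ((54 : ℤ) : ℤ⟦X⟧) * σ ^ 1 * uSeries 3 (σ ^ (i + 2)) +
        ((972 : ℤ) : ℤ⟦X⟧) * σ ^ 2 * uSeries 3 (σ ^ (i + 2)) +
        ((6561 : ℤ) : ℤ⟦X⟧) * σ ^ 3 * uSeries 3 (σ ^ (i + 2)) +
        ((12 : ℤ) : ℤ⟦X⟧) * σ ^ 1 * uSeries 3 (σ ^ (i + 1)) +
        ((81 : ℤ) : ℤ⟦X⟧) * σ ^ 2 * uSeries 3 (σ ^ (i + 1)) +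
        ((1 : ℤ) : ℤ⟦X⟧) * σ ^ 1 * uSeries 3 (σ ^ i) := by
      rw [hU3]; push_cast; ring
    rw [e]
    refine add_mem (add_mem (add_mem (add_mem (add_mem ?_ ?_) ?_) ?_) ?_) m0
    · exact lattice.mul_mem 3 1 (by norm_num) (hP 1) (by push_cast; linarith) m2
    · exact lattice.mul_mem 5 2 (by norm_num) (hP 2) (by push_cast; linarith) m2
    · exact lattice.mul_mem 8 3 (by norm_num) (hP 3) (by push_cast; linarith) m2
    · exact lattice.mul_mem 1 1 (by norm_num) (hP 1) (by push_cast; linarith) m1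
    · exact lattice.mul_mem 4 2 (by norm_num) (hP 2) (by push_cast; linarith) m1
  have key : ∀ i : ℕ, uSeries 3 (σ ^ (i + 1)) ∈ L (i + 1) ∧ uSeries 3 (σ ^ (i + 2)) ∈ L (i + 2) ∧
      uSeries 3 (σ ^ (i + 3)) ∈ L (i + 3) := by
    intro i
    induction i with
    | zero =>
      have m1 : uSeries 3 (σ ^ (0 + 1)) ∈ L (0 + 1) := by
        rw [zero_add, e1]
        refine add_mem (add_mem ?_ ?_) ?_
        · exact lattice.monomial_mem 2 1 (by norm_num) (by norm_num) (by norm_num)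
        · exact lattice.monomial_mem 4 2 (by norm_num) (by norm_num) (by norm_num)
        · exact lattice.monomial_mem 7 3 (by norm_num) (by norm_num) (by norm_num)
      have m2 : uSeries 3 (σ ^ (0 + 2)) ∈ L (0 + 2) := by
        rw [zero_add, e2]
        refine add_mem (add_mem (add_mem (add_mem (add_mem ?_ ?_) ?_) ?_) ?_) ?_
        · exact lattice.monomial_mem 0 1 (by norm_num) (by norm_num) (by norm_num)
        · exact lattice.monomial_mem 3 2 (by norm_num) (by norm_num) (by norm_num)
        · exact lattice.monomial_mem 7 3 (by norm_num) (by norm_num) (by norm_num)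
        · exact lattice.monomial_mem 9 4 (by norm_num) (by norm_num) (by norm_num)
        · exact lattice.monomial_mem 12 5 (by norm_num) (by norm_num) (by norm_num)
        · exact lattice.monomial_mem 15 6 (by norm_num) (by norm_num) (by norm_num)
      refine ⟨m1, m2, step 0 ?_ m1 m2⟩
      rw [pow_zero, uSeries_one three_ne_zero, mul_one]
      exact lattice.monomial_mem 0 1 (by simp) le_rfl (by norm_num)
    | succ i ih =>
      refine ⟨ih.2.1, ih.2.2, step (i + 1) ?_ ih.2.1 ih.2.2⟩
      exact lattice.mul_mem 0 1 (by simp) (hP 1) (by push_cast; linarith) ih.1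
  have h0 : ((-27 : ℤ) : ℤ⟦X⟧) * σ ^ 1 ∈ lattice 3 σ 2 3 (fun j => 1 ≤ j) 0 :=
    lattice.monomial_mem 3 1 (by norm_num) le_rfl (by norm_num)
  rw [pow_one] at h0
  have h2 := lattice.uSeries_iterate_mem (δ := 3) (fun i hi => by
    obtain ⟨i, rfl⟩ := Nat.exists_eq_succ_of_ne_zero (by omega : i ≠ 0)
    exact (key i).1) h0 k
  refine lattice.dvd_coeff h2 ?_ n
  intro j e hj he
  push_cast at he
  omega

/-- Divisibility of iterates of `U_3` for the modular equation of `24|4+2`. -/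
theorem dvd_coeff_iterate_three_of_fourth_root {σ : ℤ⟦X⟧} (h1 : PowerSeries.coeff 1 σ = 1)
    (h : σ ^ 3 = PowerSeries.expand 3 three_ne_zero (σ * (9 * σ ^ 2)) * σ ^ 2 +
      PowerSeries.expand 3 three_ne_zero (σ * (3 * σ)) * σ +
      PowerSeries.expand 3 three_ne_zero σ) (k n : ℕ) :
    (3 : ℤ) ^ (1 * (k + 1) / 2) ∣
      PowerSeries.coeff n ((uSeries 3)^[k] (((-1 : ℤ) : ℤ⟦X⟧) * σ)) := by
  obtain ⟨hU1, hU2⟩ := uSeries_root_three h1 h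
  have hU3 := uSeries_pow_three h
  have e1 : uSeries 3 (σ ^ 1) = ((3 : ℤ) : ℤ⟦X⟧) * σ ^ 3 := by
    apply mul_left_cancel₀ (ofNat_ne_zero_series 3)
    rw [pow_one, hU1]
    push_cast
    ring
  have e2 : uSeries 3 (σ ^ 2) = ((2 : ℤ) : ℤ⟦X⟧) * σ ^ 2 + ((27 : ℤ) : ℤ⟦X⟧) * σ ^ 6 := by
    apply mul_left_cancel₀ (ofNat_ne_zero_series 3)
    rw [hU2]
    push_cast
    ring
  have e3 : ∀ i, uSeries 3 (σ ^ (i + 3)) =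
      ((9 : ℤ) : ℤ⟦X⟧) * σ ^ 3 * uSeries 3 (σ ^ (i + 2)) +
      ((3 : ℤ) : ℤ⟦X⟧) * σ ^ 2 * uSeries 3 (σ ^ (i + 1)) +
      ((1 : ℤ) : ℤ⟦X⟧) * σ ^ 1 * uSeries 3 (σ ^ i) := by
    intro i
    rw [hU3]; push_cast; ring
  -- Parity is essential. The equation preserves the parity of exponents, and odd powers gain weight
  -- 2 out of D = 4 per step, whereas the term 2σ² of U_3(σ²) prevents any gain on even powers. The
  -- induction runs over both because the recurrence mixes them.
  let O : ℕ → AddSubgroup ℤ⟦X⟧ := fun i => lattice 3 σ 4 1 Odd (2 - (1 : ℕ) * i)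
  let E : ℕ → AddSubgroup ℤ⟦X⟧ := fun i => lattice 3 σ 4 1 Even (-i)
  have key : ∀ i : ℕ, uSeries 3 (σ ^ (2 * i)) ∈ E (2 * i) ∧
      uSeries 3 (σ ^ (2 * i + 1)) ∈ O (2 * i + 1) ∧
      uSeries 3 (σ ^ (2 * i + 2)) ∈ E (2 * i + 2) := by
    intro i
    induction i with
    | zero =>
      refine ⟨?_, ?_, ?_⟩
      · have := lattice.monomial_mem (p := 3) (σ := σ) (D := 4) (A := 1) (P := Even) (w := 0) 0 0
          (c := 1) (by norm_num) (by norm_num) (by norm_num)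
        simpa [uSeries_one three_ne_zero, E] using this
      · rw [mul_zero, zero_add, e1]
        exact lattice.monomial_mem 1 3 (by norm_num) (by decide) (by norm_num)
      · rw [mul_zero, zero_add, e2]
        exact add_mem (lattice.monomial_mem 0 2 (by norm_num) (by decide) (by norm_num))
          (lattice.monomial_mem 3 6 (by norm_num) (by decide) (by norm_num))
    | succ i ih =>
      obtain ⟨m0, m1, m2⟩ := ih
      have m3 : uSeries 3 (σ ^ (2 * i + 3)) ∈ O (2 * i + 3) := by
        rw [e3]
        refine add_mem (add_mem ?_ ?_) ?_
        · exact lattice.mul_mem 2 3 (by norm_num) (fun j hj => hj.add_odd (by decide))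
            (by push_cast; linarith) m2
        · exact lattice.mul_mem 1 2 (by norm_num) (fun j hj => hj.add_even (by decide))
            (by push_cast; linarith) m1
        · exact lattice.mul_mem 0 1 (by norm_num) (fun j hj => hj.add_odd (by decide))
            (by push_cast; linarith) m0
      refine ⟨m2, m3, ?_⟩
      have e4 := e3 (2 * i + 1)
      rw [show 2 * i + 1 + 3 = 2 * (i + 1) + 2 by ring] at e4
      rw [e4]
      refine add_mem (add_mem ?_ ?_) ?_
      · exact lattice.mul_mem 2 3 (by norm_num) (fun j hj => hj.add_odd (by decide))
          (by push_cast; linarith) m3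
      · exact lattice.mul_mem 1 2 (by norm_num) (fun j hj => hj.add (by decide))
          (by push_cast; linarith) m2
      · exact lattice.mul_mem 0 1 (by norm_num) (fun j hj => hj.add_odd (by decide))
          (by push_cast; linarith) m1
  -- The starting weight is -1, since σ carries no power of 3. After k steps 4e ≥ j + 2k - 1 ≥ 2k,
  -- so e ≥ k/2, and rounding up gives (k + 1)/2 in natural division.
  have h0 : ((-1 : ℤ) : ℤ⟦X⟧) * σ ^ 1 ∈ lattice 3 σ 4 1 Odd (-1) :=
    lattice.monomial_mem 0 1 (by norm_num) (by decide) (by norm_num)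
  rw [pow_one] at h0
  have h2 := lattice.uSeries_iterate_mem (δ := 2) (fun i hi => by
    obtain ⟨i, rfl⟩ := hi
    exact (key i).2.1) h0 k
  refine lattice.dvd_coeff h2 ?_ n
  intro j e hj he
  have := hj.pos
  push_cast at he
  omega

/-! ### Modular equations from finitely many coefficients -/

lemma coeff_intCast_mul (c : ℤ) (F : ℤ⟦X⟧) (n : ℕ) :
    PowerSeries.coeff n ((c : ℤ⟦X⟧) * F) = c * PowerSeries.coeff n F := by
  rw [← zsmul_eq_mul, map_zsmul, smul_eq_mul]

/-- The coefficients of `t` and `s = 1 / t`, up to order ten. -/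
structure CoeffLists (p M R : ℕ) (f s : List ℤ) : Prop where
  length_f : f.length = 10
  length_s : s.length = 10
  f_eq : mulList f (powList (expandList p (etaNumList M)) R) = powList (etaNumList M) R
  s_eq : mulList s f = [0, 1, 0, 0, 0, 0, 0, 0, 0, 0]

namespace CoeffLists

variable {p M R : ℕ} {f s : List ℤ}

lemma hasCoeffs_f (H : CoeffLists p M R f s) (hp : p ≠ 0) (hM : M ≠ 0) :
    HasCoeffs (fSeries p M 1 R hp hM one_ne_zero) f :=
  hasCoeffs_fSeries hp hM H.length_f H.f_eq

lemma hasCoeffs_s (H : CoeffLists p M R f s) (hp : p ≠ 0) (hM : M ≠ 0) :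
    HasCoeffs (sSeries p M R hp hM) s :=
  hasCoeffs_sSeries hp hM H.length_s H.length_f (H.hasCoeffs_f hp hM) H.s_eq

theorem modular_equation_two (H : CoeffLists 2 M R f s) (A : Params 2 M 1 R)
    (ht : ALInvariant 2 M (fFun 2 M 1 R)) {a b : ℤ}
    (h : ∀ m < 3, 2 * s.getD (2 * m) 0 = a * s.getD m 0 + b * (powList s 2).getD m 0) :
    sSeries 2 M R A.p_ne A.M_ne ^ 2 =
      ((a : ℤ⟦X⟧) * PowerSeries.expand 2 two_ne_zero (sSeries 2 M R A.p_ne A.M_ne) +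
        (b : ℤ⟦X⟧) * PowerSeries.expand 2 two_ne_zero (sSeries 2 M R A.p_ne A.M_ne) ^ 2) *
        sSeries 2 M R A.p_ne A.M_ne +
      PowerSeries.expand 2 two_ne_zero (sSeries 2 M R A.p_ne A.M_ne) := by
  refine Moonshine.modular_equation_two A ht ?_
  have hs := H.hasCoeffs_s A.p_ne A.M_ne
  have hs2 := hs.pow 2
  have hl := H.length_s
  rw [PowerSeries.X_pow_dvd_iff]
  intro m hm
  have h1 := coeff_intCast_mul 2 (uSeries 2 (sSeries 2 M R A.p_ne A.M_ne)) m
  push_cast at h1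
  rw [map_sub, map_add, coeff_intCast_mul, coeff_intCast_mul, h1, uSeries, PowerSeries.coeff_mk,
    hs _ (by omega), hs _ (by omega), hs2 _ (by rw [length_powList]; omega), h m hm, sub_self]

theorem modular_equation_three (H : CoeffLists 3 M R f s) (A : Params 3 M 1 R)
    (ht : ALInvariant 3 M (fFun 3 M 1 R)) {a b c d e : ℤ}
    (h : ∀ m < 4, 3 * s.getD (3 * m) 0 = a * s.getD m 0 + b * (powList s 2).getD m 0 +
      c * (powList s 3).getD m 0)
    (h' : ∀ m < 2, 3 * f.getD (3 * m + 1) 0 + ((if m = 0 then d else 0) + e * s.getD m 0) = 0) :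
    sSeries 3 M R A.p_ne A.M_ne ^ 3 =
      ((a : ℤ⟦X⟧) * PowerSeries.expand 3 three_ne_zero (sSeries 3 M R A.p_ne A.M_ne) +
        (b : ℤ⟦X⟧) * PowerSeries.expand 3 three_ne_zero (sSeries 3 M R A.p_ne A.M_ne) ^ 2 +
        (c : ℤ⟦X⟧) * PowerSeries.expand 3 three_ne_zero (sSeries 3 M R A.p_ne A.M_ne) ^ 3) *
        sSeries 3 M R A.p_ne A.M_ne ^ 2 +
      ((d : ℤ⟦X⟧) * PowerSeries.expand 3 three_ne_zero (sSeries 3 M R A.p_ne A.M_ne) +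
        (e : ℤ⟦X⟧) * PowerSeries.expand 3 three_ne_zero (sSeries 3 M R A.p_ne A.M_ne) ^ 2) *
        sSeries 3 M R A.p_ne A.M_ne +
      PowerSeries.expand 3 three_ne_zero (sSeries 3 M R A.p_ne A.M_ne) := by
  have hf := H.hasCoeffs_f A.p_ne A.M_ne
  have hs := H.hasCoeffs_s A.p_ne A.M_ne
  have hs2 := hs.pow 2
  have hs3 := hs.pow 3
  have hl := H.length_s
  have hl' := H.length_f
  refine Moonshine.modular_equation_three A ht ?_ ?_ <;> rw [PowerSeries.X_pow_dvd_iff] <;>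
    intro m hm
  · have h1 := coeff_intCast_mul 3 (uSeries 3 (sSeries 3 M R A.p_ne A.M_ne)) m
    push_cast at h1
    rw [map_sub, map_add, map_add, coeff_intCast_mul, coeff_intCast_mul, coeff_intCast_mul, h1,
      uSeries, PowerSeries.coeff_mk, hs _ (by omega), hs _ (by omega),
      hs2 _ (by rw [length_powList]; omega), hs3 _ (by rw [length_powList]; omega), h m hm, sub_self]
  · have h1 := coeff_intCast_mul 3 (uSeries 3 (PowerSeries.mk fun n =>
      PowerSeries.coeff (n + 1) (fSeries 3 M 1 R A.p_ne A.M_ne one_ne_zero))) m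
    have h2 := coeff_intCast_mul d 1 m
    rw [mul_one, PowerSeries.coeff_one, mul_ite, mul_one, mul_zero] at h2
    push_cast at h1
    rw [map_add, map_add, coeff_intCast_mul, h1, h2, uSeries, PowerSeries.coeff_mk,
      PowerSeries.coeff_mk, hf _ (by omega), hs _ (by omega), h' m hm]

end CoeffLists

lemma coeffLists_six_plus_three : CoeffLists 2 3 6
    [1, -6, 15, -32, 87, -192, 343, -672, 1290, -2176]
    [0, 1, 6, 21, 68, 198, 510, 1248, 2904, 6393] := by
  constructor <;> decide +kernel

lemma coeffLists_ten_plus_five : CoeffLists 2 5 4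
    [1, -4, 6, -8, 17, -32, 54, -80, 116, -192]
    [0, 1, 4, 10, 24, 51, 104, 206, 384, 697] := by
  constructor <;> decide +kernel

lemma coeffLists_twentyTwo_plus_eleven : CoeffLists 2 11 2
    [1, -2, 1, -2, 4, -4, 5, -6, 9, -12]
    [0, 1, 2, 3, 6, 9, 14, 22, 32, 46] := by
  constructor <;> decide +kernel

lemma coeffLists_two : CoeffLists 2 1 12
    [1, -24, 276, -2048, 11202, -49152, 184024, -614400, 1881471, -5373952]
    [0, 1, 24, 300, 2624, 18126, 105504, 538296, 2471424, 10400997] := by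
  constructor <;> decide +kernel

lemma coeffLists_six_plus_two : CoeffLists 3 2 4
    [1, -4, -2, 28, -27, -52, 136, -108, -162, 620]
    [0, 1, 4, 18, 52, 159, 396, 1004, 2260, 5103] := by
  constructor <;> decide +kernel

/-! ### The `q`-expansion of the Hauptmodul -/

lemma coeff_uSeries_iterate (p k : ℕ) (F : ℤ⟦X⟧) (n : ℕ) :
    PowerSeries.coeff n ((uSeries p)^[k] F) = PowerSeries.coeff (p ^ k * n) F := by
  induction k generalizing n with
  | zero => simp
  | succ k ih =>
    rw [Function.iterate_succ_apply', uSeries, PowerSeries.coeff_mk, ih, pow_succ, mul_assoc]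

lemma opU_iterate (p k : ℕ) (a : ℤ → ℚ) (m : ℤ) : (opU p)^[k] a m = a (p ^ k * m) := by
  induction k generalizing m with
  | zero => simp
  | succ k ih =>
    rw [Function.iterate_succ_apply', opU, ih, pow_succ, mul_assoc]

lemma HasVal.apply_zero {F : ℂ⟦X⟧} {f : ℂ → ℂ} (hF : HasVal F f) :
    f 0 = PowerSeries.constantCoeff F := by
  have h := hF 0 (by simp)
  refine h.unique ?_
  convert hasSum_single 0 fun n hn => ?_ using 1
  · simp
  · rw [zero_pow hn, mul_zero]

/-- The coefficients of `f / q` without its constant term. -/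
def hauptmodulCoeff (f : ℤ⟦X⟧) (m : ℤ) : ℤ :=
  if m < -1 ∨ m = 0 then 0 else PowerSeries.coeff (m + 1).toNat f

lemma le_vSeries {p : ℕ} [Fact p.Prime] {x : ℤ} {N : ℕ} (hx : x ≤ N) {a : ℤ → ℚ}
    (h : ∀ m, ∃ z : ℤ, a m = z ∧ (p : ℤ) ^ N ∣ z) : (((x : ℤ) : ℝ) : EReal) ≤ vSeries p a := by
  refine le_iInf fun m => ?_
  obtain ⟨z, hz, hd⟩ := h m
  split_ifs with h0
  · exact le_top
  · rw [hz] at h0 ⊢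
    rw [padicValRat.of_int]
    have h1 := ((padicValInt_dvd_iff N z).1 hd).resolve_left fun h' => h0 (by rw [h', Int.cast_zero])
    have h2 : x ≤ ((padicValInt p z : ℕ) : ℤ) := hx.trans (by exact_mod_cast h1)
    exact EReal.coe_le_coe_iff.2 (by exact_mod_cast h2)

namespace GroupParams

variable {p M h r : ℕ} {S : Finset ℕ} (A : GroupParams p M h r S)
include A

/-- Rationality is inherited from the integral series of the eta quotient. The additive constant
need not be computed, because normalization prescribes the constant term 0. -/
lemma hasQExpansion_hauptmodul (hI : AdmissibleIndex p M h) {T : ℍ → ℂ}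
    (hT : IsNormalizedHauptmodul (fixingGroup (p * M * h) h S) T) :
    HasQExpansion T fun m => ((hauptmodulCoeff (fSeries p M h r A.p_ne A.M_ne A.h_ne) m : ℚ) : ℂ) := by
  obtain ⟨c, hc⟩ := A.hauptmodul_eq hI hT
  obtain ⟨a, ha, ha1, ha0, hlow⟩ := hT.expansion
  obtain ⟨v, hv, hvT⟩ := ha.exists_hasVal hlow
  have hf := hasVal_fSeries p M h r A.p_ne A.M_ne A.h_ne
  have hs := hf.add ((HasVal.const c).mul HasVal.X)
  have heq : (PowerSeries.mk fun n : ℕ => a (n - 1)) =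
      toC (fSeries p M h r A.p_ne A.M_ne A.h_ne) + PowerSeries.C c * PowerSeries.X := by
    refine hv.unique (hs.congr fun q hq => ?_)
    rcases eq_or_ne q 0 with rfl | hq0
    · rw [hv.apply_zero, hs.apply_zero]
      rw [map_add, ← PowerSeries.coeff_zero_eq_constantCoeff_apply (toC _), PowerSeries.coeff_map,
        PowerSeries.coeff_zero_eq_constantCoeff_apply, constantCoeff_fSeries]
      simp [ha1]
    · obtain ⟨τ, rfl⟩ := exists_qq_eq hq hq0
      rw [hvT, hc, fFun, add_mul, mul_right_comm, inv_mul_cancel₀ (qq_ne_zero τ), one_mul]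
  convert ha using 2 with m
  rw [hauptmodulCoeff]
  split_ifs with hm
  · rcases hm with hm | rfl
    · rw [hlow m hm]; norm_num
    · rw [ha0]; norm_num
  · have h1 := congrArg (PowerSeries.coeff (m + 1).toNat) heq
    have h2 : (((m + 1).toNat : ℕ) : ℤ) - 1 = m := by omega
    rw [PowerSeries.coeff_mk, h2, map_add, PowerSeries.coeff_map, PowerSeries.coeff_C_mul,
      PowerSeries.coeff_X, if_neg (by omega), mul_zero, add_zero] at h1
    rw [h1]
    simp

/-- The conclusion for the Hauptmodul, from divisibility of the coefficients of `U_p^k(c σ)`. -/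
theorem exists_le_vSeries (hI : AdmissibleIndex p M h) {T : ℍ → ℂ}
    (hT : IsNormalizedHauptmodul (fixingGroup (p * M * h) h S) T) {σ : ℤ⟦X⟧} {B : ℕ} {c₀ c : ℤ}
    (hV : tailSeries p (fSeries p M h r A.p_ne A.M_ne A.h_ne) =
      (c₀ : ℤ⟦X⟧) + (c : ℤ⟦X⟧) * σ)
    (hdvd : ∀ k n, (p : ℤ) ^ (B * (k + 1) / 2) ∣
      PowerSeries.coeff n ((uSeries p)^[k] ((c : ℤ⟦X⟧) * σ))) :
    ∃ a : ℤ → ℚ, HasQExpansion T (fun m => (a m : ℂ)) ∧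
      ∀ k : ℕ, (((⌊(k : ℚ) * (B / 2)⌋ : ℤ) : ℝ) : EReal) ≤ vSeries p ((opU p)^[k] a) := by
  have : Fact p.Prime := ⟨A.hp⟩
  refine ⟨fun m => (hauptmodulCoeff (fSeries p M h r A.p_ne A.M_ne A.h_ne) m : ℚ),
    A.hasQExpansion_hauptmodul hI hT, fun k => ?_⟩
  refine le_vSeries (N := B * k / 2) ?_ fun m => ?_
  · rw [← Int.lt_add_one_iff, Int.floor_lt]
    have h1 : B * k < 2 * (B * k / 2 + 1) := by omega
    generalize B * k / 2 = N at *
    have h2 : ((B * k : ℕ) : ℚ) < ((2 * (N + 1) : ℕ) : ℚ) := by exact_mod_cast h1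
    push_cast at h2 ⊢
    linarith
  · rw [opU_iterate]
    refine ⟨_, rfl, ?_⟩
    cases k with
    | zero => simp
    | succ k =>
      rw [hauptmodulCoeff]
      have hp := A.hp.two_le
      have hpk : 2 ≤ p ^ (k + 1) := hp.trans (Nat.le_self_pow (by omega) p)
      split_ifs with hm
      · exact dvd_zero _
      · have hm0 : 0 < m := by
          by_contra! hm'
          rcases hm'.lt_or_eq with h1 | rfl
          · apply hm
            left
            have : (2 : ℤ) ≤ (p : ℤ) ^ (k + 1) := by exact_mod_cast hpk
            nlinarith
          · exact hm (Or.inr (mul_zero _))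
        obtain ⟨n, rfl⟩ := Int.eq_ofNat_of_zero_le hm0.le
        have hn : n ≠ 0 := by omega
        have h1 : ((p : ℤ) ^ (k + 1) * n + 1).toNat = p * (p ^ k * n) + 1 := by
          rw [pow_succ', mul_assoc]
          exact_mod_cast Int.toNat_natCast (p * (p ^ k * n) + 1)
        have h2 := congrArg (PowerSeries.coeff (p ^ k * n)) hV
        rw [tailSeries, PowerSeries.coeff_mk, map_add, ← mul_one (c₀ : ℤ⟦X⟧), coeff_intCast_mul,
          PowerSeries.coeff_one, if_neg (mul_ne_zero (pow_ne_zero _ A.p_ne) hn), mul_zero,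
          zero_add] at h2
        rw [h1, h2, ← coeff_uSeries_iterate]
        exact hdvd k n

end GroupParams

/-! ### The six groups -/

lemma X_mul_invSeries_mul {f : ℤ⟦X⟧} (hf : PowerSeries.constantCoeff f = 1) :
    PowerSeries.X * invSeries f * f = PowerSeries.X := by
  rw [mul_assoc, mul_comm (invSeries f), mul_invSeries hf, mul_one]

lemma fSeries_pow {p M : ℕ} (h r : ℕ) (hp : p ≠ 0) (hM : M ≠ 0) (hh : h ≠ 0) :
    fSeries p M h r hp hM hh ^ h =
      PowerSeries.expand h hh (fSeries p M 1 (h * r) hp hM one_ne_zero) := by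
  rw [fSeries, fSeries, PowerSeries.expand_one, AlgHom.id_apply, ← map_pow, ← pow_mul, mul_comm]

/-- Both sides become X^h after multiplication by f^h, which is nonzero. -/
lemma pow_eq_expand_sSeries {p M : ℕ} (h r : ℕ) (hp : p ≠ 0) (hM : M ≠ 0) (hh : h ≠ 0) :
    (PowerSeries.X * invSeries (fSeries p M h r hp hM hh)) ^ h =
      PowerSeries.expand h hh (sSeries p M (h * r) hp hM) := by
  have h1 := congrArg (· ^ h) (X_mul_invSeries_mul (constantCoeff_fSeries p M h r hp hM hh))
  have h2 := congrArg (PowerSeries.expand h hh) (sSeries_mul_fSeries (R := h * r) hp hM)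
  simp only [mul_pow (PowerSeries.X * _)] at h1
  rw [map_mul, PowerSeries.expand_X, ← fSeries_pow, ← h1] at h2
  have hu : fSeries p M h r hp hM hh ^ h ≠ 0 := by
    intro h0
    have := congrArg PowerSeries.constantCoeff h0
    rw [map_pow, constantCoeff_fSeries, one_pow, map_zero] at this
    exact one_ne_zero this
  exact (mul_right_cancel₀ hu h2).symm

namespace GroupParams

section two

variable {M h r : ℕ} {S : Finset ℕ} {T : ℍ → ℂ}

/-- With g = 2(a + bσ) the tail of f is -(a + bσ). So c = -b, and the divisibility of b also
provides the starting weight. -/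
theorem exists_le_vSeries_two (A : GroupParams 2 M h r S) (hI : AdmissibleIndex 2 M h)
    (hT : IsNormalizedHauptmodul (fixingGroup (2 * M * h) h S) T) {σ : ℤ⟦X⟧}
    (hσ : σ * fSeries 2 M h r A.p_ne A.M_ne A.h_ne = PowerSeries.X) {a b : ℤ} {B α β : ℕ}
    (rel : σ ^ 2 = PowerSeries.expand 2 two_ne_zero (σ * (2 * ((a : ℤ⟦X⟧) + (b : ℤ⟦X⟧) * σ))) * σ +
      PowerSeries.expand 2 two_ne_zero σ)
    (ha : (2 : ℤ) ^ α ∣ a) (hα : B ≤ 2 * α) (hb : (2 : ℤ) ^ β ∣ b) (hβ : B ≤ β) :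
    ∃ a : ℤ → ℚ, HasQExpansion T (fun m => (a m : ℂ)) ∧
      ∀ k : ℕ, (((⌊(k : ℚ) * (B / 2)⌋ : ℤ) : ℝ) : EReal) ≤ vSeries 2 ((opU 2)^[k] a) := by
  have hf := constantCoeff_fSeries 2 M h r A.p_ne A.M_ne A.h_ne
  refine A.exists_le_vSeries hI hT (σ := σ) (c₀ := -a) (c := -b) ?_
    (dvd_coeff_iterate_two (coeff_one_of_mul_eq_X hf hσ) rel ha hα hb (by omega) hb.neg_right
      (by omega))
  apply mul_left_cancel₀ (ofNat_ne_zero_series 2)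
  rw [tailSeries_two hf hσ rel]
  push_cast
  ring

theorem exists_le_vSeries_two_of_coeffLists (A : GroupParams 2 M 1 r S)
    (hT : IsNormalizedHauptmodul (fixingGroup (2 * M * 1) 1 S) T) {f s : List ℤ}
    (H : CoeffLists 2 M r f s) {a b : ℤ} {B α β : ℕ}
    (hs : ∀ m < 3, 2 * s.getD (2 * m) 0 = 2 * a * s.getD m 0 + 2 * b * (powList s 2).getD m 0)
    (ha : (2 : ℤ) ^ α ∣ a) (hα : B ≤ 2 * α) (hb : (2 : ℤ) ^ β ∣ b) (hβ : B ≤ β) :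
    ∃ a : ℤ → ℚ, HasQExpansion T (fun m => (a m : ℂ)) ∧
      ∀ k : ℕ, (((⌊(k : ℚ) * (B / 2)⌋ : ℤ) : ℝ) : EReal) ≤ vSeries 2 ((opU 2)^[k] a) := by
  have ht := A.alInvariant_of_hauptmodul (Or.inl rfl) hT
  rw [one_mul] at ht
  refine A.exists_le_vSeries_two (Or.inl rfl) hT (sSeries_mul_fSeries A.p_ne A.M_ne) ?_ ha hα hb hβ
  have := H.modular_equation_two A.toParams ht hs
  simp only [map_mul, map_add, map_intCast, map_ofNat]
  push_cast at this
  linear_combination this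

end two

theorem exists_le_vSeries_six_bar_three (A : GroupParams 2 1 3 4 ∅) {T : ℍ → ℂ}
    (hT : IsNormalizedHauptmodul (fixingGroup (2 * 1 * 3) 3 ∅) T) :
    ∃ a : ℤ → ℚ, HasQExpansion T (fun m => (a m : ℂ)) ∧
      ∀ k : ℕ, (((⌊(k : ℚ) * ((3 : ℕ) / 2)⌋ : ℤ) : ℝ) : EReal) ≤ vSeries 2 ((opU 2)^[k] a) := by
  have hI : AdmissibleIndex 2 1 3 := Or.inr (Or.inl ⟨rfl, rfl, rfl⟩)
  have ht := A.alInvariant_of_hauptmodul hI hT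
  have hf := constantCoeff_fSeries 2 1 3 4 A.p_ne A.M_ne A.h_ne
  have rel := modular_equation_cube_root hf (X_mul_invSeries_mul hf)
    (pow_eq_expand_sSeries 3 4 A.p_ne A.M_ne A.h_ne) (by
      have := coeffLists_two.modular_equation_two A.base ht (a := 48) (b := 4096) (by decide +kernel)
      push_cast at this
      exact this)
  -- The equation σ² = 16Y²σ + Y corresponds to a = 0 and b = 8. Any α with 3 ≤ 2α serves, because a
  -- vanishes.
  refine A.exists_le_vSeries_two hI hT (X_mul_invSeries_mul hf) (a := 0) (b := 8) (α := 2) (β := 3)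
    ?_ (by norm_num) (by norm_num) (by norm_num) (by norm_num)
  rw [rel]
  simp only [map_mul, map_add, map_intCast, map_ofNat]
  push_cast
  ring

theorem exists_le_vSeries_six_plus_two (A : GroupParams 3 2 1 4 {2}) {T : ℍ → ℂ}
    (hT : IsNormalizedHauptmodul (fixingGroup (3 * 2 * 1) 1 {2}) T) :
    ∃ a : ℤ → ℚ, HasQExpansion T (fun m => (a m : ℂ)) ∧
      ∀ k : ℕ, (((⌊(k : ℚ) * ((3 : ℕ) / 2)⌋ : ℤ) : ℝ) : EReal) ≤ vSeries 3 ((opU 3)^[k] a) := by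
  have ht := A.alInvariant_of_hauptmodul (Or.inl rfl) hT
  rw [one_mul] at ht
  have hf := constantCoeff_fSeries 3 2 1 4 A.p_ne A.M_ne A.h_ne
  have hσ := sSeries_mul_fSeries (R := 4) A.p_ne A.M_ne
  have rel := coeffLists_six_plus_two.modular_equation_three A.toParams ht
    (a := 54) (b := 972) (c := 6561) (d := 12) (e := 81) (by decide +kernel) (by decide +kernel)
  push_cast at rel
  have rel' : sSeries 3 2 4 A.p_ne A.M_ne ^ 3 = PowerSeries.expand 3 three_ne_zero
      (sSeries 3 2 4 A.p_ne A.M_ne * (54 + 972 * sSeries 3 2 4 A.p_ne A.M_ne +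
        6561 * sSeries 3 2 4 A.p_ne A.M_ne ^ 2)) * sSeries 3 2 4 A.p_ne A.M_ne ^ 2 +
      PowerSeries.expand 3 three_ne_zero (sSeries 3 2 4 A.p_ne A.M_ne *
        (12 + 81 * sSeries 3 2 4 A.p_ne A.M_ne)) * sSeries 3 2 4 A.p_ne A.M_ne +
      PowerSeries.expand 3 three_ne_zero (sSeries 3 2 4 A.p_ne A.M_ne) := by
    simp only [map_mul, map_add, map_pow, map_ofNat]
    linear_combination rel
  -- The tail is -(12 + 81σ)/3, which explains c₀ = -4 and c = -27.
  refine A.exists_le_vSeries (Or.inl rfl) hT (c₀ := -4) ?_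
    (dvd_coeff_iterate_three (coeff_one_of_mul_eq_X hf hσ) rel')
  apply mul_left_cancel₀ (ofNat_ne_zero_series 3)
  rw [tailSeries_three hf hσ rel']
  push_cast
  ring

theorem exists_le_vSeries_twentyFour_bar_four_plus_two (A : GroupParams 3 2 4 1 {2}) {T : ℍ → ℂ}
    (hT : IsNormalizedHauptmodul (fixingGroup (3 * 2 * 4) 4 {2}) T) :
    ∃ a : ℤ → ℚ, HasQExpansion T (fun m => (a m : ℂ)) ∧
      ∀ k : ℕ, (((⌊(k : ℚ) * ((1 : ℕ) / 2)⌋ : ℤ) : ℝ) : EReal) ≤ vSeries 3 ((opU 3)^[k] a) := by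
  have hI : AdmissibleIndex 3 2 4 := Or.inr (Or.inr ⟨rfl, rfl, rfl⟩)
  have ht := A.alInvariant_of_hauptmodul hI hT
  have hf := constantCoeff_fSeries 3 2 4 1 A.p_ne A.M_ne A.h_ne
  have hσ := X_mul_invSeries_mul hf
  have rel := modular_equation_fourth_root hf hσ
    (pow_eq_expand_sSeries 4 1 A.p_ne A.M_ne A.h_ne) (by
      have := coeffLists_six_plus_two.modular_equation_three A.base ht
        (a := 54) (b := 972) (c := 6561) (d := 12) (e := 81) (by decide +kernel) (by decide +kernel)
      push_cast at this
      exact this)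
  generalize PowerSeries.X * invSeries (fSeries 3 2 4 1 A.p_ne A.M_ne A.h_ne) = σ at hσ rel
  have rel' : σ ^ 3 = PowerSeries.expand 3 three_ne_zero (σ * (9 * σ ^ 2)) * σ ^ 2 +
      PowerSeries.expand 3 three_ne_zero (σ * (3 * σ)) * σ +
      PowerSeries.expand 3 three_ne_zero σ := by
    simp only [map_mul, map_pow, map_ofNat]
    linear_combination rel
  -- Here the tail is -3σ/3 = -σ, with no constant term.
  refine A.exists_le_vSeries hI hT (c₀ := 0) ?_
    (dvd_coeff_iterate_three_of_fourth_root (coeff_one_of_mul_eq_X hf hσ) rel')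
  apply mul_left_cancel₀ (ofNat_ne_zero_series 3)
  rw [tailSeries_three hf hσ rel']
  push_cast
  ring

end GroupParams

lemma groupParams_of_prime {p M h r : ℕ} (hp : p.Prime) (hM : M.Prime) (hne : M ≠ p)
    (hw : h * r * ((p - 1) * (M + 1)) = 24) : GroupParams p M h r {M} where
  hp := hp
  hM := Or.inr ⟨hM, hne⟩
  weight := hw
  eq_of_mem := by simp
  M_mem := by simp

lemma groupParams_six_bar_three : GroupParams 2 1 3 4 ∅ where
  hp := Nat.prime_two
  hM := Or.inl rfl
  weight := by norm_num
  eq_of_mem := by simp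
  M_mem := Or.inl rfl

end Moonshine

end

theorem proposition4p6 (n h : ℕ) (S : Finset ℕ) (p : ℕ) (α : ℚ)
    (hrow : (n, h, S, p, α) ∈ ([
      (6, 1, {2}, 3, 3 / 2),
      (6, 1, {3}, 2, 1),
      (10, 1, {5}, 2, 3 / 2),
      (22, 1, {11}, 2, 1 / 2),
      (6, 3, ∅, 2, 3 / 2),
      (24, 4, {2}, 3, 1 / 2)] : List (ℕ × ℕ × Finset ℕ × ℕ × ℚ)))
    (T : UpperHalfPlane → ℂ)
    (hT : Moonshine.IsNormalizedHauptmodul (Moonshine.fixingGroup n h S) T) :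
    ∃ a : ℤ → ℚ, Moonshine.HasQExpansion T (fun m => (a m : ℂ)) ∧
      ∀ k : ℕ, (((⌊(k : ℚ) * α⌋ : ℤ) : ℝ) : EReal) ≤
        Moonshine.vSeries p ((Moonshine.opU p)^[k] a) := by
  simp only [List.mem_cons, List.not_mem_nil, or_false, Prod.mk.injEq] at hrow
  rcases hrow with ⟨rfl, rfl, rfl, rfl, rfl⟩ | ⟨rfl, rfl, rfl, rfl, rfl⟩ |
    ⟨rfl, rfl, rfl, rfl, rfl⟩ | ⟨rfl, rfl, rfl, rfl, rfl⟩ | ⟨rfl, rfl, rfl, rfl, rfl⟩ |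
    ⟨rfl, rfl, rfl, rfl, rfl⟩
  · exact (Moonshine.groupParams_of_prime (by norm_num) (by norm_num) (by norm_num)
      (by norm_num)).exists_le_vSeries_six_plus_two hT
  · have := (Moonshine.groupParams_of_prime (p := 2) (M := 3) (h := 1) (r := 6) (by norm_num) (by norm_num)
      (by norm_num) (by norm_num)).exists_le_vSeries_two_of_coeffLists hT
      Moonshine.coeffLists_six_plus_three (a := 6) (b := 32) (B := 2) (α := 1) (β := 5) (by decide +kernel)
      (by norm_num) (by norm_num) (by norm_num) (by norm_num)
    simpa using this
  · exact (Moonshine.groupParams_of_prime (p := 2) (M := 5) (h := 1) (r := 4) (by norm_num) (by norm_num)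
      (by norm_num) (by norm_num)).exists_le_vSeries_two_of_coeffLists hT
      Moonshine.coeffLists_ten_plus_five (a := 4) (b := 8) (B := 3) (α := 2) (β := 3) (by decide +kernel)
      (by norm_num) (by norm_num) (by norm_num) (by norm_num)
  · have := (Moonshine.groupParams_of_prime (p := 2) (M := 11) (h := 1) (r := 2) (by norm_num) (by norm_num)
      (by norm_num) (by norm_num)).exists_le_vSeries_two_of_coeffLists hT
      Moonshine.coeffLists_twentyTwo_plus_eleven (a := 2) (b := 2) (B := 1) (α := 1) (β := 1)
      (by decide +kernel) (by norm_num) (by norm_num) (by norm_num) (by norm_num)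
    simpa using this
  · exact Moonshine.groupParams_six_bar_three.exists_le_vSeries_six_bar_three hT
  · have := (Moonshine.groupParams_of_prime (by norm_num) (by norm_num) (by norm_num)
      (by norm_num)).exists_le_vSeries_twentyFour_bar_four_plus_two hT
    simpa using this
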